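/- Let $\mathfrak{sl}_2[t]=\mathfrak{sl}_2(\mathbb C)\otimes\mathbb C[t]$ be the current algebra, graded by powers of $t$, with $x,h,y$ the standard basis of $\mathfrak{sl}_2$. Let $\mathcal I_{\mathrm{bdd}}$ be the category of $\mathbb Z$-graded $\mathfrak{sl}_2[t]$-modules $V=\bigoplus_{p\in\mathbb Z}V[p]$ (so $(a\otimes t^r)V[s]\subset V[r+s]$) such that $V[p]=0$ for $p\ll0$, $\dim V[p]<\infty$ for all $p$, and $V_\mu=\{v:(h\otimes1)v=\mu v\}$ is zero for all but finitely many $\mu\in\mathbb Z$; morphisms are the $\mathfrak{sl}_2[t]$-homomorphisms of degree zero. For an integer $\lambda\ge0$ the global Weyl module $W(\lambda)$ is the graded $\mathfrak{sl}_2[t]$-module generated by an element $w_\lambda$ of degree $0$ with defining relations $$(x\otimes\mathbb C[t])w_\lambda=0,\qquad (h\otimes1)w_\lambda=\lambda w_\lambda,\qquad (y\otimes1)^{\lambda+1}w_\lambda=0,$$ and $W(\lambda)=0$ for $\lambda<0$. Let $W(\lambda,r)$ be $W(\lambda)$ with its grading shifted by $r$: $W(\lambda,r)[k]=W(\lambda)[k-r]$.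 An object $M$ of $\mathcal I_{\mathrm{bdd}}$ has a filtration by global Weyl modules if there is a finite chain $M=M^0\supset M^1\supset\cdots\supset M^{k+1}=0$ of graded submodules such that for each $0\le s\le k$ there are $\lambda_s\in\mathbb Z_{\ge0}$ and $m_{s,p}\in\mathbb Z_{\ge0}$ $(p\in\mathbb Z)$ with $M^s/M^{s+1}\cong\bigoplus_{p\in\mathbb Z}W(\lambda_s,p)^{\oplus m_{s,p}}$ as graded modules. **Proposition.** For every integer $\lambda\ge0$, the module $W(\lambda)\otimes W(1)$ (with the tensor product grading) is an object of $\mathcal I_{\mathrm{bdd}}$ and has a filtration by global Weyl modules. Explicitly, there is a short exact sequence in $\mathcal I_{\mathrm{bdd}}$ $$0\to\bigoplus_{r=0}^{\lambda}W(\lambda+1,r)\to W(\lambda)\otimes W(1)\to\bigoplus_{r\ge0}W(\lambda-1,r)\to0.$$ -/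

import Mathlib

open scoped TensorProduct DirectSum

noncomputable section

namespace CurrentSl2

attribute [local instance 100] LieRing.ofAssociativeRing

/-- The complex Lie algebra of traceless `2 × 2` matrices. -/
abbrev Sl2 : Type := LieAlgebra.SpecialLinear.sl (Fin 2) ℂ

/-- The current algebra `sl₂[t] = ℂ[t] ⊗ sl₂`, with bracket `[p ⊗ a, q ⊗ b] = pq ⊗ [a, b]`. -/
abbrev Sl2t : Type := Polynomial ℂ ⊗[ℂ] Sl2

/-- The standard basis vector `x = E₁₂` of `sl₂`. -/
def x : Sl2 := LieAlgebra.SpecialLinear.single (0 : Fin 2) 1 (by decide) (1 : ℂ)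

/-- The standard basis vector `y = E₂₁` of `sl₂`. -/
def y : Sl2 := LieAlgebra.SpecialLinear.single (1 : Fin 2) 0 (by decide) (1 : ℂ)

/-- The standard basis vector `h = E₁₁ - E₂₂` of `sl₂`. -/
def h : Sl2 := LieAlgebra.SpecialLinear.singleSubSingle (0 : Fin 2) 1 (1 : ℂ)

/-- The element `a ⊗ t ^ r` of the current algebra. -/
def cur (a : Sl2) (r : ℕ) : Sl2t := (Polynomial.X ^ r : Polynomial ℂ) ⊗ₜ[ℂ] a

/-- The universal enveloping algebra of `sl₂[t]`. -/
abbrev USl2t : Type := UniversalEnvelopingAlgebra ℂ Sl2t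

/-- The canonical map from `sl₂[t]` to its enveloping algebra. -/
abbrev toU : Sl2t →ₗ⁅ℂ⁆ USl2t := UniversalEnvelopingAlgebra.ι ℂ

/-- The graded piece of degree `k` of the enveloping algebra: the span of the products
`(a₁ ⊗ t ^ r₁) ⋯ (aₛ ⊗ t ^ rₛ)` with `r₁ + ⋯ + rₛ = k`. -/
def USl2t.grade (k : ℤ) : Submodule ℂ USl2t :=
  Submodule.span ℂ {u | ∃ l : List (Sl2 × ℕ),
    (((l.map Prod.snd).sum : ℕ) : ℤ) = k ∧ u = (l.map fun p => toU (cur p.1 p.2)).prod}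

/-! ### Graded representations

A grading of a representation `M` is given by its family of graded pieces
`ℤ → Submodule ℂ M`. -/

section Graded

variable {M : Type} [AddCommGroup M] [Module ℂ M] [LieRingModule Sl2t M] [LieModule ℂ Sl2t M]
variable {N : Type} [AddCommGroup N] [Module ℂ N] [LieRingModule Sl2t N] [LieModule ℂ Sl2t N]

/-- `M` is a `ℤ`-graded representation of `sl₂[t]` with graded pieces `V r`. -/
structure IsGradedRep (V : ℤ → Submodule ℂ M) : Prop where
  isInternal : DirectSum.IsInternal V
  lie_mem : ∀ (a : Sl2) (r : ℕ) (s : ℤ) (v : M), v ∈ V s → ⁅cur a r, v⁆ ∈ V ((r : ℤ) + s)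

/-- `M`, with graded pieces `V r`, is an object of the category `I_bdd`: a graded representation
whose graded pieces are finite-dimensional and vanish in all sufficiently negative degrees, and
whose set of (integral) weights is finite. -/
structure IsBddObject (V : ℤ → Submodule ℂ M) : Prop extends IsGradedRep V where
  bounded : ∃ p₀ : ℤ, ∀ p < p₀, V p = ⊥
  finite : ∀ p : ℤ, FiniteDimensional ℂ (V p)
  weights : {μ : ℤ | ∃ v : M, v ≠ 0 ∧ ⁅cur h 0, v⁆ = (μ : ℂ) • v}.Finite

/-- The grade shift: `shift r V` has degree `k` piece `V (k - r)`. -/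
def shift (r : ℤ) (V : ℤ → Submodule ℂ M) (k : ℤ) : Submodule ℂ M := V (k - r)

/-- The grading of a tensor product: in degree `k` it is the sum of the `V a ⊗ W (k - a)`. -/
def tensorGrade (V : ℤ → Submodule ℂ M) (W : ℤ → Submodule ℂ N) (k : ℤ) :
    Submodule ℂ (M ⊗[ℂ] N) :=
  ⨆ a : ℤ, Submodule.map₂ (TensorProduct.mk ℂ M N) (V a) (W (k - a))

/-- The grading of a direct sum: an element has degree `k` if all its components have. -/
def sumGrade {ι : Type} {P : ι → Type} [∀ i, AddCommGroup (P i)] [∀ i, Module ℂ (P i)]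
    (V : ∀ i, ℤ → Submodule ℂ (P i)) (k : ℤ) : Submodule ℂ (⨁ i, P i) :=
  ⨅ i, (V i k).comap (DirectSum.component ℂ ι P i)

/-- The induced family of subspaces on a subrepresentation. -/
def subGrade (V : ℤ → Submodule ℂ M) (F : LieSubmodule ℂ Sl2t M) (k : ℤ) : Submodule ℂ F :=
  (V k).comap (F : Submodule ℂ M).subtype

/-- The induced family of subspaces on a quotient representation. -/
def quotGrade (V : ℤ → Submodule ℂ M) (F : LieSubmodule ℂ Sl2t M) (k : ℤ) :
    Submodule ℂ (M ⧸ F) :=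
  (V k).map (LieSubmodule.Quotient.mk' F : M →ₗ[ℂ] M ⧸ F)

/-- A subrepresentation is graded if it is the sum of its intersections with the graded pieces. -/
def IsGradedSub (V : ℤ → Submodule ℂ M) (F : LieSubmodule ℂ Sl2t M) : Prop :=
  (F : Submodule ℂ M) = ⨆ k : ℤ, (F : Submodule ℂ M) ⊓ V k

/-- A homomorphism of representations is a morphism of graded representations if it has
degree zero. -/
def IsDegreeZero (V : ℤ → Submodule ℂ M) (W : ℤ → Submodule ℂ N) (f : M →ₗ⁅ℂ,Sl2t⁆ N) : Prop :=
  ∀ (k : ℤ) (v : M), v ∈ V k → f v ∈ W k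

/-- Isomorphism of graded representations. -/
def GradedIso (V : ℤ → Submodule ℂ M) (W : ℤ → Submodule ℂ N) : Prop :=
  ∃ e : M ≃ₗ⁅ℂ,Sl2t⁆ N, ∀ (k : ℤ) (v : M), v ∈ V k ↔ e v ∈ W k

/-- `0 → M → N → P → 0` is a short exact sequence in the category `I_bdd`. -/
structure IsShortExact {P : Type} [AddCommGroup P] [Module ℂ P] [LieRingModule Sl2t P]
    [LieModule ℂ Sl2t P] (U : ℤ → Submodule ℂ M) (V : ℤ → Submodule ℂ N)
    (W : ℤ → Submodule ℂ P) (f : M →ₗ⁅ℂ,Sl2t⁆ N) (g : N →ₗ⁅ℂ,Sl2t⁆ P) : Prop where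
  left_obj : IsBddObject U
  mid_obj : IsBddObject V
  right_obj : IsBddObject W
  left_deg : IsDegreeZero U V f
  right_deg : IsDegreeZero V W g
  injective : Function.Injective f
  exact : Function.Exact f g
  surjective : Function.Surjective g

end Graded

/-! ### Global Weyl modules -/

/-- The left ideal generated by the defining relations of the global Weyl module `W(m)`:
`x ⊗ ℂ[t]`, `h ⊗ 1 - m` and `(y ⊗ 1) ^ (m + 1)`.  For `m < 0` the last exponent is read as `0`,
so the ideal is everything, in accordance with the convention `W(m) = 0` for `m < 0`. -/
def weylIdeal (m : ℤ) : Ideal USl2t :=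
  Ideal.span (Set.range (fun p : Polynomial ℂ => toU (p ⊗ₜ[ℂ] x)) ∪
    {toU (cur h 0) - algebraMap ℂ USl2t (m : ℂ), toU (cur y 0) ^ (m + 1).toNat})

/-- The global Weyl module `W(m)`, the cyclic `sl₂[t]`-module with generator the class of `1`
and the relations above. -/
def GlobalWeyl (m : ℤ) : Type := USl2t ⧸ weylIdeal m

namespace GlobalWeyl

variable (m : ℤ)

instance : AddCommGroup (GlobalWeyl m) := inferInstanceAs (AddCommGroup (USl2t ⧸ weylIdeal m))

instance : Module USl2t (GlobalWeyl m) := inferInstanceAs (Module USl2t (USl2t ⧸ weylIdeal m))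

instance : Module ℂ (GlobalWeyl m) := inferInstanceAs (Module ℂ (USl2t ⧸ weylIdeal m))

instance : IsScalarTower ℂ USl2t (GlobalWeyl m) :=
  inferInstanceAs (IsScalarTower ℂ USl2t (USl2t ⧸ weylIdeal m))

/-- `sl₂[t]` acts through the enveloping algebra. -/
instance : LieRingModule Sl2t (GlobalWeyl m) where
  bracket a w := toU a • w
  add_lie a b w := by simp only [map_add, add_smul]
  lie_add a v w := smul_add _ _ _
  leibniz_lie a b w := by
    simp only [LieHom.map_lie, Ring.lie_def, sub_smul, mul_smul, sub_add_cancel]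

theorem lie_def (a : Sl2t) (w : GlobalWeyl m) : ⁅a, w⁆ = toU a • w := rfl

instance : LieModule ℂ Sl2t (GlobalWeyl m) where
  smul_lie c a w := by simp only [lie_def, map_smul, smul_assoc]
  lie_smul c a w := by
    rw [lie_def, lie_def, ← algebraMap_smul USl2t c w, ← algebraMap_smul USl2t c (toU a • w),
      ← mul_smul, ← mul_smul, Algebra.commutes]

/-- The quotient map from the enveloping algebra, `u ↦ u w_m`. -/
def mk : USl2t →ₗ[USl2t] GlobalWeyl m := (weylIdeal m).mkQ

/-- The grading of `W(m)` in which the generator has degree zero. -/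
def grade (k : ℤ) : Submodule ℂ (GlobalWeyl m) :=
  (USl2t.grade k).map ((mk m).restrictScalars ℂ)

end GlobalWeyl

/-- The grading of `⨁ i, W(m, d i)`, where `W(m, r)` is `W(m)` with its grading shifted by `r`. -/
def weylSumGrade {ι : Type} (m : ℤ) (d : ι → ℤ) :
    ℤ → Submodule ℂ (⨁ _ : ι, GlobalWeyl m) :=
  sumGrade fun i => shift (d i) (GlobalWeyl.grade m)

/-- An object of `I_bdd` has a filtration by global Weyl modules: there is a finite decreasing
chain `M = F 0 ⊇ F 1 ⊇ ⋯ ⊇ F (k + 1) = 0` of graded submodules such that each `F s / F (s + 1)`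
is isomorphic, as a graded representation, to `⨁ p : ℤ, W(l, p) ^ (c p)` for some `l : ℕ` and some
multiplicities `c p : ℕ`. -/
def HasGlobalWeylFiltration {M : Type} [AddCommGroup M] [Module ℂ M] [LieRingModule Sl2t M]
    [LieModule ℂ Sl2t M] (V : ℤ → Submodule ℂ M) : Prop :=
  IsBddObject V ∧ ∃ (k : ℕ) (F : ℕ → LieSubmodule ℂ Sl2t M),
    F 0 = ⊤ ∧ F (k + 1) = ⊥ ∧ Antitone F ∧ (∀ s, IsGradedSub V (F s)) ∧
    ∀ s ≤ k, ∃ (l : ℕ) (c : ℤ → ℕ),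
      GradedIso (quotGrade (subGrade V (F s)) ((F (s + 1)).comap (F s).incl))
        (weylSumGrade (l : ℤ) (fun i : (Σ p : ℤ, Fin (c p)) => i.1))

end CurrentSl2

end

/-!
The proof takes place inside symmetric algebras. Let `S` be the symmetric algebra of `ℂ² ⊗ ℂ[t]`
(`SymV`), on which `sl₂[t]` acts by derivations, and let `v` be the highest weight vector of `ℂ²`.
Sending the generator to `vⁿ` embeds the global Weyl module `W(n)` into `S`, with image the
homogeneous elements of degree `n` (`GlobalWeyl.toSym_injective`, `GlobalWeyl.exists_toSym_eq`).
Injectivity rests on a spanning theorem, `weylIdeal_sup_wordSpan`: ordered products of at most `n`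
elements `h ⊗ tˢ` (`s > 0`) and `y ⊗ tʳ` span `W(n)`. Indeed, modulo the defining ideal and shorter
products, acting with `x ⊗ ℂ[t]` and then commuting with `h ⊗ ℂ[t]` turns the relation
`yⁿ⁺¹ w = 0` into relations killing all products of length `n + 1`. On the other hand these products
have distinct leading monomials in `S`. The embedding also yields the degree operator of `W(n)`, the
finite-dimensionality of its graded pieces and the finiteness of its set of weights.

The vectors `wₙ ⊗ h tʳ w₁` of `W(n) ⊗ W(1)` are killed by `x ⊗ ℂ[t]` and have weight `n + 1`, so
each defines a homomorphism `W(n + 1) → W(n) ⊗ W(1)`. Up to a scalar it is the restriction of the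
derivation `S → S ⊗ S` that sends a linear form `l` to `1 ⊗ tʳ l` (`pol`). For `r ≤ n` these
homomorphisms are jointly injective: composing with evaluations at `n + 1` distinct points of the
line gives a Vandermonde system (`eq_zero_of_sum_evDer_eq_zero`). Their images already contain
`wₙ ⊗ h tʳ w₁` for all `r` (`GlobalWeyl.genTensor_zero_mem`).

For `n = 0` these vectors generate `W(n) ⊗ W(1)` (`GlobalWeyl.highSum_zero_range`). For `n > 0`,
modulo the submodule that they generate, the classes of `wₙ ⊗ y tʳ w₁` are killed by `x ⊗ ℂ[t]`,
have weight `n - 1` and generate the quotient, so that `⨁ᵣ W(n - 1, r)` maps onto it. The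
contractions of `S ⊗ S` with the determinant of `ℂ²` evaluated at `t = c` (`contraction`) vanish on
the submodule and take the `r`-th copy of `W(n - 1)` to a nonzero multiple of `cʳ` times its image
in `S`. As `c` varies, this shows that the map is injective (`GlobalWeyl.lowSum_injective`).
-/

open scoped TensorProduct DirectSum

noncomputable section

namespace CurrentSl2

attribute [local instance 100] LieRing.ofAssociativeRing

/-! ### The current algebra and its enveloping algebra -/

theorem lie_x_y : ⁅x, y⁆ = h := by
  ext i j
  rw [LieAlgebra.SpecialLinear.sl_bracket]
  fin_cases i <;> fin_cases j <;> simp [x, y, h, LieAlgebra.SpecialLinear.val_single,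
    LieAlgebra.SpecialLinear.val_singleSubSingle, Matrix.mul_apply, Matrix.single]

theorem lie_h_x : ⁅h, x⁆ = (2 : ℂ) • x := by
  ext i j
  rw [LieAlgebra.SpecialLinear.sl_bracket]
  fin_cases i <;> fin_cases j <;> simp [x, h, LieAlgebra.SpecialLinear.val_single,
    LieAlgebra.SpecialLinear.val_singleSubSingle, Matrix.mul_apply, Matrix.single]
  norm_num

theorem lie_h_y : ⁅h, y⁆ = (-2 : ℂ) • y := by
  ext i j
  rw [LieAlgebra.SpecialLinear.sl_bracket]
  fin_cases i <;> fin_cases j <;> simp [y, h, LieAlgebra.SpecialLinear.val_single,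
    LieAlgebra.SpecialLinear.val_singleSubSingle, Matrix.mul_apply, Matrix.single]
  norm_num

theorem sl2_eq (a : Sl2) : a = a.val 0 1 • x + a.val 1 0 • y + a.val 0 0 • h := by
  have ht : a.val 1 1 = - a.val 0 0 := by
    have : Matrix.trace a.val = 0 := LinearMap.mem_ker.1 a.2
    rw [Matrix.trace_fin_two] at this
    linear_combination this
  ext i j
  fin_cases i <;> fin_cases j <;> simp [x, y, h, LieAlgebra.SpecialLinear.val_single,
    LieAlgebra.SpecialLinear.val_singleSubSingle, Matrix.single, ht]

@[elab_as_elim]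
theorem sl2t_induction {P : Sl2t → Prop} (hx : ∀ p, P (p ⊗ₜ x)) (hy : ∀ p, P (p ⊗ₜ y))
    (hh : ∀ p, P (p ⊗ₜ h)) (hadd : ∀ a b, P a → P b → P (a + b)) (a : Sl2t) : P a := by
  induction a using TensorProduct.induction_on with
  | zero => simpa using hx 0
  | tmul p a =>
    rw [sl2_eq a, TensorProduct.tmul_add, TensorProduct.tmul_add]
    refine hadd _ _ (hadd _ _ ?_ ?_) ?_
    · rw [← TensorProduct.smul_tmul]; exact hx _
    · rw [← TensorProduct.smul_tmul]; exact hy _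
    · rw [← TensorProduct.smul_tmul]; exact hh _
  | add a b ha hb => exact hadd _ _ ha hb

theorem tmul_mem_span (p : Polynomial ℂ) (a : Sl2) :
    (p ⊗ₜ a : Sl2t) ∈ Submodule.span ℂ (Set.range (cur a)) := by
  induction p using Polynomial.induction_on' with
  | add p q hp hq => rw [TensorProduct.add_tmul]; exact add_mem hp hq
  | monomial r c =>
    rw [← Polynomial.C_mul_X_pow_eq_monomial, ← Polynomial.smul_eq_C_mul,
      ← TensorProduct.smul_tmul']
    exact Submodule.smul_mem _ _ (Submodule.subset_span ⟨r, rfl⟩)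

theorem lie_cur_x_y (r s : ℕ) : ⁅cur x r, cur y s⁆ = cur h (r + s) := by
  rw [cur, cur, LieAlgebra.ExtendScalars.bracket_tmul, lie_x_y, ← pow_add, cur]

theorem isSl2Triple : IsSl2Triple (cur h 0) (cur x 0) (cur y 0) where
  h_ne_zero := by
    intro h0
    have h1 := congrArg (TensorProduct.lid ℂ Sl2 ∘
      (Polynomial.lcoeff ℂ 0).rTensor Sl2) h0
    have h2 : h = 0 := by simpa [cur] using h1
    have h3 := congrArg (fun a : Sl2 => a.val 0 0) h2
    simp [h, LieAlgebra.SpecialLinear.val_singleSubSingle, Matrix.single] at h3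
  lie_e_f := lie_cur_x_y 0 0
  lie_h_e_nsmul := by
    rw [cur, cur, LieAlgebra.ExtendScalars.bracket_tmul, lie_h_x, TensorProduct.tmul_smul,
      ofNat_smul_eq_nsmul]
    simp
  lie_h_f_nsmul := by
    rw [cur, cur, LieAlgebra.ExtendScalars.bracket_tmul, lie_h_y, TensorProduct.tmul_smul,
      pow_zero, one_mul]
    module

theorem toU_lie (a b : Sl2t) : toU ⁅a, b⁆ = toU a * toU b - toU b * toU a := by
  rw [LieHom.map_lie, Ring.lie_def]

/-- A subspace of the enveloping algebra that contains `1` and is stable under left multiplication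
by `sl₂[t]` is everything. -/
theorem usl2t_eq_top {p : Submodule ℂ USl2t} (h1 : 1 ∈ p)
    (hmul : ∀ (a : Sl2t), ∀ u ∈ p, toU a * u ∈ p) : p = ⊤ := by
  let A : Subalgebra ℂ USl2t :=
    { carrier := {u | ∀ v ∈ p, u * v ∈ p}
      mul_mem' := fun {a b} ha hb v hv => by rw [mul_assoc]; exact ha _ (hb _ hv)
      add_mem' := fun {a b} ha hb v hv => by rw [add_mul]; exact add_mem (ha _ hv) (hb _ hv)
      algebraMap_mem' := fun c v hv => by
        rw [Algebra.algebraMap_eq_smul_one, smul_mul_assoc, one_mul]; exact p.smul_mem _ hv }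
  let φ : Sl2t →ₗ⁅ℂ⁆ A :=
    { toFun := fun a => ⟨toU a, hmul a⟩
      map_add' := fun a b => Subtype.ext (map_add toU a b)
      map_smul' := fun c a => Subtype.ext (map_smul toU c a)
      map_lie' := fun {a b} => Subtype.ext (toU_lie a b) }
  have hφ : A.val.comp (UniversalEnvelopingAlgebra.lift ℂ φ) = AlgHom.id ℂ USl2t := by
    apply UniversalEnvelopingAlgebra.hom_ext
    ext a
    simp only [LieHom.coe_comp, AlgHom.coe_toLieHom, Function.comp_apply, AlgHom.coe_comp]
    rw [UniversalEnvelopingAlgebra.lift_ι_apply]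
    rfl
  rw [eq_top_iff]
  intro u _
  have hu := congrArg (fun f : USl2t →ₐ[ℂ] USl2t => f u) hφ
  have := (UniversalEnvelopingAlgebra.lift ℂ φ u).2 1 h1
  simp only [AlgHom.coe_comp, Function.comp_apply, AlgHom.coe_id, id] at hu
  rw [mul_one] at this
  rw [← hu]; exact this

section Primitive

variable {M : Type} [AddCommGroup M] [Module ℂ M] [LieRingModule Sl2t M] [LieModule ℂ Sl2t M]

/-- A vector of weight `m` killed by `x` and by some power of `y` is killed by `y ^ (m + 1)`. -/
theorem toEnd_y_pow_eq_zero {v : M} {m N : ℕ} (hx : ⁅cur x 0, v⁆ = 0)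
    (hh : ⁅cur h 0, v⁆ = (m : ℂ) • v) (hN : (LieModule.toEnd ℂ Sl2t M (cur y 0) ^ N) v = 0) :
    (LieModule.toEnd ℂ Sl2t M (cur y 0) ^ (m + 1)) v = 0 := by
  by_cases hv : v = 0
  · simp [hv]
  have P : isSl2Triple.HasPrimitiveVectorWith v (m : ℂ) := ⟨hv, hh, hx⟩
  induction N with
  | zero => simp at hN; exact absurd hN hv
  | succ N ih =>
    by_cases hle : N + 1 ≤ m + 1
    · obtain ⟨k, hk⟩ := Nat.exists_eq_add_of_le hle
      rw [hk, add_comm, pow_add, Module.End.mul_apply, hN, map_zero]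
    · apply ih
      have e := P.lie_e_pow_succ_toEnd_f N
      simp only [hN, lie_zero] at e
      have hne : (((N : ℂ) + 1) * ((m : ℂ) - N)) ≠ 0 := by
        refine mul_ne_zero (by exact_mod_cast Nat.succ_ne_zero N) (sub_ne_zero.2 ?_)
        have : m ≠ N := by omega
        exact_mod_cast this
      exact (smul_eq_zero.1 e.symm).resolve_left hne

end Primitive

/-! ### Cyclicity and the universal property of the global Weyl modules -/

namespace GlobalWeyl

variable {m : ℤ}

/-- The generator `w_m` of the global Weyl module. -/
def gen (m : ℤ) : GlobalWeyl m := mk m 1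

theorem mk_surjective : Function.Surjective (mk m) := Submodule.mkQ_surjective _

theorem mk_eq_zero {u : USl2t} : mk m u = 0 ↔ u ∈ weylIdeal m := Submodule.Quotient.mk_eq_zero _

theorem lie_mk (a : Sl2t) (u : USl2t) : ⁅a, mk m u⁆ = mk m (toU a * u) := by
  rw [lie_def, ← smul_eq_mul, map_smul]

theorem toEnd_pow_mk (a : Sl2t) (u : USl2t) (k : ℕ) :
    (LieModule.toEnd ℂ Sl2t (GlobalWeyl m) a ^ k) (mk m u) = mk m (toU a ^ k * u) := by
  induction k with
  | zero => simp
  | succ k ih =>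
    rw [pow_succ', Module.End.mul_apply, ih, LieModule.toEnd_apply_apply, lie_mk, pow_succ',
      mul_assoc]

theorem x_mem (p : Polynomial ℂ) : toU (p ⊗ₜ x) ∈ weylIdeal m :=
  Ideal.subset_span (Or.inl ⟨p, rfl⟩)

theorem h_sub_mem : toU (cur h 0) - algebraMap ℂ USl2t (m : ℂ) ∈ weylIdeal m :=
  Ideal.subset_span (Or.inr (Or.inl rfl))

theorem y_pow_mem : toU (cur y 0) ^ (m + 1).toNat ∈ weylIdeal m :=
  Ideal.subset_span (Or.inr (Or.inr rfl))

theorem lie_x_gen (p : Polynomial ℂ) : ⁅(p ⊗ₜ x : Sl2t), gen m⁆ = 0 := by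
  rw [gen, lie_mk, mul_one, mk_eq_zero]; exact x_mem p

theorem lie_h_gen : ⁅cur h 0, gen m⁆ = (m : ℂ) • gen m := by
  have : mk m (toU (cur h 0) - algebraMap ℂ USl2t (m : ℂ)) = 0 := mk_eq_zero.2 h_sub_mem
  rw [gen, lie_mk, mul_one]
  rw [map_sub, sub_eq_zero] at this
  rw [this, Algebra.algebraMap_eq_smul_one]
  exact ((mk m).restrictScalars ℂ).map_smul _ _

theorem lie_y_pow_gen : (LieModule.toEnd ℂ Sl2t (GlobalWeyl m) (cur y 0) ^ (m + 1).toNat) (gen m)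
    = 0 := by
  rw [gen, toEnd_pow_mk, mul_one, mk_eq_zero]; exact y_pow_mem

/-- A subspace containing the generator and stable under `sl₂[t]` is everything. -/
theorem eq_top_of_gen_mem {p : Submodule ℂ (GlobalWeyl m)} (h1 : gen m ∈ p)
    (hlie : ∀ (a : Sl2t), ∀ u ∈ p, ⁅a, u⁆ ∈ p) : p = ⊤ := by
  have := usl2t_eq_top (p := p.comap ((mk m).restrictScalars ℂ)) h1 (fun a u hu => by
    have := hlie a _ hu
    simp only [Submodule.mem_comap, LinearMap.coe_restrictScalars] at this ⊢
    rwa [lie_mk] at this)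
  rw [eq_top_iff]
  rintro v -
  obtain ⟨u, rfl⟩ := mk_surjective v
  have hu : u ∈ p.comap ((mk m).restrictScalars ℂ) := this ▸ Submodule.mem_top
  exact hu

theorem subsingleton_of_neg (hm : m < 0) : Subsingleton (GlobalWeyl m) := by
  have h1 : gen m = 0 := by
    have := lie_y_pow_gen (m := m)
    rwa [Int.toNat_of_nonpos (by omega)] at this
  have h2 := eq_top_of_gen_mem (m := m) (p := ⊥) (by simp [h1]) (by simp)
  exact (Submodule.subsingleton_iff ℂ).1 (subsingleton_iff_bot_eq_top.1 h2)

section Lift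

variable {M : Type} [AddCommGroup M] [Module ℂ M] [LieRingModule Sl2t M] [LieModule ℂ Sl2t M]

omit [LieModule ℂ Sl2t M] in
theorem hom_ext {f g : GlobalWeyl m →ₗ⁅ℂ,Sl2t⁆ M} (hfg : f (gen m) = g (gen m)) : f = g := by
  have := eq_top_of_gen_mem (m := m) (p := LinearMap.eqLocus (f : GlobalWeyl m →ₗ[ℂ] M) g)
    hfg (fun a u hu => by
      simp only [LinearMap.mem_eqLocus, LieModuleHom.coe_toLinearMap] at hu ⊢
      rw [LieModuleHom.map_lie, LieModuleHom.map_lie, hu])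
  ext u
  have hu : u ∈ LinearMap.eqLocus (f : GlobalWeyl m →ₗ[ℂ] M) g := this ▸ Submodule.mem_top
  exact hu

/-- The action of the enveloping algebra on a representation, applied to a fixed vector. -/
def actOn (v : M) : USl2t →ₗ[ℂ] M :=
  (LinearMap.applyₗ v) ∘ₗ (UniversalEnvelopingAlgebra.lift ℂ (LieModule.toEnd ℂ Sl2t M)).toLinearMap

theorem actOn_mul (v : M) (u u' : USl2t) : actOn v (u * u') =
    UniversalEnvelopingAlgebra.lift ℂ (LieModule.toEnd ℂ Sl2t M) u (actOn v u') := by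
  simp [actOn]

theorem lift_aux {v : M} (hx : ∀ p : Polynomial ℂ, ⁅(p ⊗ₜ x : Sl2t), v⁆ = 0)
    (hh : ⁅cur h 0, v⁆ = (m : ℂ) • v)
    (hy : (LieModule.toEnd ℂ Sl2t M (cur y 0) ^ (m + 1).toNat) v = 0) :
    (weylIdeal m).restrictScalars ℂ ≤ LinearMap.ker (actOn v) := by
  intro u hu
  replace hu : u ∈ weylIdeal m := hu
  rw [LinearMap.mem_ker]
  induction hu using Submodule.span_induction with
  | mem u hu =>
    rcases hu with ⟨p, rfl⟩ | rfl | rfl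
    · simpa [actOn, UniversalEnvelopingAlgebra.lift_ι_apply, -UniversalEnvelopingAlgebra.ι_apply]
        using hx p
    · simp [actOn, UniversalEnvelopingAlgebra.lift_ι_apply, -UniversalEnvelopingAlgebra.ι_apply,
        hh, Int.cast_smul_eq_zsmul]
    · simpa [actOn, UniversalEnvelopingAlgebra.lift_ι_apply, -UniversalEnvelopingAlgebra.ι_apply]
        using hy
  | zero => simp
  | add a b _ _ ha hb => rw [map_add, ha, hb, add_zero]
  | smul a b _ hb => rw [smul_eq_mul, actOn_mul, hb, map_zero]

/-- The universal property of `W(m)`: the homomorphism sending the generator to a vector that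
satisfies the defining relations. -/
def lift (v : M) (hx : ∀ p : Polynomial ℂ, ⁅(p ⊗ₜ x : Sl2t), v⁆ = 0)
    (hh : ⁅cur h 0, v⁆ = (m : ℂ) • v)
    (hy : (LieModule.toEnd ℂ Sl2t M (cur y 0) ^ (m + 1).toNat) v = 0) :
    GlobalWeyl m →ₗ⁅ℂ,Sl2t⁆ M where
  toLinearMap := ((weylIdeal m).restrictScalars ℂ).liftQ (actOn v) (lift_aux hx hh hy)
  map_lie' := by
    intro a u
    obtain ⟨u, rfl⟩ := mk_surjective u
    rw [lie_mk]
    change actOn v (toU a * u) = ⁅a, actOn v u⁆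
    rw [actOn_mul, UniversalEnvelopingAlgebra.lift_ι_apply]
    rfl

theorem lift_gen (v : M) (hx : ∀ p : Polynomial ℂ, ⁅(p ⊗ₜ x : Sl2t), v⁆ = 0)
    (hh : ⁅cur h 0, v⁆ = (m : ℂ) • v)
    (hy : (LieModule.toEnd ℂ Sl2t M (cur y 0) ^ (m + 1).toNat) v = 0) :
    lift v hx hh hy (gen m) = v := by
  change actOn v 1 = v
  simp [actOn]

end Lift

end GlobalWeyl

/-! ### Commutation relations and the standard filtration of the enveloping algebra -/

theorem toU_h_mul_x (p q : Polynomial ℂ) :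
    toU (p ⊗ₜ h) * toU (q ⊗ₜ x) = toU (q ⊗ₜ x) * toU (p ⊗ₜ h) + (2 : ℂ) • toU ((p * q) ⊗ₜ x) := by
  have := toU_lie (p ⊗ₜ h) (q ⊗ₜ x)
  rw [LieAlgebra.ExtendScalars.bracket_tmul, lie_h_x, TensorProduct.tmul_smul, map_smul] at this
  rw [this]; abel

theorem toU_h_mul_y (p q : Polynomial ℂ) :
    toU (p ⊗ₜ h) * toU (q ⊗ₜ y) = toU (q ⊗ₜ y) * toU (p ⊗ₜ h) + (-2 : ℂ) • toU ((p * q) ⊗ₜ y) := by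
  have := toU_lie (p ⊗ₜ h) (q ⊗ₜ y)
  rw [LieAlgebra.ExtendScalars.bracket_tmul, lie_h_y, TensorProduct.tmul_smul, map_smul] at this
  rw [this]; abel

theorem toU_x_mul_y (p q : Polynomial ℂ) :
    toU (p ⊗ₜ x) * toU (q ⊗ₜ y) = toU (q ⊗ₜ y) * toU (p ⊗ₜ x) + toU ((p * q) ⊗ₜ h) := by
  have := toU_lie (p ⊗ₜ x) (q ⊗ₜ y)
  rw [LieAlgebra.ExtendScalars.bracket_tmul, lie_x_y] at this
  rw [this]; abel

theorem toU_commute (p q : Polynomial ℂ) (a : Sl2) : Commute (toU (p ⊗ₜ a)) (toU (q ⊗ₜ a)) := by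
  have := toU_lie (p ⊗ₜ a) (q ⊗ₜ a)
  rw [LieAlgebra.ExtendScalars.bracket_tmul, lie_self, TensorProduct.tmul_zero, map_zero] at this
  exact (sub_eq_zero.1 this.symm)

/-- The degree one part of the standard filtration of the enveloping algebra; its `d`-th power is
the span of the products of at most `d` elements of `sl₂[t]`. -/
def filt : Submodule ℂ USl2t := 1 ⊔ LinearMap.range (toU : Sl2t →ₗ[ℂ] USl2t)

theorem toU_mem_filt (a : Sl2t) : toU a ∈ filt := Submodule.mem_sup_right ⟨a, rfl⟩

theorem one_le_filt : 1 ≤ filt := le_sup_left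

theorem one_mem_filt_zero : (1 : USl2t) ∈ filt ^ 0 := by
  rw [pow_zero]; exact Submodule.mem_one.2 ⟨1, map_one _⟩

theorem filt_mono {d e : ℕ} (hde : d ≤ e) : filt ^ d ≤ filt ^ e :=
  pow_le_pow_right₀ one_le_filt hde

theorem mul_mem_filt {d e k : ℕ} {u v : USl2t} (hu : u ∈ filt ^ d) (hv : v ∈ filt ^ e)
    (hk : d + e ≤ k) : u * v ∈ filt ^ k :=
  filt_mono hk (pow_add filt d e ▸ Submodule.mul_mem_mul hu hv)

theorem toU_mul_mem_filt {d : ℕ} (a : Sl2t) {u : USl2t} (hu : u ∈ filt ^ d) :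
    toU a * u ∈ filt ^ (d + 1) :=
  mul_mem_filt (d := 1) (by simpa using toU_mem_filt a) hu (by omega)

theorem mul_toU_mem_filt {d : ℕ} (a : Sl2t) {u : USl2t} (hu : u ∈ filt ^ d) :
    u * toU a ∈ filt ^ (d + 1) :=
  mul_mem_filt (e := 1) hu (by simpa using toU_mem_filt a) (by omega)

theorem pow_toU_mem_filt (a : Sl2t) (d : ℕ) : toU a ^ d ∈ filt ^ d :=
  Submodule.pow_mem_pow _ (toU_mem_filt a) d

theorem filt_induction {C : ℕ → USl2t → Prop} (hone : C 0 1)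
    (hadd : ∀ d u v, C d u → C d v → C d (u + v)) (hsmul : ∀ d (c : ℂ) u, C d u → C d (c • u))
    (hsucc : ∀ d u, C d u → C (d + 1) u)
    (hmul : ∀ d (a : Sl2t) u, u ∈ filt ^ d → C d u → C (d + 1) (toU a * u))
    {d : ℕ} {u : USl2t} (hu : u ∈ filt ^ d) : C d u := by
  induction d generalizing u with
  | zero =>
    rw [pow_zero] at hu
    obtain ⟨c, rfl⟩ := Submodule.mem_one.1 hu
    rw [Algebra.algebraMap_eq_smul_one]
    exact hsmul _ _ _ hone
  | succ d ih =>
    rw [pow_succ'] at hu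
    induction hu using Submodule.mul_induction_on' with
    | mem_mul_mem a ha v hv =>
      obtain ⟨b, hb, c, ⟨c, rfl⟩, rfl⟩ := Submodule.mem_sup.1 ha
      obtain ⟨b, rfl⟩ := Submodule.mem_one.1 hb
      rw [add_mul, Algebra.algebraMap_eq_smul_one, smul_mul_assoc, one_mul]
      exact hadd _ _ _ (hsmul _ _ _ (hsucc _ _ (ih hv))) (hmul _ _ _ hv (ih hv))
    | add a _ b _ ha hb => exact hadd _ _ _ ha hb

/-- The adjoint action of `sl₂[t]` preserves the standard filtration. -/
theorem commutator_mem_filt {d : ℕ} (a : Sl2t) {u : USl2t} (hu : u ∈ filt ^ d) :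
    toU a * u - u * toU a ∈ filt ^ d := by
  refine filt_induction (C := fun d u => toU a * u - u * toU a ∈ filt ^ d) ?_ ?_ ?_ ?_ ?_ hu
  · simp
  · intro d u v hu hv
    rw [mul_add, add_mul, add_sub_add_comm]; exact add_mem hu hv
  · intro d c u hu
    rw [mul_smul_comm, smul_mul_assoc, ← smul_sub]; exact Submodule.smul_mem _ _ hu
  · intro d u hu; exact filt_mono (Nat.le_succ d) hu
  · intro d b u hu hu'
    have : toU a * (toU b * u) - toU b * u * toU a =
        toU ⁅a, b⁆ * u + toU b * (toU a * u - u * toU a) := by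
      rw [toU_lie]; noncomm_ring
    rw [this]
    exact add_mem (toU_mul_mem_filt _ hu) (toU_mul_mem_filt _ hu')

/-- The commutator of `x ⊗ p` with a power of `y`, up to shorter products. -/
theorem x_mul_y_pow (p : Polynomial ℂ) (c : ℕ) : ∃ r ∈ filt ^ c,
    toU (p ⊗ₜ x) * toU (cur y 0) ^ (c + 1) = toU (cur y 0) ^ (c + 1) * toU (p ⊗ₜ x) +
      ((c : ℂ) + 1) • (toU (cur y 0) ^ c * toU (p ⊗ₜ h)) + r := by
  induction c with
  | zero => exact ⟨0, zero_mem _, by simp [cur, toU_x_mul_y, -UniversalEnvelopingAlgebra.ι_apply]⟩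
  | succ c ih =>
    obtain ⟨r, hr, e⟩ := ih
    refine ⟨(-2 * ((c : ℂ) + 1)) • (toU (cur y 0) ^ c * toU (p ⊗ₜ y)) + r * toU (cur y 0),
      add_mem (Submodule.smul_mem _ _ (mul_toU_mem_filt _ (pow_toU_mem_filt _ c)))
        (mul_toU_mem_filt _ hr), ?_⟩
    have h1 : toU (p ⊗ₜ x) * toU (cur y 0) = toU (cur y 0) * toU (p ⊗ₜ x) + toU (p ⊗ₜ h) := by
      simpa [cur, -UniversalEnvelopingAlgebra.ι_apply] using toU_x_mul_y p 1
    have h2 : toU (p ⊗ₜ h) * toU (cur y 0) =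
        toU (cur y 0) * toU (p ⊗ₜ h) + (-2 : ℂ) • toU (p ⊗ₜ y) := by
      simpa [cur, -UniversalEnvelopingAlgebra.ι_apply] using toU_h_mul_y p 1
    rw [pow_succ _ (c + 1), ← mul_assoc, e, add_mul, add_mul, mul_assoc _ (toU (p ⊗ₜ x)), h1,
      smul_mul_assoc, mul_assoc _ (toU (p ⊗ₜ h)), h2, pow_succ _ c]
    push_cast
    simp only [mul_add, mul_smul_comm, smul_add, mul_assoc, smul_smul, add_smul]
    module

theorem h_mul_y_pow (p : Polynomial ℂ) (c : ℕ) :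
    toU (p ⊗ₜ h) * toU (cur y 0) ^ (c + 1) = toU (cur y 0) ^ (c + 1) * toU (p ⊗ₜ h) +
      (-2 * ((c : ℂ) + 1)) • (toU (cur y 0) ^ c * toU (p ⊗ₜ y)) := by
  have h2 : toU (p ⊗ₜ h) * toU (cur y 0) =
      toU (cur y 0) * toU (p ⊗ₜ h) + (-2 : ℂ) • toU (p ⊗ₜ y) := by
    simpa [cur, -UniversalEnvelopingAlgebra.ι_apply] using toU_h_mul_y p 1
  induction c with
  | zero => simpa using h2
  | succ c ih =>
    have h3 : toU (p ⊗ₜ y) * toU (cur y 0) = toU (cur y 0) * toU (p ⊗ₜ y) := toU_commute _ _ _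
    rw [pow_succ _ (c + 1), ← mul_assoc, ih, add_mul, smul_mul_assoc, mul_assoc _ (toU (p ⊗ₜ h)),
      h2, mul_assoc _ (toU (p ⊗ₜ y)), h3, ← mul_assoc _ _ (toU (p ⊗ₜ y)), ← pow_succ]
    push_cast
    simp only [mul_add, mul_smul_comm, mul_assoc]
    module

/-! ### A spanning set of the global Weyl module -/

section WordSpan

variable (n : ℕ)

/-- The ideal defining `W(n)`, enlarged by the products of at most `n` elements of `sl₂[t]`. -/
def weylIdealFilt : Submodule ℂ USl2t := (weylIdeal n).restrictScalars ℂ ⊔ filt ^ n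

variable {n}

theorem mem_weylIdealFilt_of_ideal {u : USl2t} (hu : u ∈ weylIdeal n) : u ∈ weylIdealFilt n :=
  Submodule.mem_sup_left hu

theorem mem_weylIdealFilt_of_filt {u : USl2t} (hu : u ∈ filt ^ n) : u ∈ weylIdealFilt n :=
  Submodule.mem_sup_right hu

theorem x_mul_mem_weylIdealFilt (p : Polynomial ℂ) {u : USl2t} (hu : u ∈ weylIdealFilt n) :
    toU (p ⊗ₜ x) * u ∈ weylIdealFilt n := by
  obtain ⟨v, hv, w, hw, rfl⟩ := Submodule.mem_sup.1 hu
  have : toU (p ⊗ₜ x) * (v + w) =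
      (toU (p ⊗ₜ x) * v + w * toU (p ⊗ₜ x)) + (toU (p ⊗ₜ x) * w - w * toU (p ⊗ₜ x)) := by
    noncomm_ring
  rw [this]
  exact add_mem (mem_weylIdealFilt_of_ideal (add_mem (Ideal.mul_mem_left _ _ hv)
    (Ideal.mul_mem_left _ _ (GlobalWeyl.x_mem p))))
    (mem_weylIdealFilt_of_filt (commutator_mem_filt _ hw))

/-- The defining ideal is stable under right multiplication by `h ⊗ ℂ[t]`: for every `q`, the vector
`(h ⊗ q) w_n` satisfies the defining relations of `W(n)`. -/
theorem mul_h_mem_weylIdeal (q : Polynomial ℂ) {u : USl2t} (hu : u ∈ weylIdeal n) :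
    u * toU (q ⊗ₜ h) ∈ weylIdeal n := by
  have hx (p : Polynomial ℂ) : toU (p ⊗ₜ x) * toU (q ⊗ₜ h) ∈ weylIdeal n := by
    have := toU_h_mul_x q p
    rw [← sub_eq_iff_eq_add] at this
    rw [← this]
    exact sub_mem (Ideal.mul_mem_left _ _ (GlobalWeyl.x_mem p))
      (((weylIdeal n).restrictScalars ℂ).smul_mem _ (GlobalWeyl.x_mem _))
  have hh : (toU (cur h 0) - algebraMap ℂ USl2t ((n : ℤ) : ℂ)) * toU (q ⊗ₜ h) ∈ weylIdeal n := by
    have : (toU (cur h 0) - algebraMap ℂ USl2t ((n : ℤ) : ℂ)) * toU (q ⊗ₜ h) =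
        toU (q ⊗ₜ h) * (toU (cur h 0) - algebraMap ℂ USl2t ((n : ℤ) : ℂ)) := by
      rw [sub_mul, mul_sub, cur, (toU_commute _ q h).eq, Algebra.commutes]
    rw [this]
    exact Ideal.mul_mem_left _ _ GlobalWeyl.h_sub_mem
  have hyn : toU (cur y 0) ^ (n + 1) ∈ weylIdeal n := GlobalWeyl.y_pow_mem (m := n)
  have hy : toU (cur y 0) ^ (n + 1) * toU (q ⊗ₜ h) ∈ weylIdeal n := by
    rw [← GlobalWeyl.mk_eq_zero, ← GlobalWeyl.toEnd_pow_mk]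
    apply toEnd_y_pow_eq_zero (N := n + 2)
    · rw [GlobalWeyl.lie_mk, GlobalWeyl.mk_eq_zero]; exact hx _
    · have := GlobalWeyl.mk_eq_zero.2 hh
      rw [sub_mul, map_sub, sub_eq_zero] at this
      rw [GlobalWeyl.lie_mk, this, Algebra.algebraMap_eq_smul_one, smul_mul_assoc, one_mul]
      exact ((GlobalWeyl.mk (n : ℤ)).restrictScalars ℂ).map_smul _ _
    · rw [GlobalWeyl.toEnd_pow_mk, GlobalWeyl.mk_eq_zero]
      have h1 := h_mul_y_pow q (n + 1)
      rw [← sub_eq_iff_eq_add] at h1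
      have h3 : Commute (toU (cur y 0) ^ (n + 1)) (toU (q ⊗ₜ y)) :=
        (toU_commute _ _ _).pow_left _
      rw [← h1, h3.eq]
      refine sub_mem (Ideal.mul_mem_left _ _ ?_)
        (((weylIdeal n).restrictScalars ℂ).smul_mem _ (Ideal.mul_mem_left _ _ hyn))
      rw [pow_succ']
      exact Ideal.mul_mem_left _ _ hyn
  induction hu using Submodule.span_induction with
  | mem u hu =>
    rcases hu with ⟨p, rfl⟩ | rfl | rfl
    · exact hx p
    · exact hh
    · exact hy
  | zero => simp
  | add a b _ _ ha hb => rw [add_mul]; exact add_mem ha hb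
  | smul a b _ hb => rw [smul_eq_mul, mul_assoc]; exact Ideal.mul_mem_left _ _ hb

theorem h_commutator_mem_weylIdealFilt (p : Polynomial ℂ) {u : USl2t} (hu : u ∈ weylIdealFilt n) :
    toU (p ⊗ₜ h) * u - u * toU (p ⊗ₜ h) ∈ weylIdealFilt n := by
  obtain ⟨v, hv, w, hw, rfl⟩ := Submodule.mem_sup.1 hu
  have : toU (p ⊗ₜ h) * (v + w) - (v + w) * toU (p ⊗ₜ h) =
      (toU (p ⊗ₜ h) * v - v * toU (p ⊗ₜ h)) + (toU (p ⊗ₜ h) * w - w * toU (p ⊗ₜ h)) := by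
    noncomm_ring
  rw [this]
  exact add_mem (mem_weylIdealFilt_of_ideal (sub_mem (Ideal.mul_mem_left _ _ hv)
    (mul_h_mem_weylIdeal p hv)))
    (mem_weylIdealFilt_of_filt (commutator_mem_filt _ hw))

/-- The subspace `a ⊗ ℂ[t]` of the enveloping algebra. -/
def loopSpace (a : Sl2) : Submodule ℂ USl2t :=
  LinearMap.range ((toU : Sl2t →ₗ[ℂ] USl2t) ∘ₗ (TensorProduct.mk ℂ (Polynomial ℂ) Sl2).flip a)

theorem toU_mem_loopSpace (p : Polynomial ℂ) (a : Sl2) : toU (p ⊗ₜ a) ∈ loopSpace a := ⟨p, rfl⟩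

theorem loopSpace_pow_le_filt (a : Sl2) (k : ℕ) : loopSpace a ^ k ≤ filt ^ k := by
  refine pow_le_pow_left' ?_ k
  rintro _ ⟨p, rfl⟩
  exact toU_mem_filt _

@[elab_as_elim]
theorem loopSpace_induction {a : Sl2} {C : ∀ k : ℕ, ∀ u ∈ loopSpace a ^ k, Prop}
    (hone : ∀ c : ℂ, C 0 (c • 1) (Submodule.smul_mem _ _ (Submodule.mem_one.2 ⟨1, map_one _⟩)))
    (hadd : ∀ k u v hu hv, C k u hu → C k v hv → C k (u + v) (add_mem hu hv))
    (hmul : ∀ k p u hu, C k u hu → C (k + 1) (toU (p ⊗ₜ a) * u)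
      (by rw [pow_succ']; exact Submodule.mul_mem_mul (toU_mem_loopSpace p a) hu))
    {k : ℕ} {u : USl2t} (hu : u ∈ loopSpace a ^ k) : C k u hu := by
  induction k generalizing u with
  | zero =>
    obtain ⟨c, rfl⟩ : ∃ c : ℂ, c • 1 = u := by
      rw [pow_zero] at hu
      obtain ⟨c, rfl⟩ := Submodule.mem_one.1 hu
      exact ⟨c, (Algebra.algebraMap_eq_smul_one c).symm⟩
    exact hone _
  | succ d ih =>
    have hu' := hu
    rw [pow_succ'] at hu'
    induction hu' using Submodule.mul_induction_on' with
    | mem_mul_mem a ha v hv =>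
      obtain ⟨p, rfl⟩ := ha
      exact hmul _ _ _ hv (ih hv)
    | add a ha b hb iha ihb =>
      rw [← pow_succ'] at ha hb
      exact hadd _ _ _ ha hb (iha ha) (ihb hb)

theorem x_mul_loopSpace_h_mem {k : ℕ} {u : USl2t} (hu : u ∈ loopSpace h ^ k) :
    ∀ p : Polynomial ℂ, toU (p ⊗ₜ x) * u ∈ weylIdeal n := by
  induction hu using loopSpace_induction with
  | hone c =>
    intro p
    rw [mul_smul_comm, mul_one]
    exact ((weylIdeal n).restrictScalars ℂ).smul_mem _ (GlobalWeyl.x_mem _)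
  | hadd k u v _ _ hu hv => intro p; rw [mul_add]; exact add_mem (hu p) (hv p)
  | hmul k q u _ hu =>
    intro p
    have := toU_h_mul_x q p
    rw [← sub_eq_iff_eq_add] at this
    rw [← mul_assoc, ← this, sub_mul, smul_mul_assoc, mul_assoc]
    exact sub_mem (Ideal.mul_mem_left _ _ (hu p))
      (((weylIdeal n).restrictScalars ℂ).smul_mem _ (hu _))

theorem commute_loopSpace {a : Sl2} (p : Polynomial ℂ) {k : ℕ} {u : USl2t}
    (hu : u ∈ loopSpace a ^ k) : Commute (toU (p ⊗ₜ a)) u := by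
  induction hu using loopSpace_induction with
  | hone c => exact (Commute.one_right _).smul_right _
  | hadd k u v _ _ hu hv => exact hu.add_right hv
  | hmul k q u _ hu => exact (toU_commute p q a).mul_right hu

theorem h_commutator_loopSpace_y (p : Polynomial ℂ) {k : ℕ} {u : USl2t}
    (hu : u ∈ loopSpace y ^ k) :
    toU (p ⊗ₜ h) * u - u * toU (p ⊗ₜ h) ∈ loopSpace y ^ k := by
  induction hu using loopSpace_induction with
  | hone c => simp
  | hadd k u v _ _ hu hv => rw [mul_add, add_mul, add_sub_add_comm]; exact add_mem hu hv
  | hmul k q u hu' hu =>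
    have : toU (p ⊗ₜ h) * (toU (q ⊗ₜ y) * u) - toU (q ⊗ₜ y) * u * toU (p ⊗ₜ h) =
        ((-2 : ℂ) • toU ((p * q) ⊗ₜ y)) * u +
          toU (q ⊗ₜ y) * (toU (p ⊗ₜ h) * u - u * toU (p ⊗ₜ h)) := by
      rw [← mul_assoc, toU_h_mul_y]; noncomm_ring
    rw [this, pow_succ', smul_mul_assoc]
    exact add_mem (Submodule.smul_mem _ _ (Submodule.mul_mem_mul (toU_mem_loopSpace _ _) hu'))
      (Submodule.mul_mem_mul (toU_mem_loopSpace _ _) hu)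

/-- Acting by `x ⊗ ℂ[t]` turns the factors of `y ^ (n + 1)` into factors `h ⊗ q`. -/
theorem y_pow_mul_mem {k : ℕ} {u : USl2t} (hu : u ∈ loopSpace h ^ k) :
    ∀ c : ℕ, c + k = n + 1 → toU (cur y 0) ^ c * u ∈ weylIdealFilt n := by
  induction hu using loopSpace_induction with
  | hone a =>
    intro c hc
    obtain rfl : c = n + 1 := hc
    rw [mul_smul_comm, mul_one]
    exact Submodule.smul_mem _ _
      (mem_weylIdealFilt_of_ideal (GlobalWeyl.y_pow_mem (m := n)))
  | hadd k u v _ _ hu hv => intro c hc; rw [mul_add]; exact add_mem (hu c hc) (hv c hc)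
  | hmul k p u hu' hu =>
    intro c hc
    have h1 := x_mul_mem_weylIdealFilt p (hu (c + 1) (by omega))
    obtain ⟨r, hr, e⟩ := x_mul_y_pow p c
    rw [← mul_assoc, e, add_mul, add_mul, mul_assoc _ (toU (p ⊗ₜ x)), smul_mul_assoc,
      mul_assoc _ (toU (p ⊗ₜ h))] at h1
    have h2 : toU (cur y 0) ^ (c + 1) * (toU (p ⊗ₜ x) * u) ∈ weylIdealFilt n :=
      mem_weylIdealFilt_of_ideal (Ideal.mul_mem_left _ _ (x_mul_loopSpace_h_mem hu' p))
    have h3 : r * u ∈ weylIdealFilt n :=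
      mem_weylIdealFilt_of_filt (mul_mem_filt hr (loopSpace_pow_le_filt _ _ hu') (by omega))
    have hc0 : (c : ℂ) + 1 ≠ 0 := Nat.cast_add_one_ne_zero c
    rwa [Submodule.add_mem_iff_left _ h3, Submodule.add_mem_iff_right _ h2,
      Submodule.smul_mem_iff _ hc0] at h1

/-- Commuting with `h ⊗ ℂ[t]` turns the factors `y` into factors `y ⊗ q`. -/
theorem y_pow_mul_mul_mem {j : ℕ} {v : USl2t} (hv : v ∈ loopSpace y ^ j) :
    ∀ (c k : ℕ) (u : USl2t), u ∈ loopSpace h ^ k → c + j + k = n + 1 →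
      toU (cur y 0) ^ c * v * u ∈ weylIdealFilt n := by
  suffices H : ∀ j : ℕ, ∀ v ∈ loopSpace y ^ j, ∀ (c k : ℕ) (u : USl2t), u ∈ loopSpace h ^ k →
      c + j + k = n + 1 → toU (cur y 0) ^ c * v * u ∈ weylIdealFilt n from H j v hv
  clear hv v j
  intro j
  induction j with
  | zero =>
    intro v hv c k u hu hc
    rw [pow_zero] at hv
    obtain ⟨a, rfl⟩ := Submodule.mem_one.1 hv
    rw [Algebra.algebraMap_eq_smul_one, mul_smul_comm, mul_one, smul_mul_assoc]
    exact Submodule.smul_mem _ _ (y_pow_mul_mem hu c (by omega))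
  | succ j ih =>
    intro v hv c k u hu hc
    rw [pow_succ'] at hv
    induction hv using Submodule.mul_induction_on' with
    | add a _ b _ ha hb => rw [mul_add, add_mul]; exact add_mem ha hb
    | mem_mul_mem a ha v hv =>
      obtain ⟨p, rfl⟩ := ha
      change toU (cur y 0) ^ c * (toU (p ⊗ₜ y) * v) * u ∈ _
      have h1 := h_commutator_mem_weylIdealFilt p (ih v hv (c + 1) k u hu (by omega))
      have h2 := ih _ (h_commutator_loopSpace_y p hv) (c + 1) k u hu (by omega)
      have e : toU (p ⊗ₜ h) * (toU (cur y 0) ^ (c + 1) * v * u) -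
          toU (cur y 0) ^ (c + 1) * v * u * toU (p ⊗ₜ h) =
          (-2 * ((c : ℂ) + 1)) • (toU (cur y 0) ^ c * (toU (p ⊗ₜ y) * v) * u) +
          toU (cur y 0) ^ (c + 1) * (toU (p ⊗ₜ h) * v - v * toU (p ⊗ₜ h)) * u := by
        rw [mul_assoc _ u, ← (commute_loopSpace p hu).eq, ← mul_assoc, ← mul_assoc, h_mul_y_pow,
          add_mul, smul_mul_assoc, add_mul, smul_mul_assoc]
        simp only [mul_sub, sub_mul, mul_assoc]
        abel
      rw [e, Submodule.add_mem_iff_left _ h2, Submodule.smul_mem_iff] at h1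
      · exact h1
      · exact mul_ne_zero (by norm_num) (Nat.cast_add_one_ne_zero c)

/-- The elements `h ⊗ t ^ s` and `y ⊗ t ^ r` of the current algebra, indexed by `(0, s)` and
`(1, r)`. -/
def lower (v : Fin 2 × ℕ) : Sl2t := cur (if v.1 = 0 then h else y) v.2

/-- The product in the enveloping algebra of the elements `lower v`, for `v` in a list. -/
def word (l : List (Fin 2 × ℕ)) : USl2t := (l.map fun v => toU (lower v)).prod

theorem word_cons (v : Fin 2 × ℕ) (l : List (Fin 2 × ℕ)) :
    word (v :: l) = toU (lower v) * word l := by simp [word]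

theorem word_append (l l' : List (Fin 2 × ℕ)) : word (l ++ l') = word l * word l' := by
  simp [word]

theorem word_mem_filt (l : List (Fin 2 × ℕ)) : word l ∈ filt ^ l.length := by
  induction l with
  | nil => exact one_mem_filt_zero
  | cons v l ih => rw [word_cons]; exact toU_mul_mem_filt _ ih

theorem word_sub_word_mem {l l' : List (Fin 2 × ℕ)} (hl : l.Perm l') :
    ∀ d, l.length ≤ d + 1 → word l - word l' ∈ filt ^ d := by
  induction hl with
  | nil => simp
  | @cons v l₁ l₂ hl ih =>
    intro d hd
    rw [word_cons, word_cons, ← mul_sub]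
    rw [List.length_cons] at hd
    rcases d with _ | d
    · obtain rfl : l₁ = [] := List.length_eq_zero_iff.1 (by omega)
      rw [List.nil_perm.1 hl]
      simp
    · exact toU_mul_mem_filt _ (ih d (by omega))
  | swap v w l =>
    intro d hd
    rw [word_cons, word_cons, word_cons, word_cons, ← mul_assoc, ← mul_assoc, ← sub_mul, ← toU_lie]
    exact filt_mono (by simpa using hd) (toU_mul_mem_filt _ (word_mem_filt l))
  | trans h1 h2 ih1 ih2 =>
    intro d hd
    have := add_mem (ih1 d hd) (ih2 d (h1.length_eq ▸ hd))
    simpa using this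

theorem word_mem_loopSpace (i : Fin 2) (l : List (Fin 2 × ℕ)) (hl : ∀ v ∈ l, v.1 = i) :
    word l ∈ loopSpace (if i = 0 then h else y) ^ l.length := by
  induction l with
  | nil => exact Submodule.mem_one.2 ⟨1, map_one _⟩
  | cons v l ih =>
    rw [word_cons, List.length_cons, pow_succ', lower, hl v (by simp), cur]
    exact Submodule.mul_mem_mul (toU_mem_loopSpace _ _)
      (ih fun w hw => hl w (List.mem_cons_of_mem _ hw))

theorem word_mem_weylIdealFilt {l : List (Fin 2 × ℕ)} (hl : l.length = n + 1) :
    word l ∈ weylIdealFilt n := by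
  have hp := List.filter_append_perm (fun v : Fin 2 × ℕ => decide (v.1 = 1)) l
  have h1 := word_mem_loopSpace 1 (l.filter fun v : Fin 2 × ℕ => decide (v.1 = 1)) (by simp)
  have h0 := word_mem_loopSpace 0 (l.filter fun v : Fin 2 × ℕ => !decide (v.1 = 1)) (by
    intro v hv
    have := (List.mem_filter.1 hv).2
    simp at this
    omega)
  rw [if_neg (by decide)] at h1
  rw [if_pos rfl] at h0
  have h2 := y_pow_mul_mul_mem (n := n) h1 0 _ _ h0 (by
    rw [zero_add, ← List.length_append, hp.length_eq, hl])
  rw [pow_zero, one_mul, ← word_append] at h2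
  have h3 := mem_weylIdealFilt_of_filt (word_sub_word_mem hp n (by rw [hp.length_eq, hl]))
  rwa [Submodule.sub_mem_iff_right _ h2] at h3

theorem tmul_h_y_mem_span (p : Polynomial ℂ) (i : Fin 2) :
    (p ⊗ₜ (if i = 0 then h else y) : Sl2t) ∈ Submodule.span ℂ (Set.range lower) := by
  refine Submodule.span_mono ?_ (tmul_mem_span p _)
  rintro _ ⟨r, rfl⟩
  exact ⟨(i, r), rfl⟩

/-- The span of the ordered words with at most `d` letters, none of which is `h ⊗ 1`. -/
def wordSpan (d : ℕ) : Submodule ℂ USl2t := Submodule.span ℂ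
  {u | ∃ α : Multiset (Fin 2 × ℕ), α.card ≤ d ∧ (0, 0) ∉ α ∧ u = word α.toList}

theorem wordSpan_mono {d e : ℕ} (hde : d ≤ e) : wordSpan d ≤ wordSpan e := by
  apply Submodule.span_mono
  rintro _ ⟨α, h1, h2, h3⟩
  exact ⟨α, h1.trans hde, h2, h3⟩

/-- A Poincaré–Birkhoff–Witt spanning statement modulo the defining ideal of `W(n)`. -/
theorem filt_le_wordSpan (d : ℕ) :
    filt ^ d ≤ (weylIdeal n).restrictScalars ℂ ⊔ wordSpan d := by
  induction d with
  | zero =>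
    refine le_sup_of_le_right ?_
    intro u hu
    rw [pow_zero] at hu
    obtain ⟨c, rfl⟩ := Submodule.mem_one.1 hu
    rw [Algebra.algebraMap_eq_smul_one]
    exact Submodule.smul_mem _ _ (Submodule.subset_span ⟨0, by simp, by simp, by simp [word]⟩)
  | succ d ih =>
    have hmono : (weylIdeal n).restrictScalars ℂ ⊔ wordSpan d ≤
        (weylIdeal n).restrictScalars ℂ ⊔ wordSpan (d + 1) :=
      sup_le_sup_left (wordSpan_mono (Nat.le_succ d)) _
    have key : ∀ α : Multiset (Fin 2 × ℕ), α.card ≤ d → (0, 0) ∉ α → ∀ a : Sl2t,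
        toU a * word α.toList ∈ (weylIdeal n).restrictScalars ℂ ⊔ wordSpan (d + 1) := by
      intro α hα h0 a
      have hw : word α.toList ∈ filt ^ d := filt_mono (by simpa using hα) (word_mem_filt _)
      have hcomm (a : Sl2t) := hmono (ih (commutator_mem_filt a hw))
      have hlow (v : Fin 2 × ℕ) : toU (lower v) * word α.toList ∈
          (weylIdeal n).restrictScalars ℂ ⊔ wordSpan (d + 1) := by
        by_cases hv : v = (0, 0)
        · subst hv
          have h1 : word α.toList * (toU (cur h 0) - algebraMap ℂ USl2t ((n : ℤ) : ℂ)) ∈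
              weylIdeal n := Ideal.mul_mem_left _ _ GlobalWeyl.h_sub_mem
          have e : toU (lower (0, 0)) * word α.toList =
              (toU (cur h 0) * word α.toList - word α.toList * toU (cur h 0)) +
              word α.toList * (toU (cur h 0) - algebraMap ℂ USl2t ((n : ℤ) : ℂ)) +
              ((n : ℤ) : ℂ) • word α.toList := by
            rw [lower, mul_sub, ← Algebra.commutes, ← Algebra.smul_def]; simp
          rw [e]
          exact add_mem (add_mem (hcomm _) (Submodule.mem_sup_left h1))
            (Submodule.smul_mem _ _ (hmono (ih hw)))
        · rw [← word_cons]
          have hp : (v :: α.toList).Perm (v ::ₘ α).toList := by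
            rw [← Multiset.coe_eq_coe, ← Multiset.cons_coe, Multiset.coe_toList,
              Multiset.coe_toList]
          have h1 := hmono (ih (word_sub_word_mem hp d (by simpa using hα)))
          have h2 : word (v ::ₘ α).toList ∈ wordSpan (d + 1) :=
            Submodule.subset_span ⟨v ::ₘ α, by simpa using hα, by
              simp [h0, Ne.symm hv], rfl⟩
          have := add_mem h1 (Submodule.mem_sup_right h2)
          rwa [sub_add_cancel] at this
      have hlow' (b : Sl2t) (hb : b ∈ Submodule.span ℂ (Set.range lower)) :
          toU b * word α.toList ∈ (weylIdeal n).restrictScalars ℂ ⊔ wordSpan (d + 1) := by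
        induction hb using Submodule.span_induction with
        | mem b hb => obtain ⟨v, rfl⟩ := hb; exact hlow v
        | zero => simp
        | add a b _ _ ha hb => rw [map_add, add_mul]; exact add_mem ha hb
        | smul c b _ hb => rw [map_smul, smul_mul_assoc]; exact Submodule.smul_mem _ _ hb
      induction a using sl2t_induction with
      | hx p =>
        have := add_mem (hcomm (p ⊗ₜ x)) (Submodule.mem_sup_left (T := wordSpan (d + 1))
          (show word α.toList * toU (p ⊗ₜ x) ∈ (weylIdeal n).restrictScalars ℂ from
            Ideal.mul_mem_left _ _ (GlobalWeyl.x_mem p)))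
        rwa [sub_add_cancel] at this
      | hy p => exact hlow' _ (tmul_h_y_mem_span p 1)
      | hh p => exact hlow' _ (tmul_h_y_mem_span p 0)
      | hadd a b ha hb => rw [map_add, add_mul]; exact add_mem ha hb
    have key2 (a : Sl2t) {u : USl2t} (hu : u ∈ (weylIdeal n).restrictScalars ℂ ⊔ wordSpan d) :
        toU a * u ∈ (weylIdeal n).restrictScalars ℂ ⊔ wordSpan (d + 1) := by
      obtain ⟨v, hv, w, hw, rfl⟩ := Submodule.mem_sup.1 hu
      rw [mul_add]
      refine add_mem (Submodule.mem_sup_left (Ideal.mul_mem_left _ _ hv)) ?_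
      induction hw using Submodule.span_induction with
      | mem w hw => obtain ⟨α, h1, h2, rfl⟩ := hw; exact key α h1 h2 a
      | zero => simp
      | add a b _ _ ha hb =>
        rw [mul_add]
        exact add_mem (ha (add_mem (Submodule.mem_sup_left hv) (Submodule.mem_sup_right ‹_›)))
          (hb (add_mem (Submodule.mem_sup_left hv) (Submodule.mem_sup_right ‹_›)))
      | smul c b hb' hb =>
        rw [mul_smul_comm]
        exact Submodule.smul_mem _ _
          (hb (add_mem (Submodule.mem_sup_left hv) (Submodule.mem_sup_right hb')))
    rw [pow_succ', Submodule.mul_le]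
    intro a ha u hu
    obtain ⟨b, hb, c, ⟨c, rfl⟩, rfl⟩ := Submodule.mem_sup.1 ha
    obtain ⟨b, rfl⟩ := Submodule.mem_one.1 hb
    rw [add_mul, Algebra.algebraMap_eq_smul_one, smul_mul_assoc, one_mul]
    exact add_mem (Submodule.smul_mem _ _ (hmono (ih hu))) (key2 c (ih hu))

/-- Products of `n + 1` elements of `sl₂[t]` are congruent to shorter ones modulo the defining
ideal, so products of at most `n` elements span the quotient. -/
theorem weylIdealFilt_eq_top : weylIdealFilt n = ⊤ := by
  have h1 : filt ^ (n + 1) ≤ weylIdealFilt n := by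
    refine (filt_le_wordSpan (n := n) (n + 1)).trans (sup_le le_sup_left ?_)
    rw [wordSpan, Submodule.span_le]
    rintro _ ⟨α, hα, -, rfl⟩
    rcases hα.lt_or_eq with hlt | heq
    · exact mem_weylIdealFilt_of_filt (filt_mono (by simpa using Nat.lt_succ_iff.1 hlt)
        (word_mem_filt _))
    · exact word_mem_weylIdealFilt (by simpa using heq)
  apply usl2t_eq_top
  · exact mem_weylIdealFilt_of_filt (filt_mono (Nat.zero_le n) one_mem_filt_zero)
  · intro a u hu
    obtain ⟨v, hv, w, hw, rfl⟩ := Submodule.mem_sup.1 hu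
    rw [mul_add]
    exact add_mem (mem_weylIdealFilt_of_ideal (Ideal.mul_mem_left _ _ hv))
      (h1 (toU_mul_mem_filt a hw))

/-- The ordered words in `h ⊗ t ^ s` (`s > 0`) and `y ⊗ t ^ r` with at most `n` letters span the
enveloping algebra modulo the defining ideal of `W(n)`. -/
theorem weylIdeal_sup_wordSpan : (weylIdeal n).restrictScalars ℂ ⊔ wordSpan n = ⊤ := by
  rw [eq_top_iff, ← weylIdealFilt_eq_top (n := n)]
  exact sup_le le_sup_left (filt_le_wordSpan n)

end WordSpan

/-! ### The symmetric algebra of `ℂ² ⊗ ℂ[t]` -/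

/-- The symmetric algebra of `ℂ² ⊗ ℂ[t]`: the variable `(j, i)` is `e_j ⊗ t ^ i`. -/
abbrev SymV : Type := MvPolynomial (Fin 2 × ℕ) ℂ

open MvPolynomial

/-- The matrix with polynomial entries attached to an element of `sl₂[t]`. -/
def toMatrix : Sl2t →ₗ[ℂ] Matrix (Fin 2) (Fin 2) (Polynomial ℂ) :=
  TensorProduct.lift (LinearMap.mk₂ ℂ (fun p a => p • a.val.map Polynomial.C)
    (fun p q a => add_smul _ _ _) (fun c p a => smul_assoc _ _ _)
    (fun p a b => by ext; simp [mul_add]) (fun c p a => by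
      ext; simp only [Matrix.smul_apply, Matrix.map_apply, SetLike.val_smul, smul_eq_mul, map_mul,
        Polynomial.smul_eq_C_mul]; rw [mul_left_comm]))

theorem toMatrix_tmul (p : Polynomial ℂ) (a : Sl2) :
    toMatrix (p ⊗ₜ a) = p • a.val.map Polynomial.C := rfl

theorem toMatrix_lie (a b : Sl2t) :
    toMatrix ⁅a, b⁆ = toMatrix a * toMatrix b - toMatrix b * toMatrix a := by
  induction a using TensorProduct.induction_on with
  | zero => rw [show ⁅(0 : Sl2t), b⁆ = 0 from zero_lie b]; simp
  | add a a' ha ha' =>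
    rw [show ⁅(a + a' : Sl2t), b⁆ = ⁅a, b⁆ + ⁅a', b⁆ from add_lie a a' b, map_add, ha, ha', map_add]
    noncomm_ring
  | tmul p a =>
    induction b using TensorProduct.induction_on with
    | zero =>
      have h0 : ⁅(p ⊗ₜ a : Sl2t), (0 : Sl2t)⁆ = 0 := lie_zero (p ⊗ₜ a : Sl2t)
      rw [h0]; simp
    | add b b' hb hb' =>
      have h0 : ⁅(p ⊗ₜ a : Sl2t), (b + b' : Sl2t)⁆ = ⁅(p ⊗ₜ a : Sl2t), (b : Sl2t)⁆ +
        ⁅(p ⊗ₜ a : Sl2t), (b' : Sl2t)⁆ := lie_add (p ⊗ₜ a : Sl2t) b b'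
      rw [h0, map_add, hb, hb', map_add]
      noncomm_ring
    | tmul q b =>
      rw [LieAlgebra.ExtendScalars.bracket_tmul, toMatrix_tmul, toMatrix_tmul, toMatrix_tmul,
        LieAlgebra.SpecialLinear.sl_bracket]
      have hsub : ((a.val * b.val - b.val * a.val).map Polynomial.C :
          Matrix (Fin 2) (Fin 2) (Polynomial ℂ)) = a.val.map Polynomial.C * b.val.map Polynomial.C
            - b.val.map Polynomial.C * a.val.map Polynomial.C := by
        rw [← Matrix.map_mul, ← Matrix.map_mul]
        exact Matrix.map_sub _ (map_sub Polynomial.C) _ _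
      rw [hsub, smul_mul_smul_comm, smul_mul_smul_comm, mul_comm q p, smul_sub]

/-- The embedding of `e_j ⊗ ℂ[t]` into the symmetric algebra. -/
def lin (j : Fin 2) : Polynomial ℂ →ₗ[ℂ] SymV :=
  (Polynomial.basisMonomials ℂ).constr ℂ (fun i => (X (j, i) : SymV))

theorem lin_X_pow (j : Fin 2) (i : ℕ) : lin j (Polynomial.X ^ i) = X (j, i) := by
  rw [← Polynomial.monomial_one_right_eq_X_pow]
  have := (Polynomial.basisMonomials ℂ).constr_basis ℂ (fun i => (X (j, i) : SymV)) i
  rwa [Polynomial.coe_basisMonomials] at this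

/-- The action of an element of `sl₂[t]` on the symmetric algebra, by derivations. -/
def der (a : Sl2t) : Derivation ℂ SymV SymV :=
  mkDerivation ℂ fun v => ∑ k, lin k (toMatrix a k v.1 * Polynomial.X ^ v.2)

theorem der_X (a : Sl2t) (v : Fin 2 × ℕ) :
    der a (X v) = ∑ k, lin k (toMatrix a k v.1 * Polynomial.X ^ v.2) := by
  rw [der, mkDerivation_X]

theorem der_lin (a : Sl2t) (j : Fin 2) (p : Polynomial ℂ) :
    der a (lin j p) = ∑ k, lin k (toMatrix a k j * p) := by
  induction p using Polynomial.induction_on' with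
  | add p q hp hq => simp only [map_add, hp, hq, mul_add, Finset.sum_add_distrib]
  | monomial r c =>
    rw [← Polynomial.C_mul_X_pow_eq_monomial, ← Polynomial.smul_eq_C_mul]
    simp only [map_smul, Derivation.map_smul, mul_smul_comm, lin_X_pow, der_X, Finset.smul_sum]

theorem der_add (a b : Sl2t) : der (a + b) = der a + der b := by
  apply derivation_ext
  intro v
  simp only [Derivation.add_apply, der_X, map_add, Matrix.add_apply, add_mul,
    Finset.sum_add_distrib]

theorem der_smul (c : ℂ) (a : Sl2t) : der (c • a) = c • der a := by
  apply derivation_ext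
  intro v
  simp only [Derivation.smul_apply, der_X, map_smul, Matrix.smul_apply, smul_mul_assoc,
    Finset.smul_sum]

theorem der_lie (a b : Sl2t) : der ⁅a, b⁆ = ⁅der a, der b⁆ := by
  apply derivation_ext
  intro v
  rw [Derivation.commutator_apply]
  simp only [der_X, der_lin, map_sum, toMatrix_lie, Matrix.sub_apply, Matrix.mul_apply, sub_mul,
    map_sub, Finset.sum_sub_distrib, Finset.sum_mul, ← mul_assoc]
  rw [Finset.sum_comm, Finset.sum_comm (s := Finset.univ) (t := Finset.univ)
    (f := fun k l => lin l (toMatrix b l k * toMatrix a k v.1 * Polynomial.X ^ v.2))]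

instance : LieRingModule Sl2t SymV where
  bracket a p := der a p
  add_lie a b p := by rw [der_add, Derivation.add_apply]
  lie_add a p q := map_add _ _ _
  leibniz_lie a b p := by rw [der_lie, Derivation.commutator_apply, sub_add_cancel]

theorem lie_symV_def (a : Sl2t) (p : SymV) : ⁅a, p⁆ = der a p := rfl

instance : LieModule ℂ Sl2t SymV where
  smul_lie c a p := by rw [lie_symV_def, lie_symV_def, der_smul, Derivation.smul_apply]
  lie_smul c a p := (der a).map_smul c p

theorem der_x_X_zero (p : Polynomial ℂ) (i : ℕ) : der (p ⊗ₜ x) (X (0, i)) = 0 := by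
  simp [der_X, toMatrix_tmul, x, LieAlgebra.SpecialLinear.val_single, Matrix.single]

theorem der_x_X_one (p : Polynomial ℂ) (i : ℕ) :
    der (p ⊗ₜ x) (X (1, i)) = lin 0 (p * Polynomial.X ^ i) := by
  simp [der_X, toMatrix_tmul, x, LieAlgebra.SpecialLinear.val_single, Matrix.single]

theorem der_y_X_zero (p : Polynomial ℂ) (i : ℕ) :
    der (p ⊗ₜ y) (X (0, i)) = lin 1 (p * Polynomial.X ^ i) := by
  simp [der_X, toMatrix_tmul, y, LieAlgebra.SpecialLinear.val_single, Matrix.single]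

theorem der_y_X_one (p : Polynomial ℂ) (i : ℕ) : der (p ⊗ₜ y) (X (1, i)) = 0 := by
  simp [der_X, toMatrix_tmul, y, LieAlgebra.SpecialLinear.val_single, Matrix.single]

theorem der_h_X_zero (p : Polynomial ℂ) (i : ℕ) :
    der (p ⊗ₜ h) (X (0, i)) = lin 0 (p * Polynomial.X ^ i) := by
  simp [der_X, toMatrix_tmul, h, LieAlgebra.SpecialLinear.val_singleSubSingle, Matrix.single]

theorem der_h_X_one (p : Polynomial ℂ) (i : ℕ) :
    der (p ⊗ₜ h) (X (1, i)) = - lin 1 (p * Polynomial.X ^ i) := by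
  simp [der_X, toMatrix_tmul, h, LieAlgebra.SpecialLinear.val_singleSubSingle, Matrix.single]

theorem der_lower (v : Fin 2 × ℕ) : der (lower v) (X (0, 0)) = X v := by
  obtain ⟨j, i⟩ := v
  fin_cases j
  · simp [lower, cur, der_h_X_zero, lin_X_pow]
  · simp [lower, cur, der_y_X_zero, lin_X_pow]

/-! ### Weighted Euler operators -/

/-- The derivation that multiplies the variable `v` by `w v`. -/
def euler (w : Fin 2 × ℕ → ℂ) : Derivation ℂ SymV SymV := mkDerivation ℂ fun v => w v • X v

theorem euler_X (w : Fin 2 × ℕ → ℂ) (v : Fin 2 × ℕ) : euler w (X v) = w v • X v :=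
  mkDerivation_X _ _ _

theorem euler_monomial (w : Fin 2 × ℕ → ℂ) (s : Fin 2 × ℕ →₀ ℕ) (c : ℂ) :
    euler w (monomial s c) = (s.sum fun v k => (k : ℂ) * w v) • monomial s c := by
  rw [euler, mkDerivation_monomial, Finsupp.sum, Finsupp.sum, Finset.sum_smul, Finset.smul_sum]
  refine Finset.sum_congr rfl fun v hv => ?_
  have hle : Finsupp.single v 1 ≤ s := by
    rw [Finsupp.single_le_iff]; exact Nat.one_le_iff_ne_zero.2 (Finsupp.mem_support_iff.1 hv)
  rw [smul_eq_mul, mul_smul_comm, X, monomial_mul, tsub_add_cancel_of_le hle, smul_monomial,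
    smul_monomial, smul_monomial]
  congr 1
  simp only [smul_eq_mul, mul_one]
  ring

theorem coeff_euler (w : Fin 2 × ℕ → ℂ) (s : Fin 2 × ℕ →₀ ℕ) (p : SymV) :
    coeff s (euler w p) = (s.sum fun v k => (k : ℂ) * w v) * coeff s p := by
  induction p using MvPolynomial.induction_on' with
  | monomial t c =>
    rw [euler_monomial, coeff_smul, smul_eq_mul]
    by_cases hst : t = s
    · rw [hst]
    · simp [coeff_monomial, hst]
  | add p q hp hq => rw [map_add, coeff_add, coeff_add, hp, hq, mul_add]

theorem weight_eq_of_euler {w : Fin 2 × ℕ → ℂ} {p : SymV} {k : ℂ} (hp : euler w p = k • p)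
    {s : Fin 2 × ℕ →₀ ℕ} (hs : coeff s p ≠ 0) : (s.sum fun v j => (j : ℂ) * w v) = k := by
  have := congrArg (coeff s) hp
  rw [coeff_euler, coeff_smul, smul_eq_mul] at this
  exact mul_right_cancel₀ hs this

/-- The Euler operator, which multiplies a homogeneous polynomial by its degree. -/
abbrev deg : Derivation ℂ SymV SymV := euler fun _ => 1

/-- The operator that multiplies a polynomial of degree `k` in `t` by `k`. -/
abbrev tdeg : Derivation ℂ SymV SymV := euler fun v => (v.2 : ℂ)

theorem deg_lin (j : Fin 2) (p : Polynomial ℂ) : deg (lin j p) = lin j p := by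
  induction p using Polynomial.induction_on' with
  | add p q hp hq => simp only [map_add, hp, hq]
  | monomial r c =>
    rw [← Polynomial.C_mul_X_pow_eq_monomial, ← Polynomial.smul_eq_C_mul]
    simp only [map_smul, Derivation.map_smul, lin_X_pow, euler_X, one_smul]

theorem deg_der (a : Sl2t) (p : SymV) : deg (der a p) = der a (deg p) := by
  have : ⁅deg, der a⁆ = 0 := by
    apply derivation_ext
    intro v
    rw [Derivation.commutator_apply, der_X, map_sum, euler_X]
    simp only [deg_lin, one_smul, der_X, sub_self, Derivation.zero_apply]
  have h1 := congrArg (fun D => D p) this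
  rwa [Derivation.commutator_apply, Derivation.zero_apply, sub_eq_zero] at h1

theorem der_cur_X (a : Sl2) (r : ℕ) (v : Fin 2 × ℕ) :
    der (cur a r) (X v) = ∑ k, a.val k v.1 • X (k, r + v.2) := by
  rw [der_X]
  refine Finset.sum_congr rfl fun k _ => ?_
  rw [cur, toMatrix_tmul, Matrix.smul_apply, Matrix.map_apply, smul_eq_mul,
    mul_comm _ (Polynomial.C _), mul_assoc, ← pow_add, ← Polynomial.smul_eq_C_mul, map_smul,
    lin_X_pow]

theorem tdeg_der (a : Sl2) (r : ℕ) (p : SymV) :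
    tdeg (der (cur a r) p) = der (cur a r) (tdeg p) + (r : ℂ) • der (cur a r) p := by
  have : ⁅tdeg, der (cur a r)⁆ = (r : ℂ) • der (cur a r) := by
    apply derivation_ext
    intro v
    simp only [Derivation.commutator_apply, der_cur_X, map_sum, euler_X, Derivation.map_smul,
      Derivation.smul_apply, Finset.smul_sum]
    rw [← Finset.sum_sub_distrib]
    refine Finset.sum_congr rfl fun k _ => ?_
    push_cast
    module
  have h1 := congrArg (fun D => D p) this
  rw [Derivation.commutator_apply, Derivation.smul_apply, sub_eq_iff_eq_add] at h1
  rw [h1, add_comm]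

/-! ### The embedding of the global Weyl module into the symmetric algebra -/

namespace GlobalWeyl

variable (n : ℕ)

theorem lie_pow_X (a : Sl2t) (k : ℕ) :
    ⁅a, (X (0, 0) ^ k : SymV)⁆ = (k : ℂ) • (X (0, 0) ^ (k - 1) * der a (X (0, 0))) := by
  rw [lie_symV_def, Derivation.leibniz_pow, smul_eq_mul, Nat.cast_smul_eq_nsmul]

theorem toEnd_y_pow_X (k : ℕ) :
    (LieModule.toEnd ℂ Sl2t SymV (cur y 0) ^ k) (X (0, 0) ^ n) =
      (n.descFactorial k : ℂ) • (X (0, 0) ^ (n - k) * X (1, 0) ^ k) := by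
  induction k with
  | zero => simp
  | succ k ih =>
    have h1 : der (cur y 0) (X (1, 0)) = 0 := der_y_X_one _ _
    have h0 : der (cur y 0) (X (0, 0)) = X (1, 0) := der_lower (1, 0)
    rw [pow_succ', Module.End.mul_apply, ih, LieModule.toEnd_apply_apply, lie_smul, lie_symV_def,
      Derivation.leibniz, Derivation.leibniz_pow, Derivation.leibniz_pow, h1, h0,
      Nat.descFactorial_succ, Nat.sub_sub]
    simp only [smul_eq_mul, nsmul_eq_mul, mul_zero, zero_add]
    rw [smul_eq_C_mul, smul_eq_C_mul]
    push_cast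
    simp only [C_mul, map_natCast]
    ring

/-- The homomorphism from `W(n)` to the symmetric algebra of `ℂ² ⊗ ℂ[t]` that maps the generator
to the `n`-th power of the highest weight vector of `ℂ²`. -/
def toSym : GlobalWeyl n →ₗ⁅ℂ,Sl2t⁆ SymV :=
  lift (X (0, 0) ^ n)
    (fun p => by rw [lie_pow_X, der_x_X_zero, mul_zero, smul_zero])
    (by
      rw [lie_pow_X, show der (cur h 0) (X (0, 0)) = X (0, 0) from der_lower (0, 0)]
      rcases n with _ | n
      · simp
      · rw [Nat.add_sub_cancel, ← pow_succ]; simp)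
    (by
      rw [show ((n : ℤ) + 1).toNat = n + 1 from rfl, toEnd_y_pow_X, Nat.descFactorial_of_lt]
      · simp
      · omega)

theorem toSym_gen : toSym n (gen n) = X (0, 0) ^ n := lift_gen _ _ _ _

variable {n}

theorem toSym_mk_mul (a : Sl2t) (u : USl2t) :
    toSym n (mk n (toU a * u)) = der a (toSym n (mk n u)) := by
  rw [← lie_mk, LieModuleHom.map_lie, lie_symV_def]

/-- The leading term of a word applied to the highest weight vector: modulo higher powers of the
variable `(0, 0)`, a word of length `d` replaces `d` of the factors by its letters. -/
theorem toSym_word (l : List (Fin 2 × ℕ)) (hl : l.length ≤ n) : ∃ q : SymV,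
    toSym n (mk n (word l)) = (n.descFactorial l.length : ℂ) •
      ((l.map X).prod * X (0, 0) ^ (n - l.length)) + X (0, 0) ^ (n - l.length + 1) * q := by
  induction l with
  | nil =>
    refine ⟨0, ?_⟩
    rw [word]
    simpa [gen] using toSym_gen n
  | cons v l ih =>
    rw [List.length_cons] at hl
    obtain ⟨q, hq⟩ := ih (by omega)
    obtain ⟨m, hm⟩ : ∃ m, n - l.length = m + 1 := ⟨n - l.length - 1, by omega⟩
    have hm' : n - (v :: l).length = m := by rw [List.length_cons]; omega
    rw [word_cons, toSym_mk_mul, hq, hm', hm, List.length_cons, Nat.descFactorial_succ, hm]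
    refine ⟨(n.descFactorial l.length : ℂ) • der (lower v) (l.map X).prod +
      ((m : SymV) + 2) * X v * q + X (0, 0) * der (lower v) q, ?_⟩
    rw [map_add, Derivation.map_smul, Derivation.leibniz, Derivation.leibniz,
      Derivation.leibniz_pow,
      Derivation.leibniz_pow, der_lower]
    simp only [smul_eq_mul, nsmul_eq_mul, Nat.add_sub_cancel, List.map_cons, List.prod_cons,
      smul_eq_C_mul]
    push_cast
    simp only [C_mul, map_natCast, C_add, C_1]
    ring

theorem list_prod_X (l : List (Fin 2 × ℕ)) :
    ((l.map X).prod : SymV) = monomial (Multiset.toFinsupp (l : Multiset (Fin 2 × ℕ))) 1 := by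
  induction l with
  | nil => simp
  | cons v l ih =>
    rw [List.map_cons, List.prod_cons, ih, ← Multiset.cons_coe, ← Multiset.singleton_add, map_add,
      Multiset.toFinsupp_singleton, X, monomial_mul, mul_one]

/-- The multi-index of the leading monomial of an ordered word. -/
def leadIndex (n : ℕ) (α : Multiset (Fin 2 × ℕ)) : Fin 2 × ℕ →₀ ℕ :=
  Multiset.toFinsupp α + Finsupp.single (0, 0) (n - α.card)

theorem leadIndex_zero {α : Multiset (Fin 2 × ℕ)} (h0 : (0, 0) ∉ α) :
    leadIndex n α (0, 0) = n - α.card := by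
  simp [leadIndex, Multiset.count_eq_zero_of_notMem h0]

theorem leadIndex_inj {α β : Multiset (Fin 2 × ℕ)} (hα : (0, 0) ∉ α) (hβ : (0, 0) ∉ β)
    (hαβ : leadIndex n α = leadIndex n β) : α = β := by
  ext v
  by_cases hv : v = (0, 0)
  · rw [hv, Multiset.count_eq_zero_of_notMem hα, Multiset.count_eq_zero_of_notMem hβ]
  · have := DFunLike.congr_fun hαβ v
    simpa [leadIndex, Finsupp.single_apply, Ne.symm hv] using this

theorem toSym_word_toList (α : Multiset (Fin 2 × ℕ)) (hα : α.card ≤ n) : ∃ q : SymV,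
    toSym n (mk n (word α.toList)) = (n.descFactorial α.card : ℂ) • monomial (leadIndex n α) 1 +
      X (0, 0) ^ (n - α.card + 1) * q := by
  obtain ⟨q, hq⟩ := toSym_word α.toList (by simpa using hα)
  refine ⟨q, ?_⟩
  rw [hq, list_prod_X, Multiset.coe_toList, Multiset.length_toList, X_pow_eq_monomial,
    X_pow_eq_monomial, monomial_mul, one_mul, leadIndex]

theorem coeff_X_pow_mul_eq_zero {s : Fin 2 × ℕ →₀ ℕ} {k : ℕ} (hs : s (0, 0) < k) (q : SymV) :
    coeff s (X (0, 0) ^ k * q) = 0 := by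
  rw [X_pow_eq_monomial, coeff_monomial_mul', if_neg]
  rw [Finsupp.single_le_iff]; omega

/-- `W(n)` embeds into the symmetric algebra: the images of the words in the spanning set have
distinct leading monomials. -/
theorem toSym_injective : Function.Injective (toSym n) := by
  rw [injective_iff_map_eq_zero]
  intro u hu
  obtain ⟨u, rfl⟩ := mk_surjective u
  have hu' : u ∈ (weylIdeal n).restrictScalars ℂ ⊔ wordSpan n := by
    rw [weylIdeal_sup_wordSpan]; trivial
  obtain ⟨v, hv, w, hw, rfl⟩ := Submodule.mem_sup.1 hu'
  rw [map_add, mk_eq_zero.2 hv, zero_add] at hu ⊢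
  let A : Set (Multiset (Fin 2 × ℕ)) := {α | α.card ≤ n ∧ (0, 0) ∉ α}
  have hspan : wordSpan n = Submodule.span ℂ ((fun α => word α.toList) '' A) := by
    rw [wordSpan]
    congr 1
    ext u
    constructor
    · rintro ⟨α, h1, h2, rfl⟩; exact ⟨α, ⟨h1, h2⟩, rfl⟩
    · rintro ⟨α, ⟨h1, h2⟩, rfl⟩; exact ⟨α, h1, h2, rfl⟩
  rw [hspan, Finsupp.mem_span_image_iff_linearCombination] at hw
  obtain ⟨l, hl, rfl⟩ := hw
  by_contra hne
  have hl0 : l.support.Nonempty := by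
    rw [Finsupp.support_nonempty_iff]; rintro rfl; simp at hne
  obtain ⟨β, hβ, hmax⟩ := Finset.exists_max_image l.support Multiset.card hl0
  have hβA : β ∈ A := hl hβ
  have hcoeff : ∀ α ∈ l.support, α ≠ β →
      coeff (leadIndex n β) (l α • toSym n (mk n (word α.toList))) = 0 := by
    intro α hα hne
    have hαA : α ∈ A := hl hα
    obtain ⟨q, hq⟩ := toSym_word_toList α hαA.1
    have h1 := hmax α hα
    have h2 := hβA.1
    rw [hq, coeff_smul, coeff_add, coeff_smul, coeff_monomial,
      if_neg fun e => hne (leadIndex_inj hαA.2 hβA.2 e), coeff_X_pow_mul_eq_zero]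
    · simp
    · rw [leadIndex_zero hβA.2]; omega
  have hmk : mk n (Finsupp.linearCombination ℂ (fun α => word α.toList) l) =
      l.sum fun α c => c • mk n (word α.toList) := by
    have := map_finsuppSum ((mk n).restrictScalars ℂ) l (fun α c => c • word α.toList)
    rw [Finsupp.linearCombination_apply]
    exact this
  rw [hmk, Finsupp.sum, map_sum] at hu
  have h1 := congrArg (coeff (leadIndex n β)) hu
  simp only [map_smul] at h1
  rw [coeff_sum, Finset.sum_eq_single β hcoeff (fun hn => absurd hβ hn), coeff_smul,
    coeff_zero] at h1
  obtain ⟨q, hq⟩ := toSym_word_toList β hβA.1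
  rw [hq, coeff_add, coeff_smul, coeff_monomial, if_pos rfl, coeff_X_pow_mul_eq_zero] at h1
  · have h2 : (n.descFactorial β.card : ℂ) ≠ 0 := by
      rw [Nat.cast_ne_zero, Nat.ne_zero_iff_zero_lt]
      exact Nat.descFactorial_pos.2 hβA.1
    have h3 : l β ≠ 0 := Finsupp.mem_support_iff.1 hβ
    simp [h2, h3] at h1
  · rw [leadIndex_zero hβA.2]; omega

theorem deg_toSym (u : GlobalWeyl n) : deg (toSym n u) = (n : ℂ) • toSym n u := by
  have := eq_top_of_gen_mem (m := n) (p := LinearMap.eqLocus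
    (deg.toLinearMap ∘ₗ (toSym n : GlobalWeyl n →ₗ[ℂ] SymV))
    ((n : ℂ) • (toSym n : GlobalWeyl n →ₗ[ℂ] SymV))) (by
      change deg (toSym n (gen n)) = (n : ℂ) • toSym n (gen n)
      rw [toSym_gen, Derivation.leibniz_pow, euler_X, one_smul]
      rcases n with _ | n
      · simp
      · rw [Nat.add_sub_cancel, smul_eq_mul, ← pow_succ, Nat.cast_smul_eq_nsmul])
    (fun a u hu => by
      change deg (toSym n u) = (n : ℂ) • toSym n u at hu
      change deg (toSym n ⁅a, u⁆) = (n : ℂ) • toSym n ⁅a, u⁆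
      rw [LieModuleHom.map_lie, lie_symV_def, deg_der, hu, Derivation.map_smul])
  have hu : u ∈ LinearMap.eqLocus
    (deg.toLinearMap ∘ₗ (toSym n : GlobalWeyl n →ₗ[ℂ] SymV))
    ((n : ℂ) • (toSym n : GlobalWeyl n →ₗ[ℂ] SymV)) := this ▸ Submodule.mem_top
  exact hu

theorem sum_eq_of_coeff_ne_zero {p : SymV} (hp : deg p = (n : ℂ) • p) {s : Fin 2 × ℕ →₀ ℕ}
    (hs : coeff s p ≠ 0) : (s.sum fun _ k => k) = n := by
  have := weight_eq_of_euler hp hs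
  simp only [mul_one] at this
  rw [Finsupp.sum] at this ⊢
  exact_mod_cast this

/-- The image of `W(n)` in the symmetric algebra is the space of homogeneous elements of
degree `n`. -/
theorem exists_toSym_eq {p : SymV} (hp : deg p = (n : ℂ) • p) : ∃ u, toSym n u = p := by
  have key : ∀ d : ℕ, d ≤ n → ∀ s : Fin 2 × ℕ →₀ ℕ, (s.sum fun _ k => k) = n →
      s (0, 0) = n - d → ∃ u, toSym n u = monomial s 1 := by
    intro d
    induction d using Nat.strong_induction_on with
    | _ d ih =>
      intro hd s hs hs0
      let α : Multiset (Fin 2 × ℕ) := Finsupp.toMultiset (s.erase (0, 0))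
      have h0 : (0, 0) ∉ α := by
        rw [← Multiset.count_eq_zero, Finsupp.count_toMultiset, Finsupp.erase_same]
      have hcard : α.card = d := by
        have h1 : (s.sum fun _ k => k) = (Finsupp.toMultiset s).card :=
          (Finsupp.card_toMultiset s).symm
        rw [hs] at h1
        have h2 := Finsupp.single_add_erase (0, 0) s
        rw [← h2, map_add, Multiset.card_add, Finsupp.toMultiset_single] at h1
        simp only [Multiset.card_nsmul, Multiset.card_singleton] at h1
        change α.card = d
        have h3 : (Finsupp.toMultiset (s.erase (0, 0))).card = α.card := rfl
        omega
      have hlead : leadIndex n α = s := by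
        rw [leadIndex, hcard, ← hs0, Finsupp.toMultiset_toFinsupp, add_comm,
          Finsupp.single_add_erase]
      obtain ⟨q, hq⟩ := toSym_word_toList α (hcard.le.trans hd)
      rw [hlead, hcard] at hq
      have hc : (n.descFactorial d : ℂ) ≠ 0 := by
        rw [Nat.cast_ne_zero, Nat.ne_zero_iff_zero_lt]
        exact Nat.descFactorial_pos.2 hd
      have hrest : X (0, 0) ^ (n - d + 1) * q ∈
          LinearMap.range (toSym n : GlobalWeyl n →ₗ[ℂ] SymV) := by
        have hdeg : deg (X (0, 0) ^ (n - d + 1) * q) = (n : ℂ) • (X (0, 0) ^ (n - d + 1) * q) := by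
          have h1 := deg_toSym (mk n (word α.toList))
          rw [hq, map_add, Derivation.map_smul, euler_monomial, smul_add] at h1
          have h2 : (s.sum fun _ k => (k : ℂ) * 1) = n := by
            simp only [mul_one]
            rw [← hs, Finsupp.sum, Finsupp.sum]; push_cast; rfl
          rw [h2, smul_comm] at h1
          exact add_left_cancel h1
        rw [(X (0, 0) ^ (n - d + 1) * q : SymV).as_sum]
        refine Submodule.sum_mem _ fun s' hs' => ?_
        have hs'' := mem_support_iff.1 hs'
        have hsum := sum_eq_of_coeff_ne_zero hdeg hs''
        have hge : n - d + 1 ≤ s' (0, 0) := by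
          by_contra hlt
          exact hs'' (coeff_X_pow_mul_eq_zero (by omega) q)
        have hle : s' (0, 0) ≤ n := by
          rw [← hsum]
          by_cases hz : s' (0, 0) = 0
          · omega
          · exact Finset.single_le_sum (f := fun v => s' v) (fun _ _ => Nat.zero_le _)
              (Finsupp.mem_support_iff.2 hz)
        obtain ⟨u, hu⟩ := ih (n - s' (0, 0)) (by omega) (by omega) s' hsum (by omega)
        rw [← mul_one (coeff s' _), ← smul_eq_mul, ← smul_monomial]
        exact Submodule.smul_mem _ _ ⟨u, hu⟩
      obtain ⟨u, hu⟩ := hrest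
      refine ⟨(n.descFactorial d : ℂ)⁻¹ • (mk n (word α.toList) - u), ?_⟩
      rw [map_smul, map_sub, hq, ← hu]
      simp [smul_smul, inv_mul_cancel₀ hc]
  have hmem : p ∈ LinearMap.range (toSym n : GlobalWeyl n →ₗ[ℂ] SymV) := by
    rw [p.as_sum]
    refine Submodule.sum_mem _ fun s hs => ?_
    have hsum := sum_eq_of_coeff_ne_zero hp (mem_support_iff.1 hs)
    have hle : s (0, 0) ≤ n := by
      rw [← hsum]
      by_cases hz : s (0, 0) = 0
      · omega
      · exact Finset.single_le_sum (f := fun v => s v) (fun _ _ => Nat.zero_le _)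
          (Finsupp.mem_support_iff.2 hz)
    obtain ⟨u, hu⟩ := key (n - s (0, 0)) (by omega) s hsum (by omega)
    rw [← mul_one (coeff s _), ← smul_eq_mul, ← smul_monomial]
    exact Submodule.smul_mem _ _ ⟨u, hu⟩
  exact hmem

end GlobalWeyl

/-! ### Gradings as eigenspace decompositions -/

section Grading

variable {M : Type} [AddCommGroup M] [Module ℂ M]
variable {N : Type} [AddCommGroup N] [Module ℂ N]

/-- The operator `d` is the degree operator of a grading: the pieces `V k` span `M` and `d` acts on
`V k` by the scalar `k`. -/
structure IsGradedByOp (d : M →ₗ[ℂ] M) (V : ℤ → Submodule ℂ M) : Prop where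
  apply_eq : ∀ (k : ℤ) (v : M), v ∈ V k → d v = (k : ℂ) • v
  iSup_eq_top : ⨆ k, V k = ⊤

namespace IsGradedByOp

variable {d : M →ₗ[ℂ] M} {V : ℤ → Submodule ℂ M} {d' : N →ₗ[ℂ] N} {W : ℤ → Submodule ℂ N}

theorem iSupIndep_eigenspace (d : M →ₗ[ℂ] M) :
    iSupIndep fun k : ℤ => Module.End.eigenspace d (k : ℂ) :=
  (Module.End.eigenspaces_iSupIndep d).comp Int.cast_injective

theorem le_eigenspace (hV : IsGradedByOp d V) (k : ℤ) : V k ≤ Module.End.eigenspace d (k : ℂ) :=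
  fun v hv => Module.End.mem_eigenspace_iff.2 (hV.apply_eq k v hv)

theorem iSupIndep (hV : IsGradedByOp d V) : iSupIndep V :=
  (iSupIndep_eigenspace d).mono hV.le_eigenspace

theorem isInternal (hV : IsGradedByOp d V) : DirectSum.IsInternal V :=
  DirectSum.isInternal_submodule_of_iSupIndep_of_iSup_eq_top hV.iSupIndep hV.iSup_eq_top

theorem mem_iff (hV : IsGradedByOp d V) {k : ℤ} {v : M} : v ∈ V k ↔ d v = (k : ℂ) • v := by
  refine ⟨hV.apply_eq k v, fun hv => ?_⟩
  have h1 := (iSupIndep_eigenspace d) k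
  have h2 : (⨆ j, ⨆ (_ : j ≠ k), V j) ≤
      ⨆ j, ⨆ (_ : j ≠ k), Module.End.eigenspace d ((j : ℤ) : ℂ) :=
    iSup₂_mono fun j _ => hV.le_eigenspace j
  have h3 : V k ⊔ (⨆ j, ⨆ (_ : j ≠ k), V j) = ⊤ := by
    rw [← iSup_split_single, hV.iSup_eq_top]
  obtain ⟨a, ha, b, hb, rfl⟩ := Submodule.mem_sup.1 (h3 ▸ Submodule.mem_top (x := v))
  have hb' : b ∈ Module.End.eigenspace d (k : ℂ) := by
    have := Submodule.sub_mem _ (Module.End.mem_eigenspace_iff.2 hv) (hV.le_eigenspace k ha)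
    rwa [add_sub_cancel_left] at this
  have hb0 : b = 0 := Submodule.disjoint_def.1 h1 b hb' (h2 hb)
  rw [hb0, add_zero]; exact ha

theorem induction (hV : IsGradedByOp d V) {C : M → Prop} (h0 : C 0)
    (hadd : ∀ u v, C u → C v → C (u + v)) (hmem : ∀ k, ∀ v ∈ V k, C v) (v : M) : C v :=
  Submodule.iSup_induction V (motive := C) (hV.iSup_eq_top ▸ Submodule.mem_top (x := v)) hmem h0
    hadd

theorem comm_of_degreeZero (hV : IsGradedByOp d V) (hW : IsGradedByOp d' W) {f : M →ₗ[ℂ] N}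
    (hf : ∀ (k : ℤ) (v : M), v ∈ V k → f v ∈ W k) (v : M) : f (d v) = d' (f v) := by
  induction v using hV.induction with
  | h0 => simp
  | hadd u v hu hv => simp only [map_add, hu, hv]
  | hmem k v hv => rw [hV.apply_eq k v hv, map_smul, hW.apply_eq k _ (hf k v hv)]

theorem mem_iff_of_injective (hV : IsGradedByOp d V) (hW : IsGradedByOp d' W) {f : M →ₗ[ℂ] N}
    (hf : ∀ (k : ℤ) (v : M), v ∈ V k → f v ∈ W k) (hinj : Function.Injective f) (k : ℤ) (v : M) :
    v ∈ V k ↔ f v ∈ W k := by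
  refine ⟨hf k v, fun hv => hV.mem_iff.2 (hinj ?_)⟩
  rw [hV.comm_of_degreeZero hW hf, hW.apply_eq k _ hv, map_smul]

/-- A grading pulls back along an injective map intertwining it with eigenspaces of an operator. -/
theorem exists_of_injective {V : ℤ → Submodule ℂ M} (hV : ⨆ k, V k = ⊤) {f : M →ₗ[ℂ] N}
    (hinj : Function.Injective f) (D : N →ₗ[ℂ] N)
    (hf : ∀ (k : ℤ) (v : M), v ∈ V k → D (f v) = (k : ℂ) • f v) :
    ∃ d : M →ₗ[ℂ] M, IsGradedByOp d V := by
  have hex : ∀ v : M, ∃ w, f w = D (f v) := by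
    intro v
    induction hV ▸ Submodule.mem_top (x := v) using Submodule.iSup_induction' with
    | mem k v hv => exact ⟨(k : ℂ) • v, by rw [map_smul, hf k v hv]⟩
    | zero => exact ⟨0, by simp⟩
    | add u v _ _ hu hv =>
      obtain ⟨a, ha⟩ := hu
      obtain ⟨b, hb⟩ := hv
      exact ⟨a + b, by simp [ha, hb]⟩
  choose d hd using hex
  refine ⟨{ toFun := d
            map_add' := fun u v => hinj (by simp [hd])
            map_smul' := fun c v => hinj (by simp [hd]) }, fun k v hv => hinj ?_, hV⟩
  rw [map_smul]
  exact (hd v).trans (hf k v hv)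

end IsGradedByOp

end Grading

section GradedLie

variable {M : Type} [AddCommGroup M] [Module ℂ M] [LieRingModule Sl2t M] [LieModule ℂ Sl2t M]
variable {N : Type} [AddCommGroup N] [Module ℂ N] [LieRingModule Sl2t N] [LieModule ℂ Sl2t N]

/-! ### Representations with finitely many weights -/

/-- The representation is spanned by weight vectors with weights in a finite set. -/
def HasWeightsIn (s : Finset ℤ) (M : Type) [AddCommGroup M] [Module ℂ M] [LieRingModule Sl2t M] :
    Prop :=
  Submodule.span ℂ {v : M | ∃ μ ∈ s, ⁅cur h 0, v⁆ = (μ : ℂ) • v} = ⊤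

theorem HasWeightsIn.mem {s : Finset ℤ} (hs : HasWeightsIn s M) {v : M} (hv : v ≠ 0) {μ : ℤ}
    (hμ : ⁅cur h 0, v⁆ = (μ : ℂ) • v) : μ ∈ s := by
  by_contra hn
  have h1 := (IsGradedByOp.iSupIndep_eigenspace (LieModule.toEnd ℂ Sl2t M (cur h 0))) μ
  refine hv (Submodule.disjoint_def.1 h1 v (Module.End.mem_eigenspace_iff.2 hμ) ?_)
  have h2 : v ∈ Submodule.span ℂ {v : M | ∃ μ ∈ s, ⁅cur h 0, v⁆ = (μ : ℂ) • v} := by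
    rw [HasWeightsIn] at hs
    rw [hs]; trivial
  refine Submodule.span_le.2 ?_ h2
  rintro w ⟨ν, hν, hw⟩
  exact Submodule.mem_iSup_of_mem ν (Submodule.mem_iSup_of_mem (by rintro rfl; exact hn hν)
    (Module.End.mem_eigenspace_iff.2 hw))

theorem HasWeightsIn.finite {s : Finset ℤ} (hs : HasWeightsIn s M) :
    {μ : ℤ | ∃ v : M, v ≠ 0 ∧ ⁅cur h 0, v⁆ = (μ : ℂ) • v}.Finite :=
  s.finite_toSet.subset fun _ ⟨_, hv, hμ⟩ => hs.mem hv hμ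

omit [LieModule ℂ Sl2t M] [LieModule ℂ Sl2t N] in
theorem HasWeightsIn.of_surjective {s : Finset ℤ} (hs : HasWeightsIn s M) {f : M →ₗ⁅ℂ,Sl2t⁆ N}
    (hf : Function.Surjective f) : HasWeightsIn s N := by
  have hr : LinearMap.range (f : M →ₗ[ℂ] N) = ⊤ := LinearMap.range_eq_top.2 hf
  rw [HasWeightsIn, eq_top_iff, ← hr, LinearMap.range_eq_map, ← show _ = ⊤ from hs,
    Submodule.map_span]
  apply Submodule.span_mono
  rintro _ ⟨v, ⟨μ, hμ, hv⟩, rfl⟩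
  refine ⟨μ, hμ, ?_⟩
  rw [LieModuleHom.coe_toLinearMap, ← LieModuleHom.map_lie, hv, map_smul]

theorem HasWeightsIn.tensor {s t : Finset ℤ} (hs : HasWeightsIn s M) (ht : HasWeightsIn t N) :
    HasWeightsIn (Finset.image₂ (· + ·) s t) (M ⊗[ℂ] N) := by
  rw [HasWeightsIn, eq_top_iff, ← TensorProduct.map₂_mk_top_top_eq_top, ← show _ = ⊤ from hs,
    ← show _ = ⊤ from ht, Submodule.map₂_span_span]
  apply Submodule.span_mono
  rintro _ ⟨v, ⟨μ, hμ, hv⟩, w, ⟨ν, hν, hw⟩, rfl⟩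
  refine ⟨μ + ν, Finset.mem_image₂_of_mem hμ hν, ?_⟩
  change ⁅cur h 0, v ⊗ₜ[ℂ] w⁆ = _ • v ⊗ₜ[ℂ] w
  rw [TensorProduct.LieModule.lie_tmul_right, hv, hw, ← TensorProduct.smul_tmul',
    TensorProduct.tmul_smul, Int.cast_add, add_smul]

theorem HasWeightsIn.directSum {ι : Type} {P : ι → Type} [∀ i, AddCommGroup (P i)]
    [∀ i, Module ℂ (P i)] [∀ i, LieRingModule Sl2t (P i)] [∀ i, LieModule ℂ Sl2t (P i)]
    {s : Finset ℤ} (hs : ∀ i, HasWeightsIn s (P i)) : HasWeightsIn s (⨁ i, P i) := by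
  classical
  rw [HasWeightsIn, eq_top_iff]
  rintro v -
  induction v using DirectSum.induction_on with
  | zero => exact zero_mem _
  | add u v hu hv => exact add_mem hu hv
  | of i v =>
    have hv : v ∈ Submodule.span ℂ {v : P i | ∃ μ ∈ s, ⁅cur h 0, v⁆ = (μ : ℂ) • v} := by
      rw [show _ = ⊤ from hs i]; trivial
    have h1 := Submodule.mem_map_of_mem (f := DirectSum.lof ℂ ι P i) hv
    rw [Submodule.map_span] at h1
    refine Submodule.span_mono ?_ h1
    rintro _ ⟨w, ⟨μ, hμ, hw⟩, rfl⟩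
    refine ⟨μ, hμ, ?_⟩
    have := LieModuleHom.map_lie (DirectSum.lieModuleOf ℂ ι Sl2t P i) (cur h 0) w
    rw [hw] at this
    exact this.symm.trans ((DirectSum.lof ℂ ι P i).map_smul _ _)

/-- In a representation with finitely many weights, a vector of weight `m` killed by `x` is killed
by `y ^ (m + 1)`. -/
theorem HasWeightsIn.toEnd_y_pow_eq_zero {s : Finset ℤ} (hs : HasWeightsIn s M) {v : M} {m : ℕ}
    (hx : ⁅cur x 0, v⁆ = 0) (hh : ⁅cur h 0, v⁆ = (m : ℂ) • v) :
    (LieModule.toEnd ℂ Sl2t M (cur y 0) ^ (m + 1)) v = 0 := by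
  by_cases hv : v = 0
  · simp [hv]
  have P : isSl2Triple.HasPrimitiveVectorWith v (m : ℂ) := ⟨hv, hh, hx⟩
  obtain ⟨N, hN⟩ : ∃ N : ℕ, (m : ℤ) - 2 * N ∉ s := by
    by_contra! hall
    have hinj : Function.Injective fun N : ℕ => (m : ℤ) - 2 * N := by
      intro a b hab
      simp only at hab
      omega
    exact Set.infinite_range_of_injective hinj
      (s.finite_toSet.subset (by rintro _ ⟨N, rfl⟩; exact hall N))
  refine CurrentSl2.toEnd_y_pow_eq_zero (N := N) hx hh ?_
  by_contra hne
  refine hN (hs.mem hne ?_)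
  rw [P.lie_h_pow_toEnd_f N]
  push_cast
  rfl

/-! ### Tensor products and direct sums of graded representations -/

omit [LieRingModule Sl2t M] [LieModule ℂ Sl2t M] [LieRingModule Sl2t N] [LieModule ℂ Sl2t N] in
theorem isGradedByOp_tensor {d : M →ₗ[ℂ] M} {V : ℤ → Submodule ℂ M} {d' : N →ₗ[ℂ] N}
    {W : ℤ → Submodule ℂ N} (hV : IsGradedByOp d V) (hW : IsGradedByOp d' W) :
    IsGradedByOp (d.rTensor N + d'.lTensor M) (tensorGrade V W) where
  apply_eq := by
    intro k v hv
    rw [← Module.End.mem_eigenspace_iff]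
    refine iSup_le (fun a => Submodule.map₂_le.2 fun m hm n hn => ?_) hv
    rw [Module.End.mem_eigenspace_iff, LinearMap.add_apply, TensorProduct.mk_apply,
      LinearMap.rTensor_tmul, LinearMap.lTensor_tmul, hV.apply_eq a m hm, hW.apply_eq _ n hn,
      ← TensorProduct.smul_tmul', TensorProduct.tmul_smul, ← add_smul]
    push_cast
    rw [add_sub_cancel]
  iSup_eq_top := by
    rw [eq_top_iff, ← TensorProduct.map₂_mk_top_top_eq_top, ← hV.iSup_eq_top, ← hW.iSup_eq_top,
      Submodule.map₂_iSup_left]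
    refine iSup_le fun a => ?_
    rw [Submodule.map₂_iSup_right]
    refine iSup_le fun b => ?_
    refine le_iSup_of_le (a + b) (le_iSup_of_le a ?_)
    rw [add_sub_cancel_left]

theorem tensorGrade_lie_mem {V : ℤ → Submodule ℂ M} {W : ℤ → Submodule ℂ N} (a : Sl2) (r : ℕ)
    (hV : ∀ (s : ℤ) (v : M), v ∈ V s → ⁅cur a r, v⁆ ∈ V ((r : ℤ) + s))
    (hW : ∀ (s : ℤ) (v : N), v ∈ W s → ⁅cur a r, v⁆ ∈ W ((r : ℤ) + s))
    (s : ℤ) (v : M ⊗[ℂ] N) (hv : v ∈ tensorGrade V W s) :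
    ⁅cur a r, v⁆ ∈ tensorGrade V W ((r : ℤ) + s) := by
  have hle : tensorGrade V W s ≤ (tensorGrade V W ((r : ℤ) + s)).comap
      (LieModule.toEnd ℂ Sl2t (M ⊗[ℂ] N) (cur a r)) := by
    refine iSup_le fun b => Submodule.map₂_le.2 fun m hm n hn => ?_
    rw [Submodule.mem_comap, LieModule.toEnd_apply_apply, TensorProduct.mk_apply,
      TensorProduct.LieModule.lie_tmul_right]
    refine add_mem (Submodule.mem_iSup_of_mem ((r : ℤ) + b) ?_) (Submodule.mem_iSup_of_mem b ?_)
    · refine Submodule.apply_mem_map₂ _ (hV b m hm) ?_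
      rwa [add_sub_add_left_eq_sub]
    · refine Submodule.apply_mem_map₂ _ hm ?_
      rw [add_sub_assoc]
      exact hW _ _ hn
  exact hle hv

/-- The graded pieces vanish in negative degrees, and are finite-dimensional. -/
structure IsNonnegFinite (V : ℤ → Submodule ℂ M) : Prop where
  eq_bot : ∀ k < 0, V k = ⊥
  fg : ∀ k, (V k).FG

omit [LieRingModule Sl2t M] [LieModule ℂ Sl2t M] [LieRingModule Sl2t N] [LieModule ℂ Sl2t N] in
theorem IsNonnegFinite.tensor {V : ℤ → Submodule ℂ M} {W : ℤ → Submodule ℂ N}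
    (hV : IsNonnegFinite V) (hW : IsNonnegFinite W) : IsNonnegFinite (tensorGrade V W) where
  eq_bot := by
    intro k hk
    rw [tensorGrade, iSup_eq_bot]
    intro a
    by_cases ha : a < 0
    · rw [hV.eq_bot a ha, Submodule.map₂_bot_left]
    · rw [hW.eq_bot (k - a) (by omega), Submodule.map₂_bot_right]
  fg := by
    intro k
    have : tensorGrade V W k = ⨆ a ∈ Finset.Icc 0 k,
        Submodule.map₂ (TensorProduct.mk ℂ M N) (V a) (W (k - a)) := by
      refine le_antisymm (iSup_le fun a => ?_) (iSup_le fun a => iSup_le fun _ => le_iSup (fun a =>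
        Submodule.map₂ (TensorProduct.mk ℂ M N) (V a) (W (k - a))) a)
      by_cases ha : a < 0
      · rw [hV.eq_bot a ha, Submodule.map₂_bot_left]; exact bot_le
      by_cases ha' : k < a
      · rw [hW.eq_bot (k - a) (by omega), Submodule.map₂_bot_right]; exact bot_le
      · exact le_iSup₂_of_le a (Finset.mem_Icc.2 (by omega)) le_rfl
    rw [this]
    exact Submodule.fg_biSup _ _ fun a _ => (hV.fg a).map₂ _ (hW.fg _)

section DirectSum

variable {ι : Type} {P : ι → Type} [∀ i, AddCommGroup (P i)] [∀ i, Module ℂ (P i)]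
  {V : ∀ i, ℤ → Submodule ℂ (P i)}

theorem mem_sumGrade {k : ℤ} {v : ⨁ i, P i} : v ∈ sumGrade V k ↔ ∀ i, v i ∈ V i k := by
  simp only [sumGrade, Submodule.mem_iInf, Submodule.mem_comap]
  rfl

theorem lof_mem_sumGrade [DecidableEq ι] {k : ℤ} {i : ι} {v : P i} (hv : v ∈ V i k) :
    DirectSum.lof ℂ ι P i v ∈ sumGrade V k := by
  rw [mem_sumGrade]
  intro j
  by_cases hij : i = j
  · subst hij; rwa [DirectSum.lof_apply]
  · rw [DirectSum.lof_eq_of, DirectSum.of_eq_of_ne _ _ _ (Ne.symm hij)]; exact zero_mem _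

theorem isGradedByOp_directSum {d : ∀ i, P i →ₗ[ℂ] P i} (hV : ∀ i, IsGradedByOp (d i) (V i)) :
    IsGradedByOp (DFinsupp.mapRange.linearMap d : (⨁ i, P i) →ₗ[ℂ] ⨁ i, P i) (sumGrade V) where
  apply_eq := by
    intro k v hv
    ext i
    exact (hV i).apply_eq k (v i) (mem_sumGrade.1 hv i)
  iSup_eq_top := by
    classical
    rw [eq_top_iff]
    rintro v -
    induction v using DirectSum.induction_on with
    | zero => exact zero_mem _
    | add u v hu hv => exact add_mem hu hv
    | of i v =>
      induction v using (hV i).induction with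
      | h0 => rw [map_zero]; exact zero_mem _
      | hadd u v hu hv => rw [map_add]; exact add_mem hu hv
      | hmem k v hv => exact Submodule.mem_iSup_of_mem k (lof_mem_sumGrade hv)

omit [LieRingModule Sl2t M] [LieModule ℂ Sl2t M] in
theorem IsGradedByOp.shift {d : M →ₗ[ℂ] M} {V : ℤ → Submodule ℂ M} (hV : IsGradedByOp d V)
    (r : ℤ) : IsGradedByOp (d + (r : ℂ) • LinearMap.id) (shift r V) where
  apply_eq := by
    intro k v hv
    rw [LinearMap.add_apply, hV.apply_eq _ v hv, LinearMap.smul_apply, LinearMap.id_apply,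
      ← add_smul]
    push_cast
    rw [sub_add_cancel]
  iSup_eq_top := by
    rw [← hV.iSup_eq_top]
    exact (Equiv.subRight r).iSup_comp (g := V)

end DirectSum

end GradedLie

/-! ### The graded pieces of the global Weyl modules -/

theorem mul_mem_grade {k : ℤ} (a : Sl2) (r : ℕ) {u : USl2t} (hu : u ∈ USl2t.grade k) :
    toU (cur a r) * u ∈ USl2t.grade ((r : ℤ) + k) := by
  have hle : USl2t.grade k ≤
      (USl2t.grade ((r : ℤ) + k)).comap (LinearMap.mulLeft ℂ (toU (cur a r))) := by
    rw [USl2t.grade, Submodule.span_le]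
    rintro _ ⟨l, hl, rfl⟩
    exact Submodule.subset_span ⟨(a, r) :: l, by simp [← hl], by
      simp only [List.map_cons, List.prod_cons, LinearMap.mulLeft_apply]⟩
  exact hle hu

theorem iSup_grade : ⨆ k, USl2t.grade k = ⊤ := by
  apply usl2t_eq_top
  · exact Submodule.mem_iSup_of_mem 0 (Submodule.subset_span ⟨[], by simp, by simp⟩)
  · intro a u hu
    induction a using TensorProduct.induction_on with
    | zero => rw [map_zero, zero_mul]; exact zero_mem _
    | add a b ha hb => rw [map_add, add_mul]; exact add_mem ha hb
    | tmul p a =>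
      have hle : Submodule.span ℂ (Set.range (cur a)) ≤ (⨆ k, USl2t.grade k).comap
          ((LinearMap.mulRight ℂ u) ∘ₗ (toU : Sl2t →ₗ[ℂ] USl2t)) := by
        rw [Submodule.span_le]
        rintro _ ⟨r, rfl⟩
        change toU (cur a r) * u ∈ ⨆ k, USl2t.grade k
        induction hu using Submodule.iSup_induction' with
        | mem k u hu => exact Submodule.mem_iSup_of_mem _ (mul_mem_grade a r hu)
        | zero => rw [mul_zero]; exact zero_mem _
        | add u v _ _ hu hv => rw [mul_add]; exact add_mem hu hv
      exact hle (tmul_mem_span p a)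

namespace GlobalWeyl

variable {m : ℤ}

theorem iSup_grade : ⨆ k, grade m k = ⊤ := by
  simp only [grade]
  rw [← Submodule.map_iSup, CurrentSl2.iSup_grade, Submodule.map_top]
  exact LinearMap.range_eq_top.2 mk_surjective

theorem lie_mem_grade (a : Sl2) (r : ℕ) (s : ℤ) (v : GlobalWeyl m) (hv : v ∈ grade m s) :
    ⁅cur a r, v⁆ ∈ grade m ((r : ℤ) + s) := by
  obtain ⟨u, hu, rfl⟩ := hv
  refine ⟨toU (cur a r) * u, mul_mem_grade a r hu, ?_⟩
  exact (lie_mk _ _).symm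

theorem gen_mem_grade : gen m ∈ grade m 0 :=
  ⟨1, Submodule.subset_span ⟨[], by simp, by simp⟩, rfl⟩

theorem tdeg_toSym {n : ℕ} {k : ℤ} {v : GlobalWeyl n} (hv : v ∈ grade n k) :
    tdeg (toSym n v) = (k : ℂ) • toSym n v := by
  obtain ⟨u, hu, rfl⟩ := hv
  have hle : USl2t.grade k ≤ LinearMap.eqLocus
      (tdeg.toLinearMap ∘ₗ (toSym n : GlobalWeyl n →ₗ[ℂ] SymV) ∘ₗ (mk n).restrictScalars ℂ)
      ((k : ℂ) • ((toSym n : GlobalWeyl n →ₗ[ℂ] SymV) ∘ₗ (mk n).restrictScalars ℂ)) := by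
    clear hu
    rw [USl2t.grade, Submodule.span_le]
    rintro _ ⟨l, rfl, rfl⟩
    change tdeg (toSym n (mk n _)) = ((_ : ℤ) : ℂ) • toSym n (mk n _)
    induction l with
    | nil =>
      have h1 := toSym_gen n
      rw [gen] at h1
      simp only [List.map_nil, List.prod_nil, List.sum_nil, h1]
      rw [Derivation.leibniz_pow, euler_X]
      simp
    | cons p l ih =>
      rw [List.map_cons, List.prod_cons, toSym_mk_mul, tdeg_der, ih, Derivation.map_smul,
        ← add_smul]
      congr 1
      simp only [List.map_cons, List.sum_cons]
      push_cast
      rw [add_comm]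
  exact hle hu

theorem exists_isGradedByOp (m : ℤ) :
    ∃ d : GlobalWeyl m →ₗ[ℂ] GlobalWeyl m, IsGradedByOp d (grade m) := by
  rcases lt_or_ge m 0 with hm | hm
  · have := subsingleton_of_neg hm
    exact ⟨0, fun k v _ => Subsingleton.elim _ _, iSup_grade⟩
  · obtain ⟨n, rfl⟩ := Int.eq_ofNat_of_zero_le hm
    exact IsGradedByOp.exists_of_injective iSup_grade
      (f := (toSym n : GlobalWeyl n →ₗ[ℂ] SymV)) toSym_injective tdeg.toLinearMap
      fun k v hv => tdeg_toSym hv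

/-- The degree operator of `W(m)`. -/
def degOp (m : ℤ) : GlobalWeyl m →ₗ[ℂ] GlobalWeyl m := (exists_isGradedByOp m).choose

theorem isGradedByOp (m : ℤ) : IsGradedByOp (degOp m) (grade m) :=
  (exists_isGradedByOp m).choose_spec

theorem grade_fg {n : ℕ} (k : ℤ) : (grade (n : ℤ) k).FG := by
  let A : Set (Fin 2 × ℕ →₀ ℕ) := {s | (s.sum fun _ j => j) = n ∧
    (s.sum fun v j => (j : ℂ) * (v.2 : ℂ)) = k}
  have hA : A.Finite := by
    let g : Fin 2 × ℕ →₀ ℕ := Finsupp.indicator (Finset.univ ×ˢ Finset.range (k.toNat + 1))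
      fun _ _ => n
    refine (Set.finite_Iic g).subset fun s hs => ?_
    intro v
    have h1 : s v ≤ n := by
      rw [← hs.1]
      by_cases hz : s v = 0
      · omega
      · exact Finset.single_le_sum (f := fun v => s v) (fun _ _ => Nat.zero_le _)
          (Finsupp.mem_support_iff.2 hz)
    have h2 : ((s.sum fun v j => j * v.2 : ℕ) : ℤ) = k := by
      have := hs.2
      rw [Finsupp.sum] at this ⊢
      exact_mod_cast this
    by_cases hz : s v = 0
    · omega
    · have h3 : s v * v.2 ≤ s.sum fun v j => j * v.2 :=
        Finset.single_le_sum (f := fun v => s v * v.2) (fun _ _ => Nat.zero_le _)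
          (Finsupp.mem_support_iff.2 hz)
      have h4 : v.2 ≤ s v * v.2 := Nat.le_mul_of_pos_left _ (Nat.pos_of_ne_zero hz)
      have hv : v ∈ (Finset.univ ×ˢ Finset.range (k.toNat + 1) : Finset (Fin 2 × ℕ)) := by
        simp only [Finset.mem_product, Finset.mem_univ, true_and, Finset.mem_range]
        omega
      rw [Finsupp.indicator_of_mem hv]
      exact h1
  have hle : (grade (n : ℤ) k).map (toSym n : GlobalWeyl n →ₗ[ℂ] SymV) ≤
      Submodule.span ℂ ((fun s => (monomial s (1 : ℂ) : SymV)) '' A) := by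
    rintro _ ⟨v, hv, rfl⟩
    rw [LieModuleHom.coe_toLinearMap, (toSym n v).as_sum]
    refine Submodule.sum_mem _ fun s hs => ?_
    rw [← mul_one (coeff s _), ← smul_eq_mul, ← smul_monomial]
    refine Submodule.smul_mem _ _ (Submodule.subset_span ⟨s, ⟨?_, ?_⟩, rfl⟩)
    · exact sum_eq_of_coeff_ne_zero (deg_toSym v) (mem_support_iff.1 hs)
    · exact weight_eq_of_euler (tdeg_toSym hv) (mem_support_iff.1 hs)
  have hfd : FiniteDimensional ℂ (Submodule.span ℂ ((fun s => (monomial s (1 : ℂ) : SymV)) '' A)) :=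
    FiniteDimensional.span_of_finite ℂ (hA.image _)
  have hfd' := Submodule.finiteDimensional_of_le hle
  exact Submodule.fg_of_fg_map_injective (toSym n : GlobalWeyl n →ₗ[ℂ] SymV) toSym_injective
    (Module.Finite.iff_fg.1 hfd')

theorem isNonnegFinite (m : ℤ) : IsNonnegFinite (grade m) where
  eq_bot := by
    intro k hk
    have : USl2t.grade k = ⊥ := by
      rw [USl2t.grade, Submodule.span_eq_bot]
      rintro _ ⟨l, hl, rfl⟩
      omega
    rw [grade, this, Submodule.map_bot]
  fg := by
    intro k
    rcases lt_or_ge m 0 with hm | hm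
    · have := subsingleton_of_neg hm
      rw [Subsingleton.elim (grade m k) ⊥]
      exact Submodule.fg_bot
    · obtain ⟨n, rfl⟩ := Int.eq_ofNat_of_zero_le hm
      exact grade_fg k

theorem der_h_eq : der (cur h 0) = euler fun v => if v.1 = 0 then 1 else -1 := by
  apply derivation_ext
  rintro ⟨j, i⟩
  rw [euler_X, cur]
  fin_cases j
  · simp [der_h_X_zero, lin_X_pow]
  · simp [der_h_X_one, lin_X_pow]

theorem exists_hasWeightsIn (m : ℤ) : ∃ s, HasWeightsIn s (GlobalWeyl m) := by
  rcases lt_or_ge m 0 with hm | hm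
  · have := subsingleton_of_neg hm
    exact ⟨∅, Subsingleton.elim _ _⟩
  · obtain ⟨n, rfl⟩ := Int.eq_ofNat_of_zero_le hm
    refine ⟨Finset.Icc (-(n : ℤ)) n, ?_⟩
    rw [HasWeightsIn, eq_top_iff]
    rintro v -
    have hex : ∀ s ∈ (toSym n v).support, ∃ u, toSym n u = monomial s (coeff s (toSym n v)) := by
      intro s hs
      apply exists_toSym_eq
      rw [euler_monomial, weight_eq_of_euler (deg_toSym v) (mem_support_iff.1 hs)]
    choose! f hf using hex
    have hv : v = ∑ s ∈ (toSym n v).support, f s := by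
      apply toSym_injective
      rw [map_sum]
      conv_lhs => rw [(toSym n v).as_sum]
      exact Finset.sum_congr rfl fun s hs => (hf s hs).symm
    rw [hv]
    refine Submodule.sum_mem _ fun s hs => Submodule.subset_span
      ⟨s.sum fun v k => (k : ℤ) * (if v.1 = 0 then 1 else -1), ?_, ?_⟩
    · have hsum := sum_eq_of_coeff_ne_zero (deg_toSym v) (mem_support_iff.1 hs)
      rw [Finset.mem_Icc, ← abs_le, ← hsum, Finsupp.sum, Finsupp.sum]
      refine (Finset.abs_sum_le_sum_abs _ _).trans ?_
      push_cast
      refine Finset.sum_le_sum fun v _ => ?_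
      split_ifs <;> simp
    · apply toSym_injective
      rw [LieModuleHom.map_lie, map_smul, hf s hs, lie_symV_def, der_h_eq, euler_monomial]
      congr 1
      rw [Finsupp.sum, Finsupp.sum]
      push_cast
      rfl

end GlobalWeyl

/-! ### The objects of the exact sequence -/

theorem isBddObject_of {M : Type} [AddCommGroup M] [Module ℂ M] [LieRingModule Sl2t M]
    [LieModule ℂ Sl2t M] {V : ℤ → Submodule ℂ M} {d : M →ₗ[ℂ] M} {s : Finset ℤ}
    (hd : IsGradedByOp d V) (hV : IsNonnegFinite V) (hs : HasWeightsIn s M)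
    (hlie : ∀ (a : Sl2) (r : ℕ) (s : ℤ) (v : M), v ∈ V s → ⁅cur a r, v⁆ ∈ V ((r : ℤ) + s)) :
    IsBddObject V where
  isInternal := hd.isInternal
  lie_mem := hlie
  bounded := ⟨0, hV.eq_bot⟩
  finite := fun p => Module.Finite.iff_fg.2 (hV.fg p)
  weights := hs.finite

theorem isBddObject_tensor (m m' : ℤ) :
    IsBddObject (tensorGrade (GlobalWeyl.grade m) (GlobalWeyl.grade m')) := by
  obtain ⟨s, hs⟩ := GlobalWeyl.exists_hasWeightsIn m
  obtain ⟨s', hs'⟩ := GlobalWeyl.exists_hasWeightsIn m'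
  exact isBddObject_of
    (isGradedByOp_tensor (GlobalWeyl.isGradedByOp m) (GlobalWeyl.isGradedByOp m'))
    ((GlobalWeyl.isNonnegFinite m).tensor (GlobalWeyl.isNonnegFinite m')) (hs.tensor hs')
    fun a r => tensorGrade_lie_mem a r (GlobalWeyl.lie_mem_grade a r) (GlobalWeyl.lie_mem_grade a r)

theorem exists_isGradedByOp_weylSum {ι : Type} (m : ℤ) (d : ι → ℤ) :
    ∃ D : (⨁ _ : ι, GlobalWeyl m) →ₗ[ℂ] ⨁ _ : ι, GlobalWeyl m,
      IsGradedByOp D (weylSumGrade m d) :=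
  ⟨_, isGradedByOp_directSum fun i => (GlobalWeyl.isGradedByOp m).shift (d i)⟩

theorem isBddObject_weylSum {ι : Type} (m : ℤ) (d : ι → ℤ) (hd0 : ∀ i, 0 ≤ d i)
    (hd : ∀ k, {i | d i ≤ k}.Finite) : IsBddObject (weylSumGrade m d) := by
  classical
  obtain ⟨s, hs⟩ := GlobalWeyl.exists_hasWeightsIn m
  obtain ⟨D, hD⟩ := exists_isGradedByOp_weylSum m d
  have hW := GlobalWeyl.isNonnegFinite m
  refine isBddObject_of hD ⟨?_, ?_⟩ (HasWeightsIn.directSum fun _ => hs) ?_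
  · intro k hk
    rw [eq_bot_iff]
    intro v hv
    rw [weylSumGrade, mem_sumGrade] at hv
    rw [Submodule.mem_bot]
    ext i
    have h1 := hv i
    have h0 := hd0 i
    rw [shift, hW.eq_bot _ (by omega)] at h1
    exact h1
  · intro k
    have hle : weylSumGrade m d k ≤ ⨆ i ∈ (hd k).toFinset,
        (GlobalWeyl.grade m (k - d i)).map (DirectSum.lof ℂ ι (fun _ => GlobalWeyl m) i) := by
      intro v hv
      rw [weylSumGrade, mem_sumGrade] at hv
      rw [← DirectSum.sum_support_of v]
      refine Submodule.sum_mem _ fun i hi => ?_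
      refine Submodule.mem_iSup_of_mem i (Submodule.mem_iSup_of_mem ?_ ⟨v i, hv i, rfl⟩)
      rw [Set.Finite.mem_toFinset]
      by_contra hlt
      have h1 := hv i
      rw [shift, hW.eq_bot _ (by simp at hlt; omega)] at h1
      exact (DFinsupp.mem_support_iff.1 hi) h1
    have hfg : (⨆ i ∈ (hd k).toFinset, (GlobalWeyl.grade m (k - d i)).map
        (DirectSum.lof ℂ ι (fun _ => GlobalWeyl m) i)).FG :=
      Submodule.fg_biSup _ _ fun i _ => (hW.fg _).map _
    have := Module.Finite.iff_fg.2 hfg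
    exact Module.Finite.iff_fg.1 (Submodule.finiteDimensional_of_le hle)
  · intro a r s v hv
    rw [weylSumGrade, mem_sumGrade] at hv ⊢
    intro i
    rw [DirectSum.lie_module_bracket_apply, shift, add_sub_assoc]
    exact GlobalWeyl.lie_mem_grade a r _ _ (hv i)

/-! ### Polarization and contraction on the symmetric algebra -/

/-- The polarization `S → S ⊗ S` twisted by `t ^ r`: the derivation that maps a linear form `v` to
`1 ⊗ t ^ r v`. -/
def pol (r : ℕ) : Derivation ℂ SymV (SymV ⊗[ℂ] SymV) :=
  mkDerivation ℂ fun v => 1 ⊗ₜ X (v.1, v.2 + r)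

theorem pol_X (r : ℕ) (v : Fin 2 × ℕ) : pol r (X v) = 1 ⊗ₜ X (v.1, v.2 + r) :=
  mkDerivation_X _ _ _

theorem pol_lin (r : ℕ) (j : Fin 2) (p : Polynomial ℂ) :
    pol r (lin j p) = 1 ⊗ₜ lin j (p * Polynomial.X ^ r) := by
  induction p using Polynomial.induction_on' with
  | add p q hp hq => simp only [map_add, hp, hq, add_mul, TensorProduct.tmul_add]
  | monomial s c =>
    rw [← Polynomial.C_mul_X_pow_eq_monomial, ← Polynomial.smul_eq_C_mul]
    rw [map_smul, Derivation.map_smul, smul_mul_assoc, map_smul, lin_X_pow, pol_X, ← pow_add,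
      lin_X_pow, TensorProduct.tmul_smul]

theorem lie_smul_tensor (a : Sl2t) (p : SymV) (z : SymV ⊗[ℂ] SymV) :
    ⁅a, p • z⁆ = der a p • z + p • ⁅a, z⁆ := by
  induction z using TensorProduct.induction_on with
  | zero => simp
  | add z w hz hw => rw [smul_add, lie_add, hz, hw, smul_add, lie_add, smul_add]; abel
  | tmul q w =>
    have e : p • (q ⊗ₜ[ℂ] w) = (p * q) ⊗ₜ[ℂ] w := rfl
    rw [e, TensorProduct.LieModule.lie_tmul_right, TensorProduct.LieModule.lie_tmul_right, smul_add]
    change der a (p * q) ⊗ₜ[ℂ] w + (p * q) ⊗ₜ[ℂ] der a w =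
      (der a p * q) ⊗ₜ[ℂ] w + ((p * der a q) ⊗ₜ[ℂ] w + (p * q) ⊗ₜ[ℂ] der a w)
    rw [Derivation.leibniz, smul_eq_mul, smul_eq_mul, mul_comm q, TensorProduct.add_tmul]
    abel

theorem pol_der (r : ℕ) (a : Sl2t) (p : SymV) : pol r (der a p) = ⁅a, pol r p⁆ := by
  induction p using MvPolynomial.induction_on with
  | C c => simp
  | add p q hp hq => rw [map_add, map_add, map_add, lie_add, hp, hq]
  | mul_X p v hp =>
    have hX : pol r (der a (X v)) = ⁅a, pol r (X v)⁆ := by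
      rw [der_X, map_sum, pol_X, TensorProduct.LieModule.lie_tmul_right, lie_symV_def, lie_symV_def,
        der_X, Derivation.map_one_eq_zero, TensorProduct.zero_tmul, zero_add,
        TensorProduct.tmul_sum]
      refine Finset.sum_congr rfl fun k _ => ?_
      rw [pol_lin, mul_assoc, pow_add]
    rw [Derivation.leibniz, Derivation.leibniz, map_add, smul_eq_mul, smul_eq_mul,
      Derivation.leibniz, Derivation.leibniz, lie_add, lie_smul_tensor, lie_smul_tensor, hp, hX]
    abel

/-- The twisted polarization as a homomorphism of representations. -/
def polHom (r : ℕ) : SymV →ₗ⁅ℂ,Sl2t⁆ SymV ⊗[ℂ] SymV where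
  toLinearMap := (pol r).toLinearMap
  map_lie' := fun {a p} => pol_der r a p

/-- The derivative along the evaluation functional `e_ε ⊗ t ^ i ↦ c ^ i`, `e_j ⊗ t ^ i ↦ 0` for
`j ≠ ε`, on `ℂ² ⊗ ℂ[t]`. -/
def evDer (c : ℂ) (ε : Fin 2) : Derivation ℂ SymV SymV :=
  mkDerivation ℂ fun v => if v.1 = ε then C (c ^ v.2) else 0

theorem evDer_X (c : ℂ) (ε : Fin 2) (v : Fin 2 × ℕ) :
    evDer c ε (X v) = if v.1 = ε then C (c ^ v.2) else 0 := mkDerivation_X _ _ _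

theorem evDer_lin (c : ℂ) (ε j : Fin 2) (p : Polynomial ℂ) :
    evDer c ε (lin j p) = if j = ε then C (p.eval c) else 0 := by
  induction p using Polynomial.induction_on' with
  | add p q hp hq => rw [map_add, map_add, hp, hq, Polynomial.eval_add]; split_ifs <;> simp
  | monomial s a =>
    rw [← Polynomial.C_mul_X_pow_eq_monomial, ← Polynomial.smul_eq_C_mul, map_smul,
      Derivation.map_smul, lin_X_pow, evDer_X, Polynomial.eval_smul, Polynomial.eval_pow,
      Polynomial.eval_X]
    split_ifs
    · rw [smul_eq_mul, C_mul, smul_eq_C_mul]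
    · rw [smul_zero]

theorem evDer_comm (c c' : ℂ) (ε ε' : Fin 2) (p : SymV) :
    evDer c ε (evDer c' ε' p) = evDer c' ε' (evDer c ε p) := by
  have : ⁅evDer c ε, evDer c' ε'⁆ = 0 := by
    apply derivation_ext
    intro v
    rw [Derivation.commutator_apply, evDer_X, evDer_X]
    split_ifs <;> simp
  have h1 := congrArg (fun D => D p) this
  rwa [Derivation.commutator_apply, Derivation.zero_apply, sub_eq_zero] at h1

theorem deg_evDer (c : ℂ) (ε : Fin 2) (p : SymV) :
    deg (evDer c ε p) = evDer c ε (deg p) - evDer c ε p := by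
  have : ⁅deg, evDer c ε⁆ = - evDer c ε := by
    apply derivation_ext
    intro v
    rw [Derivation.commutator_apply, Derivation.neg_apply, euler_X, one_smul, evDer_X]
    split_ifs <;> simp
  have h1 := congrArg (fun D => D p) this
  rw [Derivation.commutator_apply, Derivation.neg_apply] at h1
  linear_combination h1

theorem evDer_der (c : ℂ) (ε : Fin 2) (a : Sl2t) (p : SymV) :
    evDer c ε (der a p) = der a (evDer c ε p) +
      ∑ j, C ((toMatrix a ε j).eval c) * evDer c j p := by
  have : ⁅evDer c ε, der a⁆ = ∑ j, (C ((toMatrix a ε j).eval c) : SymV) • evDer c j := by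
    apply derivation_ext
    intro v
    rw [Derivation.commutator_apply, der_X, map_sum, evDer_X]
    have h0 : der a (if v.1 = ε then C (c ^ v.2) else 0) = 0 := by split_ifs <;> simp
    rw [h0, sub_zero]
    simp only [evDer_lin, Fin.sum_univ_two, Derivation.add_apply, Derivation.smul_apply, evDer_X]
    obtain ⟨j, i⟩ := v
    fin_cases ε <;> fin_cases j <;> simp
  have h1 := congrArg (fun D => D p) this
  simp only [Derivation.commutator_apply, Fin.sum_univ_two, Derivation.add_apply,
    Derivation.smul_apply, smul_eq_mul] at h1
  rw [Fin.sum_univ_two]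
  linear_combination h1

theorem toMatrix_trace (a : Sl2t) : toMatrix a 0 0 + toMatrix a 1 1 = 0 := by
  induction a using sl2t_induction with
  | hx p => simp [toMatrix_tmul, x, LieAlgebra.SpecialLinear.val_single, Matrix.single]
  | hy p => simp [toMatrix_tmul, y, LieAlgebra.SpecialLinear.val_single, Matrix.single]
  | hh p => simp [toMatrix_tmul, h, LieAlgebra.SpecialLinear.val_singleSubSingle, Matrix.single]
  | hadd a b ha hb =>
    rw [map_add, Matrix.add_apply, Matrix.add_apply]
    linear_combination ha + hb

/-- The contraction of two tensor factors by the determinant, evaluated at `t = c`. -/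
def contraction (c : ℂ) : SymV ⊗[ℂ] SymV →ₗ[ℂ] SymV :=
  LinearMap.mul' ℂ SymV ∘ₗ
    (TensorProduct.map (evDer c 0).toLinearMap (evDer c 1).toLinearMap -
      TensorProduct.map (evDer c 1).toLinearMap (evDer c 0).toLinearMap)

theorem contraction_tmul (c : ℂ) (p q : SymV) :
    contraction c (p ⊗ₜ q) = evDer c 0 p * evDer c 1 q - evDer c 1 p * evDer c 0 q := by
  simp [contraction]

theorem contraction_lie (c : ℂ) (a : Sl2t) (z : SymV ⊗[ℂ] SymV) :
    contraction c ⁅a, z⁆ = ⁅a, contraction c z⁆ := by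
  induction z using TensorProduct.induction_on with
  | zero => simp
  | add z w hz hw => rw [lie_add, map_add, hz, hw, map_add, lie_add]
  | tmul p q =>
    have ht : (C ((toMatrix a 0 0).eval c) + C ((toMatrix a 1 1).eval c) : SymV) = 0 := by
      rw [← C_add, ← Polynomial.eval_add, toMatrix_trace, Polynomial.eval_zero, C_0]
    rw [TensorProduct.LieModule.lie_tmul_right, map_add]
    simp only [contraction_tmul, lie_symV_def, evDer_der, map_sub, Derivation.leibniz, smul_eq_mul,
      Fin.sum_univ_two]
    linear_combination (evDer c 0 p * evDer c 1 q - evDer c 1 p * evDer c 0 q) * ht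

/-- The contraction as a homomorphism of representations. -/
def contractionHom (c : ℂ) : SymV ⊗[ℂ] SymV →ₗ⁅ℂ,Sl2t⁆ SymV where
  toLinearMap := contraction c
  map_lie' := fun {a z} => contraction_lie c a z

/-! ### Independence of the twisted polarizations -/

/-- Differentiation in the second tensor factor followed by multiplication. -/
def evSnd (c : ℂ) (ε : Fin 2) : SymV ⊗[ℂ] SymV →ₗ[ℂ] SymV :=
  LinearMap.mul' ℂ SymV ∘ₗ (evDer c ε).toLinearMap.lTensor SymV

theorem evSnd_tmul (c : ℂ) (ε : Fin 2) (p q : SymV) : evSnd c ε (p ⊗ₜ q) = p * evDer c ε q := by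
  simp [evSnd]

theorem evSnd_smul (c : ℂ) (ε : Fin 2) (p : SymV) (z : SymV ⊗[ℂ] SymV) :
    evSnd c ε (p • z) = p * evSnd c ε z := by
  induction z using TensorProduct.induction_on with
  | zero => simp
  | add z w hz hw => rw [smul_add, map_add, hz, hw, map_add, mul_add]
  | tmul q w => rw [TensorProduct.smul_tmul', evSnd_tmul, evSnd_tmul, smul_eq_mul, mul_assoc]

theorem evSnd_pol (c : ℂ) (ε : Fin 2) (r : ℕ) (p : SymV) :
    evSnd c ε (pol r p) = c ^ r • evDer c ε p := by
  induction p using MvPolynomial.induction_on with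
  | C a => simp
  | add p q hp hq => rw [map_add, map_add, map_add, hp, hq, smul_add]
  | mul_X p v hp =>
    rw [Derivation.leibniz, Derivation.leibniz, map_add, evSnd_smul, evSnd_smul, hp, pol_X,
      evSnd_tmul, evDer_X, evDer_X, one_mul, smul_add]
    congr 1
    · split_ifs
      · rw [pow_add, C_mul, smul_eq_C_mul, smul_eq_mul]; ring
      · simp
    · rw [smul_eq_mul, mul_smul_comm]

/-- A homogeneous polynomial of positive degree vanishes as soon as its derivatives along the
evaluation functionals at all but finitely many points do: these functionals span a dense
subspace. -/
theorem eq_zero_of_evDer_eq_zero {p : SymV} {s : Set ℂ} (hs : s.Finite)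
    (hp : ∀ c ∉ s, ∀ ε, evDer c ε p = 0) {k : ℂ} (hk : k ≠ 0) (hdeg : deg p = k • p) : p = 0 := by
  -- the family `evDer c ε`, with `c` replaced by an indeterminate
  let P (ε : Fin 2) : Derivation ℂ SymV (Polynomial SymV) :=
    mkDerivation ℂ fun v => if v.1 = ε then Polynomial.X ^ v.2 else 0
  have hPX (ε : Fin 2) (v : Fin 2 × ℕ) : P ε (X v) = if v.1 = ε then Polynomial.X ^ v.2 else 0 :=
    mkDerivation_X _ _ _
  have hev (c : ℂ) (ε : Fin 2) : (P ε p).eval (C c) = evDer c ε p := by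
    have : (Polynomial.leval (C c : SymV)).compDer (P ε) = evDer c ε := by
      apply derivation_ext
      intro v
      change Polynomial.eval (C c) (P ε (X v)) = _
      rw [hPX, evDer_X]
      split_ifs <;> simp
    exact congrArg (fun D => D p) this
  have hP0 (ε : Fin 2) : P ε p = 0 := by
    apply Polynomial.eq_zero_of_infinite_isRoot
    refine Set.Infinite.mono ?_ (hs.infinite_compl.image (C_injective (Fin 2 × ℕ) ℂ).injOn)
    rintro _ ⟨c, hc, rfl⟩
    exact (hev c ε).trans (hp c hc ε)
  let L (ε : Fin 2) : Polynomial SymV →ₗ[SymV] SymV :=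
    (Polynomial.basisMonomials SymV).constr SymV fun i => X (ε, i)
  have hL (ε : Fin 2) (i : ℕ) : L ε (Polynomial.X ^ i) = X (ε, i) := by
    have := (Polynomial.basisMonomials SymV).constr_basis SymV (fun i => (X (ε, i) : SymV)) i
    rw [Polynomial.coe_basisMonomials] at this
    rw [← Polynomial.monomial_one_right_eq_X_pow]
    exact this
  have hsum : deg = (L 0).compDer (P 0) + (L 1).compDer (P 1) := by
    apply derivation_ext
    rintro ⟨j, i⟩
    rw [Derivation.add_apply, euler_X, one_smul]
    change _ = L 0 (P 0 (X (j, i))) + L 1 (P 1 (X (j, i)))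
    rw [hPX, hPX]
    fin_cases j <;> simp [hL]
  rw [hsum] at hdeg
  change L 0 (P 0 p) + L 1 (P 1 p) = k • p at hdeg
  rw [hP0, hP0, map_zero, map_zero, add_zero] at hdeg
  exact (smul_eq_zero.1 hdeg.symm).resolve_left hk

/-- Iterated derivatives along evaluation functionals. -/
def iterEvDer : List (ℂ × Fin 2) → SymV →ₗ[ℂ] SymV
  | [] => LinearMap.id
  | b :: l => (evDer b.1 b.2).toLinearMap ∘ₗ iterEvDer l

theorem iterEvDer_cons (b : ℂ × Fin 2) (l : List (ℂ × Fin 2)) (p : SymV) :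
    iterEvDer (b :: l) p = evDer b.1 b.2 (iterEvDer l p) := rfl

theorem iterEvDer_perm {l l' : List (ℂ × Fin 2)} (hl : l.Perm l') (p : SymV) :
    iterEvDer l p = iterEvDer l' p := by
  induction hl with
  | nil => rfl
  | cons b _ ih => rw [iterEvDer_cons, iterEvDer_cons, ih]
  | swap b b' l =>
    rw [iterEvDer_cons, iterEvDer_cons, iterEvDer_cons, iterEvDer_cons, evDer_comm]
  | trans _ _ h1 h2 => rw [h1, h2]

theorem iterEvDer_evDer (b : ℂ × Fin 2) (l : List (ℂ × Fin 2)) (p : SymV) :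
    iterEvDer l (evDer b.1 b.2 p) = evDer b.1 b.2 (iterEvDer l p) := by
  induction l with
  | nil => rfl
  | cons b' l ih => rw [iterEvDer_cons, iterEvDer_cons, ih, evDer_comm]

theorem deg_iterEvDer (l : List (ℂ × Fin 2)) {p : SymV} {k : ℂ} (hp : deg p = k • p) :
    deg (iterEvDer l p) = (k - l.length) • iterEvDer l p := by
  induction l with
  | nil => simpa [iterEvDer] using hp
  | cons b l ih =>
    rw [iterEvDer_cons, deg_evDer, ih, Derivation.map_smul, List.length_cons]
    push_cast
    module

/-- The twisted polarizations `pol 0, …, pol (N - 1)` are jointly injective in degree `N`. An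
`N`-fold derivative along evaluations at distinct points `c_i` turns the hypothesis into a
Vandermonde system, so all these derivatives vanish, and the derivatives of lower order vanish by
descending induction. -/
theorem eq_zero_of_sum_evDer_eq_zero {N : ℕ} {F : Fin N → SymV}
    (hF : ∀ r, deg (F r) = (N : ℂ) • F r)
    (hsum : ∀ (c : ℂ) (ε : Fin 2), ∑ r : Fin N, c ^ (r : ℕ) • evDer c ε (F r) = 0) : F = 0 := by
  have htop : ∀ l : List (ℂ × Fin 2), (l.map Prod.fst).Nodup → l.length = N →
      ∀ r, iterEvDer l (F r) = 0 := by
    intro l hl hlen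
    have hb : ∀ b ∈ l, ∑ r : Fin N, b.1 ^ (r : ℕ) • iterEvDer l (F r) = 0 := by
      intro b hb
      obtain ⟨l₁, l₂, rfl⟩ := List.append_of_mem hb
      have := congrArg (iterEvDer (l₁ ++ l₂)) (hsum b.1 b.2)
      rw [map_zero, map_sum] at this
      rw [← this]
      refine Finset.sum_congr rfl fun r _ => ?_
      rw [map_smul, iterEvDer_evDer, ← iterEvDer_cons, iterEvDer_perm List.perm_middle]
    subst hlen
    intro r
    ext s
    have hinj : Function.Injective fun i : Fin l.length => (l.get i).1 := by
      have := List.nodup_iff_injective_get.1 hl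
      intro i j hij
      have h1 := @this (i.cast (by simp)) (j.cast (by simp)) (by simpa using hij)
      simpa [Fin.ext_iff] using h1
    have := Matrix.eq_zero_of_forall_index_sum_pow_mul_eq_zero
      (v := fun r => coeff s (iterEvDer l (F r))) hinj (fun i => by
        have := congrArg (coeff s) (hb (l.get i) (List.get_mem l i))
        rw [coeff_sum, coeff_zero] at this
        rw [← this]
        exact Finset.sum_congr rfl fun r _ => by rw [coeff_smul, smul_eq_mul])
    exact congrFun this r
  have hdesc : ∀ j ≤ N, ∀ l : List (ℂ × Fin 2), (l.map Prod.fst).Nodup → l.length = N - j →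
      ∀ r, iterEvDer l (F r) = 0 := by
    intro j
    induction j with
    | zero => intro _ l hl hlen; exact htop l hl hlen
    | succ j ih =>
      intro hj l hl hlen r
      refine eq_zero_of_evDer_eq_zero (s := {c | c ∈ l.map Prod.fst}) (List.finite_toSet _)
        (k := (N : ℂ) - l.length) ?_ ?_ (deg_iterEvDer l (hF r))
      · intro c hc ε
        exact ih (by omega) ((c, ε) :: l) (by simpa using ⟨by simpa using hc, hl⟩)
          (by simp; omega) r
      · rw [sub_ne_zero, Ne, Nat.cast_inj]; omega
  funext r
  exact hdesc N le_rfl [] (by simp) (by simp) r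

/-! ### Homomorphisms out of quotients and direct sums -/

section Hom

variable {A : Type} [AddCommGroup A] [Module ℂ A] [LieRingModule Sl2t A] [LieModule ℂ Sl2t A]
variable {B : Type} [AddCommGroup B] [Module ℂ B] [LieRingModule Sl2t B] [LieModule ℂ Sl2t B]

/-- A homomorphism vanishing on a subrepresentation descends to the quotient. -/
def quotLift (F : LieSubmodule ℂ Sl2t A) (φ : A →ₗ⁅ℂ,Sl2t⁆ B) (hφ : ∀ a ∈ F, φ a = 0) :
    A ⧸ F →ₗ⁅ℂ,Sl2t⁆ B where
  toLinearMap := F.toSubmodule.liftQ (φ : A →ₗ[ℂ] B) hφ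
  map_lie' := by
    rintro s ⟨a⟩
    exact φ.map_lie s a

/-- A bijective homomorphism is an isomorphism. -/
def equivOfBijective (φ : A →ₗ⁅ℂ,Sl2t⁆ B) (hφ : Function.Bijective φ) : A ≃ₗ⁅ℂ,Sl2t⁆ B where
  toLieModuleHom := φ
  invFun := (Equiv.ofBijective φ hφ).symm
  left_inv := (Equiv.ofBijective φ hφ).left_inv
  right_inv := (Equiv.ofBijective φ hφ).right_inv

variable {ι : Type} [DecidableEq ι]

/-- The homomorphism out of a direct sum with given components. -/
def sumLift (f : ι → A →ₗ⁅ℂ,Sl2t⁆ B) : (⨁ _ : ι, A) →ₗ⁅ℂ,Sl2t⁆ B where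
  toLinearMap := DirectSum.toModule ℂ ι B fun i => (f i : A →ₗ[ℂ] B)
  map_lie' := by
    intro s v
    change DirectSum.toModule ℂ ι B (fun i => (f i : A →ₗ[ℂ] B)) ⁅s, v⁆ =
      ⁅s, DirectSum.toModule ℂ ι B (fun i => (f i : A →ₗ[ℂ] B)) v⁆
    induction v using DirectSum.induction_on with
    | zero => simp
    | add u v hu hv => rw [lie_add, map_add, hu, hv, map_add, lie_add]
    | of i a =>
      have h1 := LieModuleHom.map_lie (DirectSum.lieModuleOf ℂ ι Sl2t (fun _ => A) i) s a
      change DirectSum.lof ℂ ι (fun _ => A) i ⁅s, a⁆ = ⁅s, DirectSum.lof ℂ ι (fun _ => A) i a⁆ at h1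
      rw [← DirectSum.lof_eq_of ℂ, ← h1, DirectSum.toModule_lof, DirectSum.toModule_lof]
      exact (f i).map_lie s a

omit [LieModule ℂ Sl2t A] [LieModule ℂ Sl2t B] in
theorem sumLift_of (f : ι → A →ₗ⁅ℂ,Sl2t⁆ B) (i : ι) (a : A) :
    sumLift f (DirectSum.of (fun _ => A) i a) = f i a :=
  DirectSum.toModule_lof (φ := fun i => (f i : A →ₗ[ℂ] B)) ℂ i a

omit [LieModule ℂ Sl2t A] [LieModule ℂ Sl2t B] in
theorem sumLift_apply [∀ a : A, Decidable (a ≠ 0)] (f : ι → A →ₗ⁅ℂ,Sl2t⁆ B) (v : ⨁ _ : ι, A) :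
    sumLift f v = ∑ i ∈ DFinsupp.support v, f i (v i) := by
  conv_lhs => rw [← DirectSum.sum_support_of v, map_sum]
  exact Finset.sum_congr rfl fun i _ => sumLift_of f i _

end Hom

/-! ### Graded subrepresentations and quotients -/

section Graded

variable {A : Type} [AddCommGroup A] [Module ℂ A] [LieRingModule Sl2t A] [LieModule ℂ Sl2t A]
variable {B : Type} [AddCommGroup B] [Module ℂ B] [LieRingModule Sl2t B] [LieModule ℂ Sl2t B]
variable {V : ℤ → Submodule ℂ A} {W : ℤ → Submodule ℂ B} {d : A →ₗ[ℂ] A} {d' : B →ₗ[ℂ] B}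

omit [LieModule ℂ Sl2t A] in
theorem IsGradedByOp.exists_subGrade (hV : IsGradedByOp d V) {F : LieSubmodule ℂ Sl2t A}
    (hF : IsGradedSub V F) : ∃ D, IsGradedByOp D (subGrade V F) := by
  have hle : (F : Submodule ℂ A) ≤ (F : Submodule ℂ A).comap d := by
    conv_lhs => rw [hF]
    refine iSup_le fun k v hv => ?_
    rw [Submodule.mem_comap, hV.apply_eq k v hv.2]
    exact Submodule.smul_mem _ _ hv.1
  refine ⟨d.restrict hle, fun k v hv => Subtype.ext (hV.apply_eq k v hv), ?_⟩
  apply Submodule.map_injective_of_injective (f := (F : Submodule ℂ A).subtype)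
    Subtype.val_injective
  have hsub : ∀ k, (subGrade V F k).map (F : Submodule ℂ A).subtype = (F : Submodule ℂ A) ⊓ V k :=
    fun k => Submodule.map_comap_subtype _ _
  have htop : (⊤ : Submodule ℂ F).map (F : Submodule ℂ A).subtype = F :=
    Submodule.map_subtype_top _
  refine (Submodule.map_iSup _ _).trans (Eq.trans ?_ htop.symm)
  conv_rhs => rw [hF]
  exact iSup_congr hsub

theorem IsGradedByOp.exists_quotGrade (hV : IsGradedByOp d V) {F : LieSubmodule ℂ Sl2t A}
    (hF : ∀ a ∈ F, d a ∈ F) : ∃ D, IsGradedByOp D (quotGrade V F) := by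
  refine ⟨F.toSubmodule.mapQ F.toSubmodule d hF, ?_, ?_⟩
  · rintro k _ ⟨v, hv, rfl⟩
    change LieSubmodule.Quotient.mk' F (d v) = (k : ℂ) • LieSubmodule.Quotient.mk' F v
    rw [hV.apply_eq k v hv, map_smul]
  · simp only [quotGrade]
    rw [← Submodule.map_iSup, hV.iSup_eq_top, Submodule.map_top]
    exact LinearMap.range_eq_top.2 (LieSubmodule.Quotient.surjective_mk' F)

theorem quotGrade_lie_mem {F : LieSubmodule ℂ Sl2t A} (a : Sl2) (r : ℕ)
    (hV : ∀ (s : ℤ) (v : A), v ∈ V s → ⁅cur a r, v⁆ ∈ V ((r : ℤ) + s))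
    (s : ℤ) (v : A ⧸ F) (hv : v ∈ quotGrade V F s) :
    ⁅cur a r, v⁆ ∈ quotGrade V F ((r : ℤ) + s) := by
  obtain ⟨w, hw, rfl⟩ := hv
  exact ⟨⁅cur a r, w⁆, hV s w hw, (LieSubmodule.Quotient.mk' F).map_lie _ _⟩

omit [LieModule ℂ Sl2t A] [LieModule ℂ Sl2t B] in
theorem isGradedSub_range (hW : ⨆ k, V k = ⊤) {f : A →ₗ⁅ℂ,Sl2t⁆ B} (hf : IsDegreeZero V W f) :
    IsGradedSub W f.range := by
  refine le_antisymm ?_ (iSup_le fun k => inf_le_left)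
  rintro _ ⟨a, rfl⟩
  induction hW ▸ Submodule.mem_top (x := a) using Submodule.iSup_induction' with
  | mem k v hv => exact Submodule.mem_iSup_of_mem k ⟨⟨v, rfl⟩, hf k v hv⟩
  | zero => rw [map_zero]; exact zero_mem _
  | add u v _ _ hu hv => rw [map_add]; exact add_mem hu hv

omit [LieModule ℂ Sl2t A] in
theorem isGradedSub_top (hV : ⨆ k, V k = ⊤) : IsGradedSub V (⊤ : LieSubmodule ℂ Sl2t A) := by
  simp only [IsGradedSub, LieSubmodule.top_toSubmodule, top_inf_eq, hV]

omit [LieModule ℂ Sl2t A] in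
theorem isGradedSub_bot : IsGradedSub V (⊥ : LieSubmodule ℂ Sl2t A) := by
  simp [IsGradedSub]

omit [LieModule ℂ Sl2t A] [LieModule ℂ Sl2t B] in
theorem gradedIso_of_bijective (hV : IsGradedByOp d V) (hW : IsGradedByOp d' W)
    {φ : A →ₗ⁅ℂ,Sl2t⁆ B} (hφ : Function.Bijective φ) (hdeg : IsDegreeZero V W φ) :
    GradedIso V W :=
  ⟨equivOfBijective φ hφ, hV.mem_iff_of_injective hW (f := (φ : A →ₗ[ℂ] B)) hdeg hφ.1⟩

omit [LieModule ℂ Sl2t B] in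
/-- The first isomorphism theorem for graded representations. -/
theorem gradedIso_quot (hV : IsGradedByOp d V) (hW : IsGradedByOp d' W) {φ : A →ₗ⁅ℂ,Sl2t⁆ B}
    (hφ : Function.Surjective φ) (hdeg : IsDegreeZero V W φ) {F : LieSubmodule ℂ Sl2t A}
    (hF : ∀ a, φ a = 0 ↔ a ∈ F) : GradedIso (quotGrade V F) W := by
  obtain ⟨D, hD⟩ := hV.exists_quotGrade (F := F) fun a ha => by
    rw [← hF] at ha ⊢
    have := hV.comm_of_degreeZero hW (f := (φ : A →ₗ[ℂ] B)) hdeg a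
    change φ (d a) = d' (φ a) at this
    rw [this, ha, map_zero]
  refine gradedIso_of_bijective hD hW (φ := quotLift F φ fun a ha => (hF a).2 ha) ⟨?_, ?_⟩ ?_
  · rw [← LieModuleHom.coe_toLinearMap, ← LinearMap.ker_eq_bot, LinearMap.ker_eq_bot']
    intro q hq
    obtain ⟨a, rfl⟩ := LieSubmodule.Quotient.surjective_mk' F q
    exact (LieSubmodule.Quotient.mk_eq_zero F).2 ((hF a).1 hq)
  · intro b
    obtain ⟨a, rfl⟩ := hφ b
    exact ⟨LieSubmodule.Quotient.mk' F a, rfl⟩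
  · rintro k _ ⟨v, hv, rfl⟩
    exact hdeg k v hv

variable {C : Type} [AddCommGroup C] [Module ℂ C] [LieRingModule Sl2t C] [LieModule ℂ Sl2t C]
variable {U : ℤ → Submodule ℂ C} {e : C →ₗ[ℂ] C}

omit [LieModule ℂ Sl2t A] [LieModule ℂ Sl2t B] [LieModule ℂ Sl2t C] in
theorem GradedIso.trans (h1 : GradedIso U V) (h2 : GradedIso V W) : GradedIso U W := by
  obtain ⟨e₁, he₁⟩ := h1
  obtain ⟨e₂, he₂⟩ := h2
  exact ⟨e₁.trans e₂, fun k v => (he₁ k v).trans (he₂ k _)⟩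

omit [LieModule ℂ Sl2t C] in
/-- An isomorphism of a cokernel with `B`, inverted, gives a short exact sequence ending in `B`. -/
theorem exists_isShortExact (hU : IsGradedByOp e U) (hV : IsGradedByOp d V)
    (hW : IsGradedByOp d' W) (bU : IsBddObject U) (bV : IsBddObject V) (bW : IsBddObject W)
    {f : C →ₗ⁅ℂ,Sl2t⁆ A} (hf : Function.Injective f) (hfdeg : IsDegreeZero U V f)
    {θ : B →ₗ⁅ℂ,Sl2t⁆ A ⧸ f.range} (hθ : Function.Bijective θ)
    (hθdeg : IsDegreeZero W (quotGrade V f.range) θ) :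
    ∃ g : A →ₗ⁅ℂ,Sl2t⁆ B, IsShortExact U V W f g := by
  obtain ⟨D, hD⟩ := hV.exists_quotGrade (F := f.range) (by
    rintro _ ⟨c, rfl⟩
    exact ⟨e c, hU.comm_of_degreeZero hV (f := (f : C →ₗ[ℂ] A)) hfdeg c⟩)
  have hinv : ∀ q, θ ((equivOfBijective θ hθ).symm q) = q :=
    (equivOfBijective θ hθ).apply_symm_apply
  refine ⟨((equivOfBijective θ hθ).symm : A ⧸ f.range →ₗ⁅ℂ,Sl2t⁆ B).comp
    (LieSubmodule.Quotient.mk' f.range), bU, bV, bW, hfdeg, ?_, hf, ?_, ?_⟩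
  · intro k v hv
    rw [hW.mem_iff_of_injective hD (f := (θ : B →ₗ[ℂ] A ⧸ f.range)) hθdeg hθ.1]
    change θ ((equivOfBijective θ hθ).symm _) ∈ _
    rw [hinv]
    exact ⟨v, hv, rfl⟩
  · intro a
    change (equivOfBijective θ hθ).symm (LieSubmodule.Quotient.mk' f.range a) = 0 ↔ _
    rw [← hθ.1.eq_iff, hinv, map_zero]
    exact (LieSubmodule.Quotient.mk_eq_zero _).trans (f.mem_range a)
  · exact (equivOfBijective θ hθ).symm.surjective.comp (LieSubmodule.Quotient.surjective_mk' _)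

omit [LieModule ℂ Sl2t C] in
/-- An extension of two direct sums of shifted global Weyl modules has a filtration by global Weyl
modules, with a single proper nonzero step. -/
theorem IsShortExact.hasGlobalWeylFiltration {f : C →ₗ⁅ℂ,Sl2t⁆ A} {g : A →ₗ⁅ℂ,Sl2t⁆ B}
    (hex : IsShortExact U V W f g) (hU : IsGradedByOp e U) (hV : IsGradedByOp d V)
    (hW : IsGradedByOp d' W)
    (h1 : ∃ (l : ℕ) (c : ℤ → ℕ),
      GradedIso U (weylSumGrade (l : ℤ) (fun i : (Σ p : ℤ, Fin (c p)) => i.1)))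
    (h0 : ∃ (l : ℕ) (c : ℤ → ℕ),
      GradedIso W (weylSumGrade (l : ℤ) (fun i : (Σ p : ℤ, Fin (c p)) => i.1))) :
    HasGlobalWeylFiltration V := by
  let F : ℕ → LieSubmodule ℂ Sl2t A
    | 0 => ⊤
    | 1 => f.range
    | _ + 2 => ⊥
  have htop := isGradedSub_top hV.iSup_eq_top
  have hrange := isGradedSub_range hU.iSup_eq_top hex.left_deg
  refine ⟨hex.mid_obj, 1, F, rfl, rfl, ?_, ?_, ?_⟩
  · refine antitone_nat_of_succ_le fun s => ?_
    match s with
    | 0 => exact le_top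
    | s + 1 => exact bot_le
  · intro s
    match s with
    | 0 => exact htop
    | 1 => exact hrange
    | s + 2 => exact isGradedSub_bot
  · intro s hs
    match s with
    | 0 =>
      obtain ⟨l, c, hiso⟩ := h0
      refine ⟨l, c, GradedIso.trans ?_ hiso⟩
      obtain ⟨D, hD⟩ := hV.exists_subGrade htop
      refine gradedIso_quot hD hW (φ := g.comp (LieSubmodule.incl ⊤)) ?_ ?_ ?_
      · intro b
        obtain ⟨a, rfl⟩ := hex.surjective b
        exact ⟨⟨a, trivial⟩, rfl⟩
      · intro k v hv
        exact hex.right_deg k _ hv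
      · intro a
        exact hex.exact _
    | 1 =>
      obtain ⟨l, c, hiso⟩ := h1
      refine ⟨l, c, GradedIso.trans ?_ hiso⟩
      obtain ⟨D, hD⟩ := hV.exists_subGrade hrange
      choose s hs using fun a : f.range => a.2
      -- the inverse of `f` on its image
      let φ : f.range →ₗ⁅ℂ,Sl2t⁆ C :=
        { toFun := s
          map_add' := fun a b => hex.injective (by
            rw [map_add]; exact (hs _).trans (congrArg₂ (· + ·) (hs a) (hs b)).symm)
          map_smul' := fun c a => hex.injective (by
            rw [RingHom.id_apply, map_smul]; exact (hs _).trans (congrArg (c • ·) (hs a)).symm)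
          map_lie' := fun {b a} => hex.injective (by
            rw [LieModuleHom.map_lie]; exact (hs _).trans (congrArg (⁅b, ·⁆) (hs a)).symm) }
      have hφ : ∀ a, f (φ a) = a := hs
      refine gradedIso_quot hD hU (φ := φ) ?_ ?_ ?_
      · intro v
        exact ⟨⟨f v, v, rfl⟩, hex.injective (hφ _)⟩
      · intro k v hv
        rw [hU.mem_iff_of_injective hV (f := (f : C →ₗ[ℂ] A)) hex.left_deg hex.injective]
        change f (φ v) ∈ _
        rw [hφ]
        exact hv
      · intro a
        rw [← hex.injective.eq_iff, hφ, map_zero]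
        exact Iff.rfl
    | s + 2 => omega

end Graded

/-! ### Sums of shifted global Weyl modules -/

/-- A homomorphism out of `W(m)` sending the generator to a vector of degree `r` raises degrees
by `r`. -/
theorem GlobalWeyl.apply_mem_of_gen_mem {A : Type} [AddCommGroup A] [Module ℂ A]
    [LieRingModule Sl2t A] {V : ℤ → Submodule ℂ A}
    (hV : ∀ (a : Sl2) (r : ℕ) (s : ℤ) (v : A), v ∈ V s → ⁅cur a r, v⁆ ∈ V ((r : ℤ) + s))
    {m r : ℤ} {f : GlobalWeyl m →ₗ⁅ℂ,Sl2t⁆ A} (hf : f (gen m) ∈ V r) {k : ℤ}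
    {v : GlobalWeyl m} (hv : v ∈ grade m k) : f v ∈ V (k + r) := by
  obtain ⟨u, hu, rfl⟩ := hv
  have hle : USl2t.grade k ≤
      (V (k + r)).comap ((f : GlobalWeyl m →ₗ[ℂ] A) ∘ₗ (mk m).restrictScalars ℂ) := by
    clear hu
    rw [USl2t.grade, Submodule.span_le]
    rintro _ ⟨l, rfl, rfl⟩
    change f (mk m _) ∈ V _
    induction l with
    | nil => simpa [gen] using hf
    | cons p l ih =>
      have := hV p.1 p.2 _ _ ih
      rw [← f.map_lie, lie_mk] at this
      simpa [add_assoc] using this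
  exact hle hu

theorem isDegreeZero_sumLift {A : Type} [AddCommGroup A] [Module ℂ A]
    [LieRingModule Sl2t A] [LieModule ℂ Sl2t A] {V : ℤ → Submodule ℂ A} {ι : Type} [DecidableEq ι]
    (hV : ∀ (a : Sl2) (r : ℕ) (s : ℤ) (v : A), v ∈ V s → ⁅cur a r, v⁆ ∈ V ((r : ℤ) + s))
    {m : ℤ} {d : ι → ℤ} {f : ι → GlobalWeyl m →ₗ⁅ℂ,Sl2t⁆ A}
    (hf : ∀ i, f i (GlobalWeyl.gen m) ∈ V (d i)) :
    IsDegreeZero (weylSumGrade m d) V (sumLift f) := by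
  classical
  intro k v hv
  rw [weylSumGrade, mem_sumGrade] at hv
  rw [sumLift_apply]
  refine Submodule.sum_mem _ fun i _ => ?_
  have := GlobalWeyl.apply_mem_of_gen_mem hV (hf i) (hv i)
  rwa [sub_add_cancel] at this

theorem gradedIso_weylSum_reindex {ι κ : Type} (σ : ι ≃ κ) (m : ℤ) {d : ι → ℤ} {d' : κ → ℤ}
    (hd : ∀ i, d' (σ i) = d i) : GradedIso (weylSumGrade m d) (weylSumGrade m d') := by
  let E := DirectSum.lequivCongrLeft ℂ (M := fun _ : ι => GlobalWeyl m) σ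
  have hE : ∀ v j, E v j = v (σ.symm j) := fun v j => DirectSum.lequivCongrLeft_apply _ σ v j
  refine ⟨{ E with
    map_lie' := by
      intro a v
      change E ⁅a, v⁆ = ⁅a, E v⁆
      ext j
      rw [hE, DirectSum.lie_module_bracket_apply, DirectSum.lie_module_bracket_apply, hE] }, ?_⟩
  intro k v
  change _ ↔ E v ∈ _
  rw [weylSumGrade, weylSumGrade, mem_sumGrade, mem_sumGrade, ← σ.forall_congr_right]
  refine forall_congr' fun i => ?_
  rw [hE, σ.symm_apply_apply, shift, shift, hd]

/-- A sum of shifted global Weyl modules in which every shift occurs finitely often, written in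
terms of multiplicities. -/
theorem exists_gradedIso_weylSum {ι : Type} (m : ℤ) {d : ι → ℤ}
    (hd : ∀ k, Finite {i // d i = k}) :
    ∃ c : ℤ → ℕ, GradedIso (weylSumGrade m d)
      (weylSumGrade m (fun i : (Σ p : ℤ, Fin (c p)) => i.1)) := by
  refine ⟨fun k => Nat.card {i // d i = k}, gradedIso_weylSum_reindex
    ((Equiv.sigmaFiberEquiv d).symm.trans (Equiv.sigmaCongrRight fun k => Finite.equivFin _)) m ?_⟩
  intro i
  rfl

/-! ### The tensor product with `W(1)` -/

namespace GlobalWeyl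

theorem deg_X_pow (v : Fin 2 × ℕ) (k : ℕ) : deg (X v ^ k) = (k : ℂ) • X v ^ k := by
  induction k with
  | zero => simp
  | succ k ih =>
    rw [pow_succ, Derivation.leibniz, ih, euler_X, smul_eq_mul, smul_eq_mul]
    push_cast
    rw [one_smul, mul_smul_comm, mul_comm (X v) (X v ^ k)]
    module

/-- The vector `h tʳ w` of `W(1)` for `v = (0, r)` and `y tʳ w` for `v = (1, r)`, `w` being the
generator. -/
def genOne (v : Fin 2 × ℕ) : GlobalWeyl ((1 : ℕ) : ℤ) := ⁅lower v, gen ((1 : ℕ) : ℤ)⁆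

theorem toSym_genOne (v : Fin 2 × ℕ) : toSym 1 (genOne v) = X v := by
  rw [genOne, LieModuleHom.map_lie, toSym_gen, pow_one, lie_symV_def, der_lower]

theorem genOne_zero : genOne (0, 0) = gen ((1 : ℕ) : ℤ) := by
  apply toSym_injective
  rw [toSym_genOne, toSym_gen, pow_one]

theorem lie_x_genOne_zero (p : Polynomial ℂ) (r : ℕ) : ⁅(p ⊗ₜ x : Sl2t), genOne (0, r)⁆ = 0 := by
  apply toSym_injective
  rw [LieModuleHom.map_lie, toSym_genOne, lie_symV_def, der_x_X_zero, map_zero]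

theorem lie_x_genOne_one (s r : ℕ) : ⁅cur x s, genOne (1, r)⁆ = genOne (0, s + r) := by
  apply toSym_injective
  rw [LieModuleHom.map_lie, toSym_genOne, toSym_genOne, lie_symV_def, cur, der_x_X_one, ← pow_add,
    lin_X_pow]

theorem lie_h_genOne_zero (r : ℕ) : ⁅cur h 0, genOne (0, r)⁆ = genOne (0, r) := by
  apply toSym_injective
  rw [LieModuleHom.map_lie, toSym_genOne, lie_symV_def, cur, der_h_X_zero, ← pow_add, lin_X_pow,
    zero_add]

theorem lie_h_genOne_one (r : ℕ) : ⁅cur h 0, genOne (1, r)⁆ = - genOne (1, r) := by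
  apply toSym_injective
  rw [LieModuleHom.map_lie, map_neg, toSym_genOne, lie_symV_def, cur, der_h_X_one, ← pow_add,
    lin_X_pow, zero_add]

theorem lie_y_genOne_zero (s r : ℕ) : ⁅cur y s, genOne (0, r)⁆ = genOne (1, s + r) := by
  apply toSym_injective
  rw [LieModuleHom.map_lie, toSym_genOne, toSym_genOne, lie_symV_def, cur, der_y_X_zero, ← pow_add,
    lin_X_pow]

theorem genOne_mem_grade (v : Fin 2 × ℕ) : genOne v ∈ grade ((1 : ℕ) : ℤ) v.2 := by
  have := lie_mem_grade (if v.1 = 0 then h else y) v.2 0 _ (gen_mem_grade (m := ((1 : ℕ) : ℤ)))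
  rwa [add_zero] at this

theorem span_genOne : Submodule.span ℂ (Set.range genOne) = ⊤ := by
  rw [eq_top_iff]
  rintro w -
  obtain ⟨u, rfl⟩ := mk_surjective w
  have hu : u ∈ (weylIdeal ((1 : ℕ) : ℤ)).restrictScalars ℂ ⊔ wordSpan 1 :=
    weylIdeal_sup_wordSpan (n := 1) ▸ Submodule.mem_top
  obtain ⟨a, ha, b, hb, rfl⟩ := Submodule.mem_sup.1 hu
  rw [map_add, mk_eq_zero.2 ha, zero_add]
  have hle : wordSpan 1 ≤ (Submodule.span ℂ (Set.range genOne)).comap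
      ((mk ((1 : ℕ) : ℤ)).restrictScalars ℂ) := by
    rw [wordSpan, Submodule.span_le]
    rintro _ ⟨α, hα, -, rfl⟩
    change mk ((1 : ℕ) : ℤ) (word α.toList) ∈ Submodule.span ℂ (Set.range genOne)
    rw [← Multiset.length_toList] at hα
    match α.toList, hα with
    | [], _ => exact Submodule.subset_span ⟨(0, 0), genOne_zero⟩
    | [v], _ =>
      refine Submodule.subset_span ⟨v, ?_⟩
      rw [genOne, gen, lie_mk, word_cons]
      rfl
  exact hle hb

/-- The tensor product `W(n) ⊗ W(1)`. -/
abbrev TensorOne (n : ℕ) : Type := GlobalWeyl (n : ℤ) ⊗[ℂ] GlobalWeyl ((1 : ℕ) : ℤ)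

/-- The grading of `W(n) ⊗ W(1)`. -/
abbrev tensorOneGrade (n : ℕ) : ℤ → Submodule ℂ (TensorOne n) :=
  tensorGrade (grade (n : ℤ)) (grade ((1 : ℕ) : ℤ))

variable (n : ℕ)

/-- The embedding of `W(n) ⊗ W(1)` into the tensor square of the symmetric algebra. -/
def toSymTensor : TensorOne n →ₗ⁅ℂ,Sl2t⁆ SymV ⊗[ℂ] SymV :=
  TensorProduct.LieModule.map (toSym n) (toSym 1)

theorem toSymTensor_tmul (v : GlobalWeyl (n : ℤ)) (w : GlobalWeyl ((1 : ℕ) : ℤ)) :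
    toSymTensor n (v ⊗ₜ w) = toSym n v ⊗ₜ toSym 1 w := rfl

theorem toSymTensor_injective : Function.Injective (toSymTensor n) :=
  TensorProduct.map_injective_of_flat_flat (toSym n : GlobalWeyl (n : ℤ) →ₗ[ℂ] SymV)
    (toSym 1 : GlobalWeyl ((1 : ℕ) : ℤ) →ₗ[ℂ] SymV) toSym_injective toSym_injective

/-- The vector `wₙ ⊗ h tʳ w₁` for `v = (0, r)` and `wₙ ⊗ y tʳ w₁` for `v = (1, r)`. -/
def genTensor (v : Fin 2 × ℕ) : TensorOne n := gen (n : ℤ) ⊗ₜ genOne v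

variable {n}

theorem toSymTensor_genTensor (v : Fin 2 × ℕ) :
    toSymTensor n (genTensor n v) = (X (0, 0) ^ n) ⊗ₜ X v := by
  rw [genTensor, toSymTensor_tmul, toSym_gen, toSym_genOne]

theorem lie_x_genTensor_zero (p : Polynomial ℂ) (r : ℕ) :
    ⁅(p ⊗ₜ x : Sl2t), genTensor n (0, r)⁆ = 0 := by
  rw [genTensor, TensorProduct.LieModule.lie_tmul_right, lie_x_gen, lie_x_genOne_zero,
    TensorProduct.zero_tmul, TensorProduct.tmul_zero, add_zero]

theorem lie_x_genTensor_one_mem {N : LieSubmodule ℂ Sl2t (TensorOne n)}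
    (hN : ∀ r, genTensor n (0, r) ∈ N) (p : Polynomial ℂ) (r : ℕ) :
    ⁅(p ⊗ₜ x : Sl2t), genTensor n (1, r)⁆ ∈ N := by
  have hle : Submodule.span ℂ (Set.range (cur x)) ≤ (N : Submodule ℂ (TensorOne n)).comap
      (LinearMap.flip (LieModule.toEnd ℂ Sl2t (TensorOne n) : Sl2t →ₗ[ℂ] Module.End ℂ (TensorOne n))
        (genTensor n (1, r))) := by
    rw [Submodule.span_le]
    rintro _ ⟨s, rfl⟩
    change ⁅cur x s, genTensor n (1, r)⁆ ∈ N
    rw [genTensor, TensorProduct.LieModule.lie_tmul_right, cur, lie_x_gen, TensorProduct.zero_tmul,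
      zero_add, ← cur, lie_x_genOne_one]
    exact hN _
  exact hle (tmul_mem_span p x)

theorem lie_h_genTensor_zero (r : ℕ) :
    ⁅cur h 0, genTensor n (0, r)⁆ = ((n + 1 : ℕ) : ℂ) • genTensor n (0, r) := by
  rw [genTensor, TensorProduct.LieModule.lie_tmul_right, lie_h_gen, lie_h_genOne_zero,
    ← TensorProduct.smul_tmul']
  push_cast
  module

theorem lie_h_genTensor_one (r : ℕ) :
    ⁅cur h 0, genTensor n (1, r)⁆ = ((n : ℂ) - 1) • genTensor n (1, r) := by
  rw [genTensor, TensorProduct.LieModule.lie_tmul_right, lie_h_gen, lie_h_genOne_one,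
    ← TensorProduct.smul_tmul', TensorProduct.tmul_neg]
  push_cast
  module

theorem genTensor_mem_grade (v : Fin 2 × ℕ) : genTensor n v ∈ tensorOneGrade n v.2 := by
  refine Submodule.mem_iSup_of_mem 0 (Submodule.apply_mem_map₂ _ gen_mem_grade ?_)
  rw [sub_zero]
  exact genOne_mem_grade v

theorem exists_hasWeightsIn_tensorOne (n : ℕ) : ∃ s, HasWeightsIn s (TensorOne n) := by
  obtain ⟨s, hs⟩ := exists_hasWeightsIn (n : ℤ)
  obtain ⟨s', hs'⟩ := exists_hasWeightsIn ((1 : ℕ) : ℤ)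
  exact ⟨_, hs.tensor hs'⟩

theorem tensorOneGrade_lie_mem (a : Sl2) (r : ℕ) (s : ℤ) (v : TensorOne n)
    (hv : v ∈ tensorOneGrade n s) : ⁅cur a r, v⁆ ∈ tensorOneGrade n ((r : ℤ) + s) :=
  tensorGrade_lie_mem a r (lie_mem_grade a r) (lie_mem_grade a r) s v hv

/-- The vectors `wₙ ⊗ h tʳ w₁` and `wₙ ⊗ y tʳ w₁` generate `W(n) ⊗ W(1)`. -/
theorem eq_top_of_genTensor_mem {N : LieSubmodule ℂ Sl2t (TensorOne n)}
    (hN : ∀ v, genTensor n v ∈ N) : N = ⊤ := by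
  let p : Submodule ℂ (GlobalWeyl (n : ℤ)) :=
    ⨅ w, (N : Submodule ℂ (TensorOne n)).comap ((TensorProduct.mk ℂ _ _).flip w)
  have hp : ∀ u, u ∈ p ↔ ∀ w, u ⊗ₜ w ∈ N := fun u => by
    simp only [p, Submodule.mem_iInf]
    rfl
  have htop : p = ⊤ := by
    apply eq_top_of_gen_mem
    · rw [hp]
      intro w
      have hle : Submodule.span ℂ (Set.range genOne) ≤
          (N : Submodule ℂ (TensorOne n)).comap (TensorProduct.mk ℂ _ _ (gen (n : ℤ))) := by
        rw [Submodule.span_le]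
        rintro _ ⟨v, rfl⟩
        exact hN v
      exact hle (span_genOne ▸ Submodule.mem_top)
    · intro a u hu
      rw [hp] at hu ⊢
      intro w
      have h1 := N.lie_mem (x := a) (hu w)
      rw [TensorProduct.LieModule.lie_tmul_right] at h1
      exact (add_mem_cancel_right (hu _)).1 h1
  rw [eq_top_iff]
  rintro z -
  induction z using TensorProduct.induction_on with
  | zero => exact zero_mem _
  | add z w hz hw => exact add_mem hz hw
  | tmul u w => exact (hp u).1 (htop ▸ Submodule.mem_top) w

/-! ### The submodule generated by the vectors of highest weight -/

variable (n)

/-- The homomorphism `W(n + 1) → W(n) ⊗ W(1)` sending the generator to `wₙ ⊗ h tʳ w₁`. -/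
def highMap (r : ℕ) : GlobalWeyl ((n + 1 : ℕ) : ℤ) →ₗ⁅ℂ,Sl2t⁆ TensorOne n :=
  lift (genTensor n (0, r)) (fun p => lie_x_genTensor_zero p r) (lie_h_genTensor_zero r) <| by
    obtain ⟨s, hs⟩ := exists_hasWeightsIn_tensorOne n
    exact hs.toEnd_y_pow_eq_zero (lie_x_genTensor_zero _ r) (lie_h_genTensor_zero r)

theorem highMap_gen (r : ℕ) : highMap n r (gen _) = genTensor n (0, r) := lift_gen _ _ _ _

/-- In the symmetric algebra, the homomorphisms `highMap n r` are the twisted polarizations, up to a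
scalar. -/
theorem toSymTensor_highMap (r : ℕ) (u : GlobalWeyl ((n + 1 : ℕ) : ℤ)) :
    toSymTensor n (highMap n r u) = ((n + 1 : ℕ) : ℂ)⁻¹ • pol r (toSym (n + 1) u) := by
  have h0 : ((n + 1 : ℕ) : ℂ) ≠ 0 := Nat.cast_ne_zero.2 n.succ_ne_zero
  have hhom : (toSymTensor n).comp (highMap n r) =
      ((n + 1 : ℕ) : ℂ)⁻¹ • (polHom r).comp (toSym (n + 1)) := by
    apply hom_ext
    change toSymTensor n (highMap n r (gen _)) =
      ((n + 1 : ℕ) : ℂ)⁻¹ • pol r (toSym (n + 1) (gen _))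
    rw [highMap_gen, toSymTensor_genTensor, toSym_gen, Derivation.leibniz_pow, pol_X,
      Nat.add_sub_cancel, ← Nat.cast_smul_eq_nsmul ℂ, inv_smul_smul₀ h0, TensorProduct.smul_tmul',
      smul_eq_mul, mul_one, zero_add]
  exact LieModuleHom.congr_fun hhom u

theorem highMap_mem {N : LieSubmodule ℂ Sl2t (TensorOne n)} {r : ℕ} (hr : genTensor n (0, r) ∈ N)
    (u : GlobalWeyl ((n + 1 : ℕ) : ℤ)) : highMap n r u ∈ N := by
  have htop := eq_top_of_gen_mem (m := ((n + 1 : ℕ) : ℤ))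
    (p := (N : Submodule ℂ (TensorOne n)).comap (highMap n r : _ →ₗ[ℂ] TensorOne n))
    (by
      change highMap n r (gen _) ∈ N
      rwa [highMap_gen])
    (fun a u hu => by
      change highMap n r ⁅a, u⁆ ∈ N
      rw [LieModuleHom.map_lie]
      exact N.lie_mem hu)
  have hu : u ∈ (N : Submodule ℂ (TensorOne n)).comap (highMap n r : _ →ₗ[ℂ] TensorOne n) :=
    htop ▸ Submodule.mem_top
  exact hu

theorem exists_toSym_eq_pow_mul_pow : ∃ v : ℕ → GlobalWeyl (n : ℤ),
    ∀ k ≤ n, toSym n (v k) = X (0, 1) ^ k * X (0, 0) ^ (n - k) := by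
  have hex : ∀ k, ∃ v : GlobalWeyl (n : ℤ),
      k ≤ n → toSym n v = X (0, 1) ^ k * X (0, 0) ^ (n - k) := by
    intro k
    by_cases hk : k ≤ n
    · obtain ⟨v, hv⟩ := exists_toSym_eq (n := n) (p := X (0, 1) ^ k * X (0, 0) ^ (n - k)) (by
        rw [Derivation.leibniz, deg_X_pow, deg_X_pow, smul_eq_mul, smul_eq_mul, mul_smul_comm,
          mul_smul_comm, Nat.cast_sub hk, mul_comm (X (0, 0) ^ (n - k))]
        module)
      exact ⟨v, fun _ => hv⟩
    · exact ⟨0, fun hk' => absurd hk' hk⟩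
  choose v hv using hex
  exact ⟨v, hv⟩

/-- The first `n + 1` of the vectors `wₙ ⊗ h tʳ w₁` generate the submodule that they all generate.
With `vₖ` the element of `W(n)` corresponding to `X (0, 1) ^ k * X (0, 0) ^ (n - k)`, the images of
the analogous elements of `W(n + 1)` relate `vₖ ⊗ h tʳ⁺¹ w₁` to `vₖ₊₁ ⊗ h tʳ w₁`. -/
theorem genTensor_zero_mem {N : LieSubmodule ℂ Sl2t (TensorOne n)}
    (hN : ∀ r ≤ n, genTensor n (0, r) ∈ N) (R : ℕ) : genTensor n (0, R) ∈ N := by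
  induction R using Nat.strong_induction_on with
  | _ R ih =>
  rcases le_or_gt R n with hR | hR
  · exact hN R hR
  obtain ⟨v, hv⟩ := exists_toSym_eq_pow_mul_pow n
  obtain ⟨u, hu⟩ := exists_toSym_eq_pow_mul_pow (n + 1)
  have hmap : ∀ k ≤ n, ∀ r, ((n + 1 : ℕ) : ℂ) • highMap n r (u (k + 1)) =
      ((k + 1 : ℕ) : ℂ) • (v k ⊗ₜ[ℂ] genOne (0, r + 1)) +
        ((n - k : ℕ) : ℂ) • (v (k + 1) ⊗ₜ[ℂ] genOne (0, r)) := by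
    intro k hk r
    have h0 : ((n + 1 : ℕ) : ℂ) ≠ 0 := Nat.cast_ne_zero.2 n.succ_ne_zero
    apply toSymTensor_injective
    rw [map_smul, toSymTensor_highMap, smul_inv_smul₀ h0, map_add, map_smul, map_smul,
      toSymTensor_tmul, toSymTensor_tmul, toSym_genOne, toSym_genOne, hu _ (by omega), hv k hk,
      Nat.add_sub_add_right, Derivation.leibniz, Derivation.leibniz_pow, Derivation.leibniz_pow,
      pol_X, pol_X, Nat.add_sub_cancel, add_comm]
    simp only [← Nat.cast_smul_eq_nsmul ℂ, TensorProduct.smul_tmul', smul_eq_mul, mul_one,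
      ← mul_smul_comm, zero_add]
    congr 1
    · rw [mul_smul_comm, mul_smul_comm, mul_comm, add_comm 1 r]
    · rcases Nat.lt_or_ge k n with hkn | hkn
      · rw [hv (k + 1) hkn, ← Nat.sub_sub]; simp only [mul_smul_comm]
      · rw [Nat.sub_eq_zero_of_le hkn]; simp
  -- descending induction on `k = n - j`, starting from a vanishing coefficient `n - k`
  have hdesc : ∀ j k, k + j = n → v k ⊗ₜ[ℂ] genOne (0, R - k) ∈ N := by
    intro j
    induction j with
    | zero =>
      intro k hk
      have h1 := N.smul_mem ((n + 1 : ℕ) : ℂ)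
        (highMap_mem n (ih (R - k - 1) (by omega)) (u (k + 1)))
      rw [hmap k (by omega), show n - k = 0 by omega, Nat.cast_zero, zero_smul, add_zero,
        show R - k - 1 + 1 = R - k by omega] at h1
      exact (Submodule.smul_mem_iff (N : Submodule ℂ (TensorOne n))
        (Nat.cast_ne_zero.2 k.succ_ne_zero)).1 h1
    | succ j ihj =>
      intro k hk
      have h1 := N.smul_mem ((n + 1 : ℕ) : ℂ)
        (highMap_mem n (ih (R - k - 1) (by omega)) (u (k + 1)))
      have h2 := N.smul_mem ((n - k : ℕ) : ℂ) (ihj (k + 1) (by omega))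
      rw [hmap k (by omega), show R - k - 1 + 1 = R - k by omega] at h1
      rw [← Nat.sub_sub] at h2
      have h3 := sub_mem h1 h2
      rw [add_sub_cancel_right] at h3
      exact (Submodule.smul_mem_iff (N : Submodule ℂ (TensorOne n))
        (Nat.cast_ne_zero.2 k.succ_ne_zero)).1 h3
  have hv0 : v 0 = gen (n : ℤ) := by
    apply toSym_injective
    rw [hv 0 n.zero_le, toSym_gen, pow_zero, one_mul, Nat.sub_zero]
  have := hdesc n 0 (zero_add n)
  rwa [hv0] at this

/-- The sum of the homomorphisms `highMap n r` for `r ≤ n`. -/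
def highSum : (⨁ _ : Fin (n + 1), GlobalWeyl ((n + 1 : ℕ) : ℤ)) →ₗ⁅ℂ,Sl2t⁆ TensorOne n :=
  sumLift fun r : Fin (n + 1) => highMap n r

theorem highSum_injective : Function.Injective (highSum n) := by
  classical
  rw [← LieModuleHom.coe_toLinearMap, ← LinearMap.ker_eq_bot, LinearMap.ker_eq_bot']
  intro v hv
  have h0 : ((n + 1 : ℕ) : ℂ) ≠ 0 := Nat.cast_ne_zero.2 n.succ_ne_zero
  have hsum : ∑ r : Fin (n + 1), highMap n r (v r) = 0 := by
    have h1 : highSum n v = ∑ r ∈ DFinsupp.support v, highMap n r (v r) := sumLift_apply _ _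
    rw [← Finset.sum_subset (Finset.subset_univ (DFinsupp.support v)), ← h1]
    · exact hv
    · intro r _ hr
      rw [DFinsupp.notMem_support_iff.1 hr, map_zero]
  have hF : (fun r : Fin (n + 1) => toSym (n + 1) (v r)) = 0 := by
    refine eq_zero_of_sum_evDer_eq_zero (fun r => deg_toSym (v r)) fun c ε => ?_
    have h1 := congrArg (fun z => ((n + 1 : ℕ) : ℂ) • evSnd c ε (toSymTensor n z)) hsum
    simp only [map_sum, map_zero, toSymTensor_highMap, map_smul, evSnd_pol, Finset.smul_sum,
      smul_inv_smul₀ h0, smul_zero] at h1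
    exact h1
  ext r
  exact toSym_injective ((congrFun hF r).trans (map_zero _).symm)

theorem genTensor_zero_mem_range (r : ℕ) : genTensor n (0, r) ∈ (highSum n).range := by
  refine genTensor_zero_mem n (fun r hr => ?_) r
  refine ⟨DirectSum.of (fun _ => GlobalWeyl ((n + 1 : ℕ) : ℤ)) ⟨r, Nat.lt_succ_of_le hr⟩ (gen _),
    ?_⟩
  exact (sumLift_of _ _ _).trans (highMap_gen n r)

theorem isDegreeZero_highSum : IsDegreeZero
    (weylSumGrade ((n + 1 : ℕ) : ℤ) (fun r : Fin (n + 1) => ((r : ℕ) : ℤ))) (tensorOneGrade n)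
    (highSum n) :=
  isDegreeZero_sumLift tensorOneGrade_lie_mem fun r => by
    rw [highMap_gen]
    exact genTensor_mem_grade (0, r)

/-! ### The quotient -/

variable (m : ℕ)

/-- The class of `wₘ₊₁ ⊗ y tʳ w₁` in the cokernel of `highSum (m + 1)`. -/
def lowGen (r : ℕ) : TensorOne (m + 1) ⧸ (highSum (m + 1)).range :=
  LieSubmodule.Quotient.mk' _ (genTensor (m + 1) (1, r))

theorem lie_x_lowGen (p : Polynomial ℂ) (r : ℕ) : ⁅(p ⊗ₜ x : Sl2t), lowGen m r⁆ = 0 := by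
  rw [lowGen, ← LieModuleHom.map_lie, LieSubmodule.Quotient.mk_eq_zero]
  exact lie_x_genTensor_one_mem (genTensor_zero_mem_range _) p r

theorem lie_h_lowGen (r : ℕ) : ⁅cur h 0, lowGen m r⁆ = (m : ℂ) • lowGen m r := by
  have hm : ((m + 1 : ℕ) : ℂ) - 1 = m := by rw [Nat.cast_succ, add_sub_cancel_right]
  have h1 := lie_h_genTensor_one (n := m + 1) r
  rw [lowGen, ← LieModuleHom.map_lie, h1, hm, map_smul]

/-- The homomorphism from `W(m)` to the cokernel of `highSum (m + 1)` sending the generator to the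
class of `wₘ₊₁ ⊗ y tʳ w₁`. -/
def lowMap (r : ℕ) : GlobalWeyl (m : ℤ) →ₗ⁅ℂ,Sl2t⁆ TensorOne (m + 1) ⧸ (highSum (m + 1)).range :=
  lift (lowGen m r) (fun p => lie_x_lowGen m p r) (lie_h_lowGen m r) <| by
    obtain ⟨s, hs⟩ := exists_hasWeightsIn_tensorOne (m + 1)
    exact (hs.of_surjective (LieSubmodule.Quotient.surjective_mk' _)).toEnd_y_pow_eq_zero
      (lie_x_lowGen m _ r) (lie_h_lowGen m r)

theorem lowMap_gen (r : ℕ) : lowMap m r (gen _) =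
    lowGen m r := lift_gen _ _ _ _

/-- The sum of the homomorphisms `lowMap m r` over all `r`. -/
def lowSum : (⨁ _ : ℕ, GlobalWeyl (m : ℤ)) →ₗ⁅ℂ,Sl2t⁆
    TensorOne (m + 1) ⧸ (highSum (m + 1)).range :=
  sumLift (lowMap m)

theorem lowSum_surjective : Function.Surjective (lowSum m) := by
  have htop : (lowSum m).range.comap (LieSubmodule.Quotient.mk' _) = ⊤ := by
    apply eq_top_of_genTensor_mem
    rintro ⟨j, r⟩
    rw [LieSubmodule.mem_comap]
    fin_cases j
    · have h1 := (LieSubmodule.Quotient.mk_eq_zero _).2 (genTensor_zero_mem_range (m + 1) r)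
      exact ⟨0, (map_zero _).trans h1.symm⟩
    · exact ⟨DirectSum.of (fun _ => GlobalWeyl (m : ℤ)) r (gen _),
        (sumLift_of _ _ _).trans (lowMap_gen m r)⟩
  intro q
  obtain ⟨z, rfl⟩ := LieSubmodule.Quotient.surjective_mk' _ q
  have hz : z ∈ (lowSum m).range.comap (LieSubmodule.Quotient.mk' _) :=
    htop ▸ LieSubmodule.mem_top z
  exact hz

theorem contraction_genTensor_zero (c : ℂ) (r : ℕ) :
    contraction c (toSymTensor (m + 1) (genTensor (m + 1) (0, r))) = 0 := by
  rw [toSymTensor_genTensor, contraction_tmul, Derivation.leibniz_pow, Derivation.leibniz_pow]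
  simp [evDer_X]

theorem contraction_genTensor_one (c : ℂ) (r : ℕ) :
    contraction c (toSymTensor (m + 1) (genTensor (m + 1) (1, r))) =
      ((m + 1 : ℕ) : ℂ) • c ^ r • X (0, 0) ^ m := by
  rw [toSymTensor_genTensor, contraction_tmul, Derivation.leibniz_pow, Derivation.leibniz_pow]
  simp [evDer_X, smul_eq_C_mul]
  ring

theorem contraction_highSum (c : ℂ) (z : TensorOne (m + 1)) (hz : z ∈ (highSum (m + 1)).range) :
    (contractionHom c).comp (toSymTensor (m + 1)) z = 0 := by
  classical
  have hhom (r : ℕ) : ((contractionHom c).comp (toSymTensor (m + 1))).comp (highMap (m + 1) r) =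
      0 := by
    apply hom_ext
    change contraction c (toSymTensor (m + 1) (highMap (m + 1) r (gen _))) = 0
    rw [highMap_gen, contraction_genTensor_zero]
  obtain ⟨v, rfl⟩ := hz
  change ((contractionHom c).comp (toSymTensor (m + 1))) (highSum (m + 1) v) = 0
  rw [highSum, sumLift_apply, map_sum]
  exact Finset.sum_eq_zero fun r _ => LieModuleHom.congr_fun (hhom r) (v r)

/-- The contraction at `t = c`, on the cokernel of `highSum (m + 1)`. -/
def quotContraction (c : ℂ) :
    TensorOne (m + 1) ⧸ (highSum (m + 1)).range →ₗ⁅ℂ,Sl2t⁆ SymV :=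
  quotLift _ _ (contraction_highSum m c)

theorem quotContraction_lowMap (c : ℂ) (r : ℕ) (u : GlobalWeyl (m : ℤ)) :
    quotContraction m c (lowMap m r u) = ((m + 1 : ℕ) : ℂ) • c ^ r • toSym m u := by
  have hhom : (quotContraction m c).comp (lowMap m r) =
      ((m + 1 : ℕ) : ℂ) • c ^ r • toSym m := by
    apply hom_ext
    change quotContraction m c (lowMap m r (gen _)) =
      ((m + 1 : ℕ) : ℂ) • c ^ r • toSym m (gen _)
    rw [lowMap_gen, toSym_gen]
    exact contraction_genTensor_one m c r
  exact LieModuleHom.congr_fun hhom u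

/-- The contractions of an element of the kernel form a polynomial in `c` that vanishes
identically. -/
theorem lowSum_injective : Function.Injective (lowSum m) := by
  classical
  rw [← LieModuleHom.coe_toLinearMap, ← LinearMap.ker_eq_bot, LinearMap.ker_eq_bot']
  intro v hv
  have h0 : ((m + 1 : ℕ) : ℂ) ≠ 0 := Nat.cast_ne_zero.2 m.succ_ne_zero
  let P : Polynomial SymV := ∑ r ∈ DFinsupp.support v, Polynomial.monomial r (toSym m (v r))
  have hP : P = 0 := by
    apply Polynomial.eq_zero_of_infinite_isRoot
    refine (Set.infinite_range_of_injective (C_injective (Fin 2 × ℕ) ℂ)).mono ?_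
    rintro _ ⟨c, rfl⟩
    have h1 : quotContraction m c (lowSum m v) = 0 := by
      rw [show lowSum m v = 0 from hv, map_zero]
    rw [lowSum, sumLift_apply, map_sum] at h1
    simp only [quotContraction_lowMap, ← Finset.smul_sum] at h1
    rw [Set.mem_ofPred_eq, Polynomial.IsRoot.def, Polynomial.eval_finsetSum,
      ← (smul_eq_zero.1 h1).resolve_left h0]
    refine Finset.sum_congr rfl fun r _ => ?_
    rw [Polynomial.eval_monomial, ← C_pow, smul_eq_C_mul, mul_comm]
  ext r
  by_cases hr : r ∈ DFinsupp.support v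
  · have h1 := congrArg (fun Q => Polynomial.coeff Q r) hP
    simp only [P, Polynomial.finsetSum_coeff, Polynomial.coeff_monomial, Finset.sum_ite_eq', hr,
      if_true, Polynomial.coeff_zero] at h1
    exact toSym_injective (h1.trans (map_zero _).symm)
  · exact DFinsupp.notMem_support_iff.1 hr

theorem isDegreeZero_lowSum : IsDegreeZero (weylSumGrade (m : ℤ) (fun r : ℕ => (r : ℤ)))
    (quotGrade (tensorOneGrade (m + 1)) (highSum (m + 1)).range) (lowSum m) :=
  isDegreeZero_sumLift (fun a r => quotGrade_lie_mem a r (tensorOneGrade_lie_mem a r)) fun r => by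
    rw [lowMap_gen]
    exact ⟨_, genTensor_mem_grade (1, r), rfl⟩

/-- For `n = 0` the cokernel vanishes: `w₀ ⊗ y tʳ w₁` is the image of `w₀ ⊗ h w₁` under `y ⊗ tʳ`. -/
theorem highSum_zero_range : (highSum 0).range = ⊤ := by
  apply eq_top_of_genTensor_mem
  rintro ⟨j, r⟩
  fin_cases j
  · exact genTensor_zero_mem_range 0 r
  · have h1 : ⁅cur y r, gen ((0 : ℕ) : ℤ)⁆ = 0 := by
      apply toSym_injective
      rw [LieModuleHom.map_lie, toSym_gen, lie_symV_def, pow_zero, Derivation.map_one_eq_zero,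
        map_zero]
    have h2 := (highSum 0).range.lie_mem (x := cur y r) (genTensor_zero_mem_range 0 0)
    have h3 : ⁅cur y r, genTensor 0 (0, 0)⁆ = genTensor 0 (1, r) := by
      rw [genTensor, TensorProduct.LieModule.lie_tmul_right, h1, lie_y_genOne_zero,
        TensorProduct.zero_tmul]
      exact zero_add _
    rw [h3] at h2
    exact h2

/-- The cokernel of `highSum n` is the sum of the shifts of `W(n - 1)`. -/
theorem exists_bijective_quot {q : ℤ} (hq : q = (n : ℤ) - 1) :
    ∃ θ : (⨁ _ : ℕ, GlobalWeyl q) →ₗ⁅ℂ,Sl2t⁆ TensorOne n ⧸ (highSum n).range,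
      Function.Bijective θ ∧ IsDegreeZero (weylSumGrade q (fun r : ℕ => (r : ℤ)))
        (quotGrade (tensorOneGrade n) (highSum n).range) θ := by
  cases n with
  | zero =>
    have := subsingleton_of_neg (m := q) (by omega)
    refine ⟨0, ⟨fun v w _ => ?_, fun z => ⟨0, ?_⟩⟩, fun k v _ => zero_mem _⟩
    · ext i
      exact Subsingleton.elim _ _
    · obtain ⟨z, rfl⟩ := LieSubmodule.Quotient.surjective_mk' _ z
      refine (map_zero _).trans ((LieSubmodule.Quotient.mk_eq_zero _).2 ?_).symm
      rw [highSum_zero_range]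
      trivial
  | succ m =>
    obtain rfl : q = (m : ℤ) := by omega
    exact ⟨lowSum m, ⟨lowSum_injective m, lowSum_surjective m⟩, isDegreeZero_lowSum m⟩

end GlobalWeyl

open GlobalWeyl in
/-- The short exact sequence and the filtration, for global Weyl modules whose highest weights are
equal, but not syntactically, to `1`, `n + 1` and `n - 1`. -/
theorem tensor_one_filtration_and_exact (n : ℕ) {o p q : ℤ} (ho : o = ((1 : ℕ) : ℤ))
    (hp : p = ((n + 1 : ℕ) : ℤ)) (hq : q = (n : ℤ) - 1) :
    HasGlobalWeylFiltration (tensorGrade (grade n) (grade o)) ∧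
      ∃ (f : (⨁ _ : Fin (n + 1), GlobalWeyl p) →ₗ⁅ℂ,Sl2t⁆ (GlobalWeyl n ⊗[ℂ] GlobalWeyl o))
        (g : (GlobalWeyl n ⊗[ℂ] GlobalWeyl o) →ₗ⁅ℂ,Sl2t⁆ (⨁ _ : ℕ, GlobalWeyl q)),
        IsShortExact (weylSumGrade p (fun r : Fin (n + 1) => ((r : ℕ) : ℤ)))
          (tensorGrade (grade n) (grade o)) (weylSumGrade q (fun r : ℕ => (r : ℤ))) f g := by
  subst ho hp
  obtain ⟨e, hU⟩ := exists_isGradedByOp_weylSum ((n + 1 : ℕ) : ℤ)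
    (fun r : Fin (n + 1) => ((r : ℕ) : ℤ))
  have hV := isGradedByOp_tensor (isGradedByOp (n : ℤ)) (isGradedByOp ((1 : ℕ) : ℤ))
  obtain ⟨d, hW⟩ := exists_isGradedByOp_weylSum q (fun r : ℕ => (r : ℤ))
  have hinj : Function.Injective fun r : ℕ => (r : ℤ) := Nat.cast_injective
  have hfin : ∀ k : ℤ, {r : ℕ | (r : ℤ) ≤ k}.Finite := fun k =>
    (Set.finite_Iic k.toNat).subset fun r hr => by
      simp only [Set.mem_ofPred_eq, Set.mem_Iic] at hr ⊢
      omega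
  obtain ⟨θ, hθ, hθdeg⟩ := exists_bijective_quot n hq
  obtain ⟨g, hg⟩ := exists_isShortExact hU hV hW
    (isBddObject_weylSum _ _ (fun r => Int.natCast_nonneg _) fun k => Set.toFinite _)
    (isBddObject_tensor _ _)
    (isBddObject_weylSum _ _ (fun r => Int.natCast_nonneg _) hfin)
    (highSum_injective n) (isDegreeZero_highSum n) hθ hθdeg
  refine ⟨hg.hasGlobalWeylFiltration hU hV hW ⟨n + 1, exists_gradedIso_weylSum _ fun k => ?_⟩ ?_,
    highSum n, g, hg⟩
  · exact Subtype.finite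
  · -- if `q < 0` then `W(q) = 0`, and the empty sum of shifts of `W(0)` serves
    rcases lt_or_ge q 0 with hq0 | hq0
    · have hs := subsingleton_of_neg hq0
      obtain ⟨d', hd'⟩ := exists_isGradedByOp_weylSum ((0 : ℕ) : ℤ)
        (fun i : (Σ _ : ℤ, Fin 0) => i.1)
      refine ⟨0, fun _ => 0, gradedIso_of_bijective hW hd' (φ := 0)
        ⟨fun v w _ => ?_, fun v => ⟨0, ?_⟩⟩ fun k v _ => zero_mem _⟩
      · ext i
        exact Subsingleton.elim _ _
      · ext i
        exact i.2.elim0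
    · obtain ⟨l, rfl⟩ := Int.eq_ofNat_of_zero_le hq0
      refine ⟨l, exists_gradedIso_weylSum _ fun k => ?_⟩
      exact ((hfin k).subset fun r hr => le_of_eq hr).to_subtype

end CurrentSl2

end

theorem proposition5p3 (n : ℕ) :
    CurrentSl2.HasGlobalWeylFiltration
        (CurrentSl2.tensorGrade (CurrentSl2.GlobalWeyl.grade n) (CurrentSl2.GlobalWeyl.grade 1)) ∧
      ∃ (f : (⨁ _ : Fin (n + 1), CurrentSl2.GlobalWeyl ((n : ℤ) + 1)) →ₗ⁅ℂ,CurrentSl2.Sl2t⁆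
            (CurrentSl2.GlobalWeyl n ⊗[ℂ] CurrentSl2.GlobalWeyl 1))
        (g : (CurrentSl2.GlobalWeyl n ⊗[ℂ] CurrentSl2.GlobalWeyl 1) →ₗ⁅ℂ,CurrentSl2.Sl2t⁆
            (⨁ _ : ℕ, CurrentSl2.GlobalWeyl ((n : ℤ) - 1))),
        CurrentSl2.IsShortExact
          (CurrentSl2.weylSumGrade ((n : ℤ) + 1) (fun r : Fin (n + 1) => ((r : ℕ) : ℤ)))
          (CurrentSl2.tensorGrade (CurrentSl2.GlobalWeyl.grade n) (CurrentSl2.GlobalWeyl.grade 1))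
          (CurrentSl2.weylSumGrade ((n : ℤ) - 1) (fun r : ℕ => (r : ℤ))) f g :=
  CurrentSl2.tensor_one_filtration_and_exact n Nat.cast_one.symm (Nat.cast_succ n).symm rfl
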